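/- **Setting.** Let $\mathcal L$ be a finite-dimensional complex simple Lie algebra with Cartan subalgebra $\mathcal H$, root system $\Phi$ of type $A_n$ ($n\ge 3$), $D_n$ ($n\ge 4$), $E_6$, $E_7$ or $E_8$, and base $\Delta$ of $\Phi$ with highest root $\omega$. For $\alpha\in\Phi$ let $h_\alpha\in\mathcal H$ be the coroot, and let $\{h_\alpha\mid\alpha\in\Delta\}\cup\{e_\alpha\mid\alpha\in\Phi\}$ be a Chevalley basis, so that $[e_\alpha,e_{-\alpha}]=h_\alpha$, and the constants in $[e_\alpha,e_\beta]=c_{\alpha,\beta}e_{\alpha+\beta}$ (for $\alpha,\beta,\alpha+\beta\in\Phi$) satisfy $c_{\alpha,\beta}=-c_{-\alpha,-\beta}$. Let $\kappa$ be the Killing form rescaled so that $\kappa(h_\alpha,h_\alpha)=2$ for all $\alpha\in\Phi$. A *Frobenius algebra* is a vector space with a commutative (not necessarily associative) bilinear product and a non-degenerate symmetric bilinear form $\langle\cdot,\cdot\rangle$ with $\langle u v,w\rangle=\langle u,v w\rangle$. It is a Frobenius algebra *for $\mathcal L$* if the vector space is an $\mathcal L$-representation and product and form are $\mathcal L$-equivariant.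 A morphism of Frobenius algebras for $\mathcal L$ is an $\mathcal L$-equivariant linear map preserving product and form. **The algebra $(\mathcal A,\ast,\mathcal B)$.** On the $\mathcal L$-module $S^2(\mathcal L)$, let $$\ell_1\ell_2\bullet\ell_3\ell_4=\tfrac14\bigl(\kappa(\ell_1,\ell_3)\ell_2\ell_4+\kappa(\ell_1,\ell_4)\ell_2\ell_3+\kappa(\ell_2,\ell_3)\ell_1\ell_4+\kappa(\ell_2,\ell_4)\ell_1\ell_3\bigr),$$ $$B(\ell_1\ell_2,\ell_3\ell_4)=\tfrac12\bigl(\kappa(\ell_1,\ell_3)\kappa(\ell_2,\ell_4)+\kappa(\ell_1,\ell_4)\kappa(\ell_2,\ell_3)\bigr).$$ Let $\mathcal V$ be the subrepresentation generated by $e_\omega e_\omega$ and let $\mathcal A$ be its orthogonal complement with respect to $B$. Then $S^2(\mathcal L)=\mathcal A\oplus\mathcal V$. Write $v\mapsto\overline v$ for the resulting projection onto $\mathcal A$, and put $v\ast w=\overline{v\bullet w}$ and $\mathcal B(v,w)=B(v,w)$ for $v,w\in\mathcal A$. Then $(\mathcal A,\ast,\mathcal B)$ is a Frobenius algebra for $\mathcal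 L$. **The algebra $(\mathfrak J,\diamond,B_A)$.** Let $\zeta:S^2(\mathcal L)\to\operatorname{End}(\mathcal L)$ be the map $\zeta(\ell_1\ell_2)(\ell)=\frac12(\kappa(\ell_2,\ell)\ell_1+\kappa(\ell_1,\ell)\ell_2)$. Put $j_\alpha=\zeta(h_\alpha h_\alpha)$, $z_\alpha=\zeta(e_\alpha e_{-\alpha})$ and $v_\alpha=2z_\alpha-j_\alpha$, with spans $\mathfrak J,\mathfrak Z,\mathfrak V$ respectively, and put $\mathfrak S_0=\mathfrak J+\mathfrak Z$. The space $\mathfrak S_0$ is closed under the Jordan product $f\bullet g=\frac12(fg+gf)$. Let $\mathfrak A_0$ be the orthogonal complement of $\mathfrak V$ in $\mathfrak S_0$ for the trace form $\operatorname{tr}(fg)$. Then $\mathfrak S_0=\mathfrak A_0\oplus\mathfrak V$. Let $\pi:\mathfrak S_0\to\mathfrak A_0$ be the resulting projection. Its restriction $\pi_J:\mathfrak J\to\mathfrak A_0$ is bijective, and for $a,b\in\mathfrak J$ we put $$a\diamond b=\pi_J^{-1}\bigl(\pi(\pi_J(a)\bullet\pi_J(b))\bigr),\qquad B_A(a,b)=\operatorname{tr}(\pi_J(a)\pi_J(b)).$$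 **The space $\mathfrak A$.** Let $\Lambda_0$ be the set of sums of two orthogonal roots. For each $\lambda\in\Lambda_0$ fix roots $\alpha_\lambda,\beta_\lambda$ with $\alpha_\lambda+\beta_\lambda=\lambda$, and let $n_\lambda$ be the number of unordered pairs of roots with sum $\lambda$. Let $\mathfrak A$ be the direct sum of $\mathfrak J$, a copy of $\alpha^\perp=\{h\in\mathcal H\mid\alpha(h)=0\}$ for each $\alpha\in\Phi$, and a vector space with basis $\{x_\lambda\mid\lambda\in\Lambda_0\}$. For $h\in\mathcal H$ let $[h]_\alpha$ be the orthogonal projection of $h$ onto $\alpha^\perp$, regarded as an element of the copy of $\alpha^\perp$ indexed by $\alpha$. There is a linear isomorphism $\theta:\mathfrak A\to\mathcal A$ with $$\theta(j_\alpha)=\overline{h_\alpha h_\alpha},\qquad\theta([h]_\alpha)=\overline{e_\alpha h},\qquad\theta(x_\lambda)=\overline{e_{\alpha_\lambda}e_{\beta_\lambda}}\qquad(\alpha\in\Phi,\ h\in\mathcal H,\ \lambda\in\Lambda_0).$$ Let $\mathcal L$ act on $\mathfrak A$ by $\ell\cdot v=\theta^{-1}(\ell\cdot\theta(v))$. Then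 $e_{-\alpha}\cdot[h]_\alpha\in\mathfrak J$ for $h\in\alpha^\perp$. Put $\mathfrak e_\lambda=\frac1{4n_\lambda}\sum_{\alpha\in\Phi,\ \lambda(h_\alpha)=2}j_\alpha\in\mathfrak J$, and define bilinear maps $\ast:\mathfrak J\times\mathfrak A\to\mathfrak A$ and $\mathcal B:\mathfrak J\times\mathfrak A\to\mathbb C$ by $$\begin{aligned} v\ast w&=v\diamond w,&\mathcal B(v,w)&=B_A(v,w)&&(w\in\mathfrak J),\\ v\ast w&=\tfrac12\,e_\alpha\cdot\bigl(v\diamond(e_{-\alpha}\cdot w)\bigr),&\mathcal B(v,w)&=0&&(w=[h]_\alpha,\ h\in\alpha^\perp,\ \alpha\in\Phi),\\ v\ast w&=B_A(v,\mathfrak e_\lambda)\,w,&\mathcal B(v,w)&=0&&(w=c\,x_\lambda,\ c\in\mathbb C,\ \lambda\in\Lambda_0). \end{aligned}$$ **Theorem.** All the assertions made in the constructions above hold. The maps $\ast$ and $\mathcal B$ on $\mathfrak J\times\mathfrak A$ extend uniquely to bilinear maps on $\mathfrak A\times\mathfrak A$ such that $(\mathfrak A,\ast,\mathcal B)$ is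 a Frobenius algebra for $\mathcal L$. Moreover, $\theta$ is an isomorphism of Frobenius algebras for $\mathcal L$ from $(\mathfrak A,\ast,\mathcal B)$ onto $(\mathcal A,\ast,\mathcal B)$. -/

import Mathlib

open scoped TensorProduct DirectSum

noncomputable section

attribute [local instance 100] LieRing.ofAssociativeRing

namespace SymSquareAlgebra

section Frobenius

/-- `(V, mul, form)` is a Frobenius algebra over `ℂ`: a commutative, not necessarily associative
bilinear product with a non-degenerate symmetric associating bilinear form. -/
structure IsFrobenius {V : Type*} [AddCommGroup V] [Module ℂ V]
    (mul : V →ₗ[ℂ] V →ₗ[ℂ] V) (form : LinearMap.BilinForm ℂ V) : Prop where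
  form_symm : ∀ v w, form v w = form w v
  form_nondeg : form.Nondegenerate
  mul_comm : ∀ v w, mul v w = mul w v
  form_assoc : ∀ u v w, form (mul u v) w = form u (mul v w)

/-- `(V, mul, form)` is a Frobenius algebra for the Lie algebra `L` acting on `V` through the
representation `ρ`: it is Frobenius, and product and form are `L`-equivariant. -/
structure IsFrobeniusFor {L V : Type*} [LieRing L] [LieAlgebra ℂ L] [AddCommGroup V] [Module ℂ V]
    (ρ : L →ₗ⁅ℂ⁆ Module.End ℂ V)
    (mul : V →ₗ[ℂ] V →ₗ[ℂ] V) (form : LinearMap.BilinForm ℂ V) : Prop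
    extends IsFrobenius mul form where
  mul_equivariant : ∀ ℓ v w, ρ ℓ (mul v w) = mul (ρ ℓ v) w + mul v (ρ ℓ w)
  form_equivariant : ∀ ℓ v w, form (ρ ℓ v) w + form v (ρ ℓ w) = 0

/-- The linear map `φ` is a morphism of Frobenius algebras for `L`. -/
structure IsFrobeniusHom {L V V' : Type*} [LieRing L] [LieAlgebra ℂ L]
    [AddCommGroup V] [Module ℂ V] [AddCommGroup V'] [Module ℂ V']
    (ρ : L →ₗ⁅ℂ⁆ Module.End ℂ V)
    (mul : V →ₗ[ℂ] V →ₗ[ℂ] V) (form : LinearMap.BilinForm ℂ V)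
    (ρ' : L →ₗ⁅ℂ⁆ Module.End ℂ V')
    (mul' : V' →ₗ[ℂ] V' →ₗ[ℂ] V') (form' : LinearMap.BilinForm ℂ V')
    (φ : V →ₗ[ℂ] V') : Prop where
  map_mul : ∀ v w, φ (mul v w) = mul' (φ v) (φ w)
  map_form : ∀ v w, form' (φ v) (φ w) = form v w
  equivariant : ∀ ℓ v, φ (ρ ℓ v) = ρ' ℓ (φ v)

/-- The Jordan product `f • g = (fg + gf) / 2` on endomorphisms. -/
def jordan (E : Type*) [AddCommGroup E] [Module ℂ E] :
    Module.End ℂ E →ₗ[ℂ] Module.End ℂ E →ₗ[ℂ] Module.End ℂ E :=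
  (1 / 2 : ℂ) • (LinearMap.mul ℂ (Module.End ℂ E) + (LinearMap.mul ℂ (Module.End ℂ E)).flip)

/-- The trace form `(f, g) ↦ tr (fg)` on endomorphisms. -/
def trForm (E : Type*) [AddCommGroup E] [Module ℂ E] : LinearMap.BilinForm ℂ (Module.End ℂ E) :=
  (LinearMap.mul ℂ (Module.End ℂ E)).compr₂ (LinearMap.trace ℂ E)

lemma jordan_apply {E : Type*} [AddCommGroup E] [Module ℂ E] (f g : Module.End ℂ E) :
    jordan E f g = (1 / 2 : ℂ) • (f * g + g * f) := rfl

lemma trForm_apply {E : Type*} [AddCommGroup E] [Module ℂ E] (f g : Module.End ℂ E) :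
    trForm E f g = LinearMap.trace ℂ E (f * g) := rfl

end Frobenius

section SymmetricSquare

variable (L : Type*) [LieRing L] [LieAlgebra ℂ L]

/-- The subrepresentation of `L ⊗ L` spanned by the tensors `x ⊗ y - y ⊗ x`. -/
def antisymm : LieSubmodule ℂ L (L ⊗[ℂ] L) where
  __ := Submodule.span ℂ {t : L ⊗[ℂ] L | ∃ x y : L, t = x ⊗ₜ[ℂ] y - y ⊗ₜ[ℂ] x}
  lie_mem {ℓ t} ht := by
    change t ∈ Submodule.span ℂ _ at ht
    change ⁅ℓ, t⁆ ∈ Submodule.span ℂ _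
    induction ht using Submodule.span_induction with
    | mem t ht =>
      obtain ⟨x, y, rfl⟩ := ht
      have h : ⁅ℓ, x ⊗ₜ[ℂ] y - y ⊗ₜ[ℂ] x⁆ =
          (⁅ℓ, x⁆ ⊗ₜ[ℂ] y - y ⊗ₜ[ℂ] ⁅ℓ, x⁆) + (x ⊗ₜ[ℂ] ⁅ℓ, y⁆ - ⁅ℓ, y⁆ ⊗ₜ[ℂ] x) := by
        rw [lie_sub, TensorProduct.LieModule.lie_tmul_right,
          TensorProduct.LieModule.lie_tmul_right]
        abel
      rw [h]
      exact Submodule.add_mem _ (Submodule.subset_span ⟨_, _, rfl⟩)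
        (Submodule.subset_span ⟨_, _, rfl⟩)
    | zero => simp
    | add s t _ _ hs ht => rw [lie_add]; exact Submodule.add_mem _ hs ht
    | smul c t _ ht => rw [lie_smul]; exact Submodule.smul_mem _ _ ht

/-- The symmetric square of `L`, as an `L`-module. -/
abbrev S2 : Type _ := (L ⊗[ℂ] L) ⧸ antisymm L

variable {L}

/-- The element `x y` of the symmetric square. -/
def sprod : L →ₗ[ℂ] L →ₗ[ℂ] S2 L :=
  (TensorProduct.mk ℂ L L).compr₂ (LieSubmodule.Quotient.mk' (antisymm L)).toLinearMap

lemma lie_sprod (ℓ x y : L) : ⁅ℓ, sprod x y⁆ = sprod ⁅ℓ, x⁆ y + sprod x ⁅ℓ, y⁆ := by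
  change ⁅ℓ, LieSubmodule.Quotient.mk' (antisymm L) (x ⊗ₜ[ℂ] y)⁆ =
    LieSubmodule.Quotient.mk' (antisymm L) (⁅ℓ, x⁆ ⊗ₜ[ℂ] y) +
    LieSubmodule.Quotient.mk' (antisymm L) (x ⊗ₜ[ℂ] ⁅ℓ, y⁆)
  rw [← LieModuleHom.map_lie, TensorProduct.LieModule.lie_tmul_right, map_add]

lemma S2.induction {p : S2 L → Prop} (h : ∀ x y, p (sprod x y))
    (hadd : ∀ a b, p a → p b → p (a + b)) (a : S2 L) : p a := by
  obtain ⟨t, rfl⟩ := LieSubmodule.Quotient.surjective_mk' (antisymm L) a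
  induction t using TensorProduct.induction_on with
  | zero => simpa using h 0 0
  | tmul x y => exact h x y
  | add s t hs ht => rw [map_add]; exact hadd _ _ hs ht

variable (L) in
/-- The section `σ : S²(L) → L ⊗ L`, `x y ↦ (x ⊗ y + y ⊗ x) / 2`. -/
def sigma : S2 L →ₗ[ℂ] L ⊗[ℂ] L :=
  (antisymm L).toSubmodule.liftQ
    ((1 / 2 : ℂ) • (LinearMap.id + (TensorProduct.comm ℂ L L).toLinearMap)) (by
      change Submodule.span ℂ _ ≤ _
      rw [Submodule.span_le]
      rintro _ ⟨x, y, rfl⟩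
      simp only [SetLike.mem_coe, LinearMap.mem_ker, LinearMap.smul_apply, LinearMap.add_apply,
        LinearMap.id_apply, map_sub, LinearEquiv.coe_coe, TensorProduct.comm_tmul]
      module)

lemma sigma_sprod (x y : L) :
    sigma L (sprod x y) = (1 / 2 : ℂ) • (x ⊗ₜ[ℂ] y + y ⊗ₜ[ℂ] x) := rfl

/-- The linear map `S²(L) → N` sending `x y` to `(f x y + f y x) / 2`. -/
def symLift {N : Type*} [AddCommGroup N] [Module ℂ N] :
    (L →ₗ[ℂ] L →ₗ[ℂ] N) →ₗ[ℂ] (S2 L →ₗ[ℂ] N) :=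
  (LinearMap.lcomp ℂ N (sigma L)) ∘ₗ (TensorProduct.lift.equiv (.id ℂ) L L N).toLinearMap

lemma symLift_sprod {N : Type*} [AddCommGroup N] [Module ℂ N] (f : L →ₗ[ℂ] L →ₗ[ℂ] N) (x y : L) :
    symLift f (sprod x y) = (1 / 2 : ℂ) • (f x y + f y x) := by
  change TensorProduct.lift f (sigma L (sprod x y)) = _
  rw [sigma_sprod, map_smul, map_add, TensorProduct.lift.tmul, TensorProduct.lift.tmul]

variable (κ : LinearMap.BilinForm ℂ L)

/-- The map `ζ : S²(L) → Hom(L, L)`; see `zeta_sprod`. -/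
def zeta : S2 L →ₗ[ℂ] Module.End ℂ L :=
  symLift ((LinearMap.smulRightₗ (R := ℂ) (M := L) (M₂ := L) ∘ₗ κ).flip)

lemma zeta_sprod (x y ℓ : L) :
    zeta κ (sprod x y) ℓ = (1 / 2 : ℂ) • (κ y ℓ • x + κ x ℓ • y) := by
  rw [zeta, symLift_sprod]
  rfl

/-- The product `•` on `S²(L)`; see `bullet_sprod` for its formula. -/
def bullet : S2 L →ₗ[ℂ] S2 L →ₗ[ℂ] S2 L :=
  symLift <| LinearMap.mk₂ ℂ
    (fun x y => symLift (LinearMap.mk₂ ℂ (fun c d => κ x c • sprod y d)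
      (fun c c' d => by rw [map_add, add_smul]) (fun r c d => by rw [map_smul, smul_assoc])
      (fun c d d' => by rw [map_add, smul_add]) (fun r c d => by rw [map_smul, smul_comm])))
    (fun x x' y => by
      rw [← map_add]; congr 1; ext c d
      simp [add_smul])
    (fun r x y => by
      rw [← map_smul]; congr 1; ext c d
      simp [mul_smul])
    (fun x y y' => by
      rw [← map_add]; congr 1; ext c d
      simp)
    (fun r x y => by
      rw [← map_smul]; congr 1; ext c d
      simp [smul_comm (κ x c) r])

lemma bullet_sprod (a b c d : L) :
    bullet κ (sprod a b) (sprod c d) = (1 / 4 : ℂ) •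
      (κ a c • sprod b d + κ a d • sprod b c + κ b c • sprod a d + κ b d • sprod a c) := by
  simp only [bullet, symLift_sprod, LinearMap.mk₂_apply, LinearMap.smul_apply,
    LinearMap.add_apply]
  module

/-- The bilinear form `B` on `S²(L)`; see `bform_sprod` for its formula. -/
def bform : LinearMap.BilinForm ℂ (S2 L) :=
  symLift <| LinearMap.mk₂ ℂ
    (fun x y => symLift (LinearMap.mk₂ ℂ (fun c d => κ x c * κ y d)
      (fun c c' d => by rw [map_add, add_mul])
      (fun r c d => by rw [map_smul, smul_eq_mul, smul_eq_mul, mul_assoc])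
      (fun c d d' => by rw [map_add, mul_add])
      (fun r c d => by rw [map_smul, smul_eq_mul, smul_eq_mul, mul_left_comm])))
    (fun x x' y => by
      rw [← map_add]; congr 1; ext c d
      simp [add_mul])
    (fun r x y => by
      rw [← map_smul]; congr 1; ext c d
      simp [mul_assoc])
    (fun x y y' => by
      rw [← map_add]; congr 1; ext c d
      simp [mul_add])
    (fun r x y => by
      rw [← map_smul]; congr 1; ext c d
      simp [mul_left_comm])

lemma bform_sprod (a b c d : L) :
    bform κ (sprod a b) (sprod c d) = (1 / 2 : ℂ) * (κ a c * κ b d + κ a d * κ b c) := by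
  simp only [bform, symLift_sprod, LinearMap.mk₂_apply, LinearMap.smul_apply,
    LinearMap.add_apply, smul_eq_mul]
  ring

lemma bform_lieInvariant (hκ : κ.lieInvariant L) : (bform κ).lieInvariant L := by
  intro ℓ a b
  induction a using S2.induction with
  | hadd a a' ha ha' => simp only [lie_add, map_add, LinearMap.add_apply, ha, ha']; ring
  | h x y =>
    induction b using S2.induction with
    | hadd b b' hb hb' => simp only [lie_add, map_add, hb, hb']; ring
    | h c d =>
      simp only [lie_sprod, map_add, LinearMap.add_apply, bform_sprod, hκ ℓ]
      ring

end SymmetricSquare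

section Roots

open LieAlgebra LieAlgebra.IsKilling

variable {L : Type*} [LieRing L] [LieAlgebra ℂ L] [FiniteDimensional ℂ L] [IsKilling ℂ L]
variable (H : LieSubalgebra ℂ L) [H.IsCartanSubalgebra]

/-- A base is of type `Aₙ` (`n ≥ 3`), `Dₙ` (`n ≥ 4`), `E₆`, `E₇` or `E₈`. -/
def IsADE {H : LieSubalgebra ℂ L} [H.IsCartanSubalgebra] (b : (rootSystem H).Base) : Prop :=
  (∃ n, 3 ≤ n ∧ ∃ f : b.support ≃ Fin n, b.cartanMatrix.reindex f f = CartanMatrix.A n) ∨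
  (∃ n, 4 ≤ n ∧ ∃ f : b.support ≃ Fin n, b.cartanMatrix.reindex f f = CartanMatrix.D n) ∨
  (∃ f : b.support ≃ Fin 6, b.cartanMatrix.reindex f f = CartanMatrix.E₆) ∨
  (∃ f : b.support ≃ Fin 7, b.cartanMatrix.reindex f f = CartanMatrix.E₇) ∨
  (∃ f : b.support ≃ Fin 8, b.cartanMatrix.reindex f f = CartanMatrix.E₈)

/-- `ω` is the highest root with respect to the base `b`: for every root `β`, the difference
`ω - β` is a sum of simple roots. -/
def IsHighest {H : LieSubalgebra ℂ L} [H.IsCartanSubalgebra] (b : (rootSystem H).Base)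
    (ω : H.root) : Prop :=
  ∀ β : H.root, (rootSystem H).root ω - (rootSystem H).root β ∈
    AddSubmonoid.closure ((rootSystem H).root '' b.support)

variable {H}

/-- The root `-α`. -/
def negRoot (α : H.root) : H.root :=
  ⟨-α.1, by
    have := α.2
    simp only [LieSubalgebra.root, Finset.mem_filter_univ] at this ⊢
    exact this.neg⟩

/-- The coroot `h_α`, as an element of `L`. -/
def hh (α : H.root) : L := (coroot α.1 : H)

variable (H) in
/-- The family `e_α` of root vectors of a Chevalley basis. The remaining members of the basis are
the coroots of the simple roots. -/
structure Chevalley where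
  /-- The root vectors. -/
  e : H.root → L
  e_mem : ∀ α, e α ∈ rootSpace H α.1
  lie_e_neg : ∀ α, ⁅e α, e (negRoot α)⁆ = hh α
  /-- `c_{α,β} = -c_{-α,-β}` for the structure constants `[e_α, e_β] = c_{α,β} e_{α+β}`. -/
  lie_neg : ∀ (α β γ : H.root) (c : ℂ),
    (rootSystem H).root α + (rootSystem H).root β = (rootSystem H).root γ →
    ⁅e α, e β⁆ = c • e γ → ⁅e (negRoot α), e (negRoot β)⁆ = (-c) • e (negRoot γ)

/-- The rescaled Killing form `κ(x, y) = 2 t⁻¹ tr(ad x ad y)`, `t = tr(ad h_ω ad h_ω)`. In the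
simply laced case it does not depend on the root `ω`. -/
def kappa (ω : H.root) : LinearMap.BilinForm ℂ L :=
  (2 * (killingForm ℂ L (hh ω) (hh ω))⁻¹) • killingForm ℂ L

lemma kappa_lieInvariant (ω : H.root) : (kappa ω).lieInvariant L := by
  intro x y z
  simp only [kappa, LinearMap.smul_apply, smul_eq_mul]
  rw [← lie_skew, map_neg, LinearMap.neg_apply, LieModule.traceForm_apply_lie_apply]
  ring

variable (C : Chevalley H) (ω : H.root)

/-- The subrepresentation `𝒱` of `S²(L)` generated by `e_ω e_ω`. -/
def calV : LieSubmodule ℂ L (S2 L) := LieSubmodule.lieSpan ℂ L {sprod (C.e ω) (C.e ω)}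

/-- The orthogonal complement `𝒜` of `𝒱` in `S²(L)` with respect to `B`. -/
def calA : LieSubmodule ℂ L (S2 L) :=
  InvariantForm.orthogonal (bform (kappa ω)) (bform_lieInvariant _ (kappa_lieInvariant ω)) (calV C ω)

section

variable {C ω}
variable (hV : IsCompl (calA C ω).toSubmodule (calV C ω).toSubmodule)

/-- The orthogonal projection `S²(L) → 𝒜`, `v ↦ v̄`. -/
def bar : S2 L →ₗ[ℂ] calA C ω := Submodule.projectionOnto _ _ hV

/-- The product `v ∗ w`, the projection of `v • w`, on `𝒜`. -/
def calMul : calA C ω →ₗ[ℂ] calA C ω →ₗ[ℂ] calA C ω :=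
  ((bullet (kappa ω)).domRestrict₁₂ (calA C ω).toSubmodule (calA C ω).toSubmodule).compr₂ (bar hV)

end

/-- The form `𝓑`, the restriction of `B` to `𝒜`. -/
def calForm : LinearMap.BilinForm ℂ (calA C ω) :=
  (bform (kappa ω)).domRestrict₁₂ (calA C ω).toSubmodule (calA C ω).toSubmodule

/-- `j_α = ζ(h_α h_α)`. -/
def jEnd (α : H.root) : Module.End ℂ L := zeta (kappa ω) (sprod (hh α) (hh α))

/-- `z_α = ζ(e_α e_{-α})`. -/
def zEnd (α : H.root) : Module.End ℂ L := zeta (kappa ω) (sprod (C.e α) (C.e (negRoot α)))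

/-- The space `𝔍` spanned by the `j_α`. -/
def frakJ : Submodule ℂ (Module.End ℂ L) := Submodule.span ℂ (Set.range (jEnd ω))

/-- The space `ℨ` spanned by the `z_α`. -/
def frakZ : Submodule ℂ (Module.End ℂ L) := Submodule.span ℂ (Set.range (zEnd C ω))

/-- The space `𝔖₀ = 𝔍 + ℨ`. -/
def frakS : Submodule ℂ (Module.End ℂ L) := frakJ ω ⊔ frakZ C ω


lemma jEnd_apply (α : H.root) (ℓ : L) : jEnd ω α ℓ = kappa ω (hh α) ℓ • hh α := by
  rw [jEnd, zeta_sprod]; module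

lemma zEnd_apply (α : H.root) (ℓ : L) : zEnd C ω α ℓ = (1 / 2 : ℂ) •
    (kappa ω (C.e (negRoot α)) ℓ • C.e α + kappa ω (C.e α) ℓ • C.e (negRoot α)) := by
  rw [zEnd, zeta_sprod]

lemma kappa_comm (x y : L) : kappa ω x y = kappa ω y x := by
  simp only [kappa, LinearMap.smul_apply]
  rw [LieModule.traceForm_comm ℂ L L x y]

lemma hh_mem_rootSpace (α : H.root) : hh α ∈ rootSpace H (0 : H → ℂ) := by
  rw [LieAlgebra.rootSpace_zero_eq]
  exact (coroot α.1 : H).2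

lemma kappa_eq_zero {α β : H → ℂ} {x y : L} (hx : x ∈ rootSpace H α) (hy : y ∈ rootSpace H β)
    (h : α + β ≠ 0) : kappa ω x y = 0 := by
  simp only [kappa, LinearMap.smul_apply]
  rw [killingForm_apply_eq_zero_of_mem_rootSpace_of_add_ne_zero ℂ L H hx hy h, smul_zero]

lemma root_coe_ne_zero (α : H.root) : (α.1 : H → ℂ) ≠ 0 := by
  have := α.2
  simpa only [LieSubalgebra.root, Finset.mem_filter_univ] using! this

lemma kappa_hh_e (α β : H.root) : kappa ω (hh α) (C.e β) = 0 :=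
  kappa_eq_zero ω (hh_mem_rootSpace α) (C.e_mem β) (by rw [zero_add]; exact root_coe_ne_zero β)

lemma kappa_e_e (α β : H.root) (h : β ≠ negRoot α) : kappa ω (C.e α) (C.e β) = 0 := by
  refine kappa_eq_zero ω (C.e_mem α) (C.e_mem β) fun h0 => h ?_
  apply Subtype.ext
  apply DFunLike.coe_injective
  exact (neg_eq_of_add_eq_zero_right h0).symm

lemma negRoot_negRoot (α : H.root) : negRoot (negRoot α) = α :=
  Subtype.ext (neg_neg α.1)

lemma zEnd_negRoot (α : H.root) : zEnd C ω (negRoot α) = zEnd C ω α := by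
  ext ℓ
  rw [zEnd_apply, zEnd_apply, negRoot_negRoot, add_comm]

lemma jEnd_mul_zEnd (α β : H.root) : jEnd ω α * zEnd C ω β = 0 := by
  ext ℓ
  simp [Module.End.mul_apply, zEnd_apply, jEnd_apply, kappa_hh_e]

lemma zEnd_mul_jEnd (α β : H.root) : zEnd C ω β * jEnd ω α = 0 := by
  ext ℓ
  simp [Module.End.mul_apply, zEnd_apply, jEnd_apply, kappa_comm ω (C.e _) (hh _), kappa_hh_e]

lemma zEnd_mul_zEnd_of_ne {α β : H.root} (h₁ : β ≠ α) (h₂ : β ≠ negRoot α) :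
    zEnd C ω α * zEnd C ω β = 0 := by
  have h₃ : negRoot β ≠ α := fun h => h₂ (by rw [← h, negRoot_negRoot])
  have h₄ : negRoot β ≠ negRoot α := fun h => h₁ (by
    rw [← negRoot_negRoot β, h, negRoot_negRoot])
  ext ℓ
  simp [Module.End.mul_apply, zEnd_apply, kappa_e_e, negRoot_negRoot, h₁, h₂, h₃, h₄]

lemma e_ne (α : H.root) : negRoot α ≠ α := by
  intro h
  refine root_coe_ne_zero α ?_
  have h' : -(α.1 : H → ℂ) = α.1 := congrArg (fun a : H.root => (a.1 : H → ℂ)) h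
  exact neg_eq_self.mp h'

lemma zEnd_mul_self (α : H.root) :
    zEnd C ω α * zEnd C ω α = ((1 / 2 : ℂ) * kappa ω (C.e α) (C.e (negRoot α))) • zEnd C ω α := by
  ext ℓ
  have h₁ : kappa ω (C.e α) (C.e α) = 0 := kappa_e_e C ω α α (e_ne α).symm
  have h₂ : kappa ω (C.e (negRoot α)) (C.e (negRoot α)) = 0 :=
    kappa_e_e C ω _ _ (by rw [negRoot_negRoot]; exact e_ne α)
  simp only [Module.End.mul_apply, LinearMap.smul_apply, zEnd_apply, map_smul, map_add, h₁, h₂,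
    kappa_comm ω (C.e (negRoot α)) (C.e α)]
  module

lemma jordan_jEnd_mem (α β : H.root) : jordan L (jEnd ω α) (jEnd ω β) ∈ frakJ ω := by
  obtain ⟨γ, k, m, hγ, hm⟩ : ∃ (γ : H.root) (k m : ℂ), hh γ = hh α - k • hh β ∧
      kappa ω (hh α) (hh β) = m * k := by
    refine ⟨(rootSystem H).reflectionPerm β α, β.1 (coroot α.1),
      (2 * (killingForm ℂ L (hh ω) (hh ω))⁻¹) *
        (2 * (β.1 ((cartanEquivDual H).symm β.1))⁻¹), ?_, ?_⟩
    · exact congrArg (fun x : H => (x : L)) ((rootSystem H).coroot_reflectionPerm (i := β) α)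
    · rw [kappa_comm]
      have h := traceForm_coroot β.1 (coroot α.1)
      change killingForm ℂ L (hh β) (hh α) = _ at h
      simp only [kappa, LinearMap.smul_apply, smul_eq_mul, h, nsmul_eq_mul, Nat.cast_ofNat]
      ring
  have h : jordan L (jEnd ω α) (jEnd ω β) = (-(1 / 2 : ℂ) * m) • jEnd ω γ +
      ((1 / 2 : ℂ) * m) • jEnd ω α + ((1 / 2 : ℂ) * m * k ^ 2) • jEnd ω β := by
    ext ℓ
    simp only [jordan_apply, Module.End.mul_apply, LinearMap.smul_apply, LinearMap.add_apply,
      jEnd_apply, hγ, map_smul, map_sub, LinearMap.sub_apply, smul_eq_mul,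
      kappa_comm ω (hh β) (hh α), hm]
    module
  rw [h]
  refine Submodule.add_mem _ (Submodule.add_mem _ ?_ ?_) ?_ <;>
    exact Submodule.smul_mem _ _ (Submodule.subset_span ⟨_, rfl⟩)

lemma jordan_zEnd_mem (α β : H.root) : jordan L (zEnd C ω α) (zEnd C ω β) ∈ frakZ C ω := by
  have key : jordan L (zEnd C ω α) (zEnd C ω α) ∈ frakZ C ω := by
    rw [jordan_apply, zEnd_mul_self]
    refine Submodule.smul_mem _ _ (Submodule.add_mem _ ?_ ?_) <;>
      exact Submodule.smul_mem _ _ (Submodule.subset_span ⟨_, rfl⟩)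
  by_cases h₁ : β = α
  · rw [h₁]; exact key
  by_cases h₂ : β = negRoot α
  · rw [h₂, zEnd_negRoot]; exact key
  have h₃ : α ≠ negRoot β := fun h => h₂ (by rw [h, negRoot_negRoot])
  rw [jordan_apply, zEnd_mul_zEnd_of_ne C ω h₁ h₂, zEnd_mul_zEnd_of_ne C ω (Ne.symm h₁) h₃]
  simp

/-- `𝔖₀` is closed under the Jordan product. -/
lemma jordan_mem (a b : Module.End ℂ L) (ha : a ∈ frakS C ω) (hb : b ∈ frakS C ω) :
    jordan L a b ∈ frakS C ω := by
  have hS : frakS C ω = Submodule.span ℂ (Set.range (jEnd ω) ∪ Set.range (zEnd C ω)) := by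
    rw [Submodule.span_union]; rfl
  rw [hS] at ha hb
  induction ha, hb using Submodule.span_induction₂ with
  | mem_mem x y hx hy =>
    rcases hx with ⟨α, rfl⟩ | ⟨α, rfl⟩ <;> rcases hy with ⟨β, rfl⟩ | ⟨β, rfl⟩
    · exact Submodule.mem_sup_left (jordan_jEnd_mem ω α β)
    · rw [jordan_apply, jEnd_mul_zEnd, zEnd_mul_jEnd]; simp
    · rw [jordan_apply, jEnd_mul_zEnd, zEnd_mul_jEnd]; simp
    · exact Submodule.mem_sup_right (jordan_zEnd_mem C ω α β)
  | zero_left y hy => simp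
  | zero_right x hx => simp
  | add_left x y z hx hy hz h₁ h₂ => rw [map_add]; exact Submodule.add_mem _ h₁ h₂
  | add_right x y z hx hy hz h₁ h₂ => rw [map_add]; exact Submodule.add_mem _ h₁ h₂
  | smul_left r x y hx hy h => rw [map_smul]; exact Submodule.smul_mem _ _ h
  | smul_right r x y hx hy h => rw [map_smul]; exact Submodule.smul_mem _ _ h

/-- The Jordan product on `𝔖₀`. -/
def sMul : frakS C ω →ₗ[ℂ] frakS C ω →ₗ[ℂ] frakS C ω :=
  LinearMap.mk₂ ℂ (fun a b => ⟨jordan L a b, jordan_mem C ω a b a.2 b.2⟩)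
    (fun a a' b => Subtype.ext (by simp)) (fun r a b => Subtype.ext (by simp))
    (fun a b b' => Subtype.ext (by simp)) (fun r a b => Subtype.ext (by simp))

/-- The trace form on `𝔖₀`. -/
def sForm : LinearMap.BilinForm ℂ (frakS C ω) :=
  (trForm L).domRestrict₁₂ (frakS C ω) (frakS C ω)

/-- `𝔖₀ ∋ v_α = 2 z_α - j_α`. -/
def vEnd (α : H.root) : frakS C ω :=
  ⟨(2 : ℂ) • zEnd C ω α - jEnd ω α, Submodule.sub_mem _
    (Submodule.mem_sup_right (Submodule.smul_mem _ _ (Submodule.subset_span ⟨α, rfl⟩)))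
    (Submodule.mem_sup_left (Submodule.subset_span ⟨α, rfl⟩))⟩

/-- The span `𝔙` of the `v_α`, in `𝔖₀`. -/
def frakV : Submodule ℂ (frakS C ω) := Submodule.span ℂ (Set.range (vEnd C ω))

/-- The orthogonal complement `𝔄₀` of `𝔙` in `𝔖₀`. -/
def frakA₀ : Submodule ℂ (frakS C ω) := (sForm C ω).orthogonal (frakV C ω)

section

variable {C ω}
variable (hV₀ : IsCompl (frakA₀ C ω) (frakV C ω))

/-- The restriction `π_J : 𝔍 → 𝔄₀` of the orthogonal projection `π : 𝔖₀ → 𝔄₀`. -/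
def piJ : frakJ ω →ₗ[ℂ] frakA₀ C ω :=
  Submodule.projectionOnto _ _ hV₀ ∘ₗ Submodule.inclusion le_sup_left

/-- The product `a ⋄ b = π(a • b)` on `𝔄₀`. -/
def diamond₀ : frakA₀ C ω →ₗ[ℂ] frakA₀ C ω →ₗ[ℂ] frakA₀ C ω :=
  ((sMul C ω).domRestrict₁₂ (frakA₀ C ω) (frakA₀ C ω)).compr₂ (Submodule.projectionOnto _ _ hV₀)

variable (hJ : Function.Bijective (piJ hV₀))

/-- The product `a ⋄ b = π_J⁻¹(π_J a ⋄ π_J b)` on `𝔍`. -/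
def diamond : frakJ ω →ₗ[ℂ] frakJ ω →ₗ[ℂ] frakJ ω :=
  ((diamond₀ hV₀).compl₁₂ (piJ hV₀) (piJ hV₀)).compr₂
    (LinearEquiv.ofBijective (piJ hV₀) hJ).symm.toLinearMap

/-- The form `B_A(a, b) = B(π_J a, π_J b)` on `𝔍`. -/
def formJ : LinearMap.BilinForm ℂ (frakJ ω) :=
  ((sForm C ω).domRestrict₁₂ (frakA₀ C ω) (frakA₀ C ω)).compl₁₂ (piJ hV₀) (piJ hV₀)

end

/-- `j_α` as an element of `𝔍`. -/
def jJ (α : H.root) : frakJ ω := ⟨jEnd ω α, Submodule.subset_span ⟨α, rfl⟩⟩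

variable (H) in
/-- The set `Λ₀` of sums of two orthogonal roots. -/
def Lam₀ : Set (Module.Dual ℂ H) :=
  {μ | ∃ α β : H.root, (rootSystem H).pairing α β = 0 ∧
    (rootSystem H).root α + (rootSystem H).root β = μ}

/-- The number `n_μ` of unordered pairs of roots with sum `μ`. -/
def nPairs (μ : Module.Dual ℂ H) : ℕ :=
  {s : Sym2 H.root | ∃ α β : H.root, s = s(α, β) ∧
    (rootSystem H).root α + (rootSystem H).root β = μ}.ncard

open Classical in
/-- `𝔢_μ = (4 n_μ)⁻¹ ∑ j_α`, over the roots `α` with `κ(α, μ) = μ(h_α) = 2`. -/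
def frakE (μ : Module.Dual ℂ H) : frakJ ω :=
  (4 * (nPairs μ : ℂ))⁻¹ • ∑ α : H.root with μ (coroot α.1) = 2, jJ ω α

/-- `α^⊥`, the space of `h ∈ H` with `κ(h, α) = α(h) = 0`. -/
def perp (α : H.root) : Submodule ℂ H := LinearMap.ker ((rootSystem H).root α)

/-- The orthogonal projection of `h ∈ H` onto `α^⊥`. -/
def toPerp (α : H.root) (h : H) : perp α :=
  ⟨h - ((1 / 2 : ℂ) * (rootSystem H).root α h) • coroot α.1, by
    have h2 : (rootSystem H).root α (coroot α.1) = 2 :=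
      root_apply_coroot (by
      have := α.2
      simpa only [LieSubalgebra.root, Finset.mem_filter_univ] using this)
    rw [perp, LinearMap.mem_ker, map_sub, map_smul, h2, smul_eq_mul]
    ring⟩

/-- The vector space `𝔄 = 𝔍 ⊕ ⨁ α^⊥ ⊕ ⟨x_μ⟩`. -/
abbrev FrakA : Type _ := frakJ ω × (⨁ α : H.root, perp α) × (Lam₀ H →₀ ℂ)

/-- The inclusion of `𝔍` in `𝔄`. -/
def inJ : frakJ ω →ₗ[ℂ] FrakA ω := LinearMap.inl ℂ _ _

open Classical in
/-- The inclusion of the copy of `α^⊥` in `𝔄`. -/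
def inPerp (α : H.root) : perp α →ₗ[ℂ] FrakA ω :=
  LinearMap.inr ℂ _ _ ∘ₗ LinearMap.inl ℂ _ _ ∘ₗ DirectSum.lof ℂ H.root (fun α => perp α) α

/-- The element `[h]_α` of `𝔄`. -/
def br (α : H.root) (h : H) : FrakA ω := inPerp ω α (toPerp α h)

/-- The basis vector `x_μ` of `𝔄`. -/
def xx (μ : Lam₀ H) : FrakA ω := (0, 0, Finsupp.single μ 1)

section

variable {C ω}

/-- `θ : 𝔄 → 𝒜` is the linear isomorphism with `j_α ↦ bar (h_α h_α)`,
`[h]_α ↦ bar (e_α h)` and `x_μ ↦ bar (e_{a(μ)} e_{b(μ)})`, where `μ = a(μ) + b(μ)`. -/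
structure IsTheta (hV : IsCompl (calA C ω).toSubmodule (calV C ω).toSubmodule)
    (a b : Lam₀ H → H.root) (θ : FrakA ω ≃ₗ[ℂ] calA C ω) : Prop where
  map_j : ∀ α, θ (inJ ω (jJ ω α)) = bar hV (sprod (hh α) (hh α))
  map_br : ∀ α (h : H), θ (br ω α h) = bar hV (sprod (C.e α) (h : L))
  map_x : ∀ μ, θ (xx ω μ) = bar hV (sprod (C.e (a μ)) (C.e (b μ)))

variable (C ω) in
/-- The action of `L` on `𝒜`. -/
def calAct : L →ₗ⁅ℂ⁆ Module.End ℂ (calA C ω) := LieModule.toEnd ℂ L (calA C ω)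

/-- The action `ℓ · v = θ⁻¹(ℓ · θ(v))` of `L` on `𝔄`. -/
def frakAct (θ : FrakA ω ≃ₗ[ℂ] calA C ω) : L →ₗ⁅ℂ⁆ Module.End ℂ (FrakA ω) :=
  θ.symm.lieConj.toLieHom.comp (calAct C ω)

lemma frakAct_apply (θ : FrakA ω ≃ₗ[ℂ] calA C ω) (ℓ : L) (v : FrakA ω) :
    frakAct θ ℓ v = θ.symm ⁅ℓ, θ v⁆ := rfl

/-- The bilinear maps `mul` and `form` on `𝔄` extend the partial product `𝔍 × 𝔄 → 𝔄` and the
partial form `𝔍 × 𝔄 → ℂ`. The second clause of `mul` reads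
`v ∗ w = ½ e_α · (v ⋄ (e_{-α} · w))` for `w ∈ α^⊥`, where `e_{-α} · w` lies in `𝔍`. -/
structure Extends {hV₀ : IsCompl (frakA₀ C ω) (frakV C ω)}
    (hJ : Function.Bijective (piJ hV₀)) (θ : FrakA ω ≃ₗ[ℂ] calA C ω)
    (mul : FrakA ω →ₗ[ℂ] FrakA ω →ₗ[ℂ] FrakA ω) (form : LinearMap.BilinForm ℂ (FrakA ω)) :
    Prop where
  mul_J : ∀ v w : frakJ ω, mul (inJ ω v) (inJ ω w) = inJ ω (diamond hV₀ hJ v w)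
  mul_perp : ∀ (v : frakJ ω) (α : H.root) (h : perp α),
    mul (inJ ω v) (inPerp ω α h) = (1 / 2 : ℂ) • frakAct θ (C.e α)
      (inJ ω (diamond hV₀ hJ v (frakAct θ (C.e (negRoot α)) (inPerp ω α h)).1))
  mul_x : ∀ (v : frakJ ω) (μ : Lam₀ H),
    mul (inJ ω v) (xx ω μ) = formJ hV₀ v (frakE ω μ.1) • xx ω μ
  form_J : ∀ v w : frakJ ω, form (inJ ω v) (inJ ω w) = formJ hV₀ v w
  form_perp : ∀ (v : frakJ ω) (α : H.root) (h : perp α), form (inJ ω v) (inPerp ω α h) = 0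
  form_x : ∀ (v : frakJ ω) (μ : Lam₀ H), form (inJ ω v) (xx ω μ) = 0

end

end Roots
end SymSquareAlgebra
end

open SymSquareAlgebra LieAlgebra.IsKilling

noncomputable section

set_option linter.unusedSectionVars false

namespace SymSquareAlgebra

open LieAlgebra LieAlgebra.IsKilling

/-! Everything rests on one property of `𝒱`. The root vector e_ω is extremal, [e_ω,[e_ω,z]] =
-2κ(e_ω,z)e_ω, so e_ω e_ω lies in the radical of the invariant form E = `lieForm` - 2B. That radical
is a submodule, hence contains all of `𝒱` (`lieForm_eq_of_mem_calV`). Expanding `lieForm` over the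
roots turns this into linear equations for the entries B(v, xy) of v in `𝒱`. Conversely, acting on
e_ω e_ω by root vectors produces explicit elements of `𝒱`, that is, relations in the quotient `𝒜`.

In weight zero the equations express the entries of v on H × H through those on the e_β e_{-β}.
Since the matrix with entries 4δ_{αβ} + β(h_α)² is positive definite, a zero-weight element of `𝒱`
orthogonal to all v_α vanishes (`eq_zero_of_hasWt_zero`). An sl₂ argument reduces the other weights
to this one and gives `𝒱 ∩ 𝒜 = 0`. The map ζ is injective and carries • to the Jordan product and B
to the trace form, so the same weight-zero facts yield `𝔖₀ = 𝔄₀ ⊕ 𝔙` and the bijectivity of π_J. The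
map θ is injective because E pairs the three summands of `𝔄` nondegenerately with suitable test
vectors (`preTheta_mem_calV`), and surjective by the explicit relations.

Product and form on `𝔄` are transported from `𝒜` along θ, so what remains is to compute products
with `𝔍`. On `𝔍` itself, the projection onto `𝒜` agrees with π under ζ (`zeta_bar`). On [h]_α,
equivariance gives the stated formula once bar(e_α h) ∗ bar(h_α h') = 0 is known for h, h' in α^⊥
(`calMul_bar_e_h_bar_h_h`). On x_λ, multiplication by a zero-weight element is computed on an
explicit representative in `𝒜` of a multiple of bar(e_α e_β), on which • acts diagonally
(`card_smul_calMul_bar_e_e`). Uniqueness follows from equivariance, because `𝔍` generates `𝔄` as an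
L-module. -/

lemma _root_.RootPairing.span_coroot_pairing_ne_zero {ι K M N : Type*} [Field K] [CharZero K]
    [AddCommGroup M] [Module K M] [AddCommGroup N] [Module K N] (P : RootPairing ι K M N)
    [P.IsIrreducible] [Finite ι] [P.IsCrystallographic] (i : ι) :
    Submodule.span K (P.coroot '' {j | P.pairing j i ≠ 0}) = ⊤ := by
  refine P.flip.span_root_image_eq_top_of_forall_orthogonal {j | P.pairing j i ≠ 0}
    ⟨i, by simp⟩ fun j hj k hk => ?_
  have hmem : ∀ k, P.pairing k i ≠ 0 →
      P.coroot k ∈ Submodule.span K (P.coroot '' {j | P.pairing j i ≠ 0}) :=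
    fun k hk => Submodule.subset_span ⟨k, hk, rfl⟩
  by_contra hjk
  have hjk' : P.pairing j k ≠ 0 := fun h0 => hjk ⟨P.pairing_eq_zero_iff.mp h0, h0⟩
  refine hj ?_
  -- A root j not orthogonal to some k of the set is either in the set itself, or else the
  -- reflection of k in j is; in the second case the coroot of j is a multiple of the difference of
  -- two coroots from the set.
  by_cases hji : P.pairing j i = 0
  · have hl : P.coroot (P.reflectionPerm j k) = P.coroot k - P.pairing j k • P.coroot j :=
      P.coroot_reflectionPerm j k
    have hli : P.pairing (P.reflectionPerm j k) i ≠ 0 := by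
      rw [Ne, P.pairing_eq_zero_iff, ← P.root_coroot_eq_pairing, hl, map_sub, map_smul,
        P.root_coroot_eq_pairing, P.root_coroot_eq_pairing, P.pairing_eq_zero_iff.mp hji,
        smul_zero, sub_zero, P.pairing_eq_zero_iff]
      exact hk
    have h3 := Submodule.sub_mem _ (hmem k hk) (hmem _ hli)
    rw [hl, sub_sub_cancel] at h3
    exact (Submodule.smul_mem_iff _ hjk').mp h3
  · exact hmem j hji

/-! ### Integer pairings in a simply laced root system -/

section SimplyLaced

variable {L : Type*} [LieRing L] [LieAlgebra ℂ L] [FiniteDimensional ℂ L] [IsKilling ℂ L]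
variable {H : LieSubalgebra ℂ L} [H.IsCartanSubalgebra]

variable (H) in
/-- The root system is simply laced: the pairing of roots is symmetric. -/
class SimplyLaced : Prop where
  pairing_symm : ∀ α β : H.root,
    (rootSystem H).pairingIn ℤ α β = (rootSystem H).pairingIn ℤ β α

/-- The integer `α(h_β)`. -/
def pI (α β : H.root) : ℤ := (rootSystem H).pairingIn ℤ α β

lemma apply_coroot (α β : H.root) : α.1 (coroot β.1) = (pI α β : ℂ) := by
  have := (rootSystem H).algebraMap_pairingIn ℤ α β
  rw [rootSystem_pairing_apply] at this
  rw [← this]; rfl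

lemma pI_eq_iff {α β : H.root} {n : ℤ} : pI α β = n ↔ α.1 (coroot β.1) = (n : ℂ) := by
  rw [apply_coroot, Int.cast_inj]

@[simp] lemma pI_self (α : H.root) : pI α α = 2 := by
  rw [pI_eq_iff, root_apply_coroot (LieSubalgebra.isNonZero_coe_root α)]; norm_num

lemma negRoot_apply (α : H.root) (h : H) : (negRoot α).1 h = -α.1 h := rfl

lemma coroot_negRoot (α : H.root) : coroot (negRoot α).1 = -coroot α.1 := coroot_neg α.1

lemma root_apply_neg (α : H.root) (x : H) : α.1 (-x) = -α.1 x :=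
  map_neg α.1.toLinear x

@[simp] lemma pI_neg_left (α β : H.root) : pI (negRoot α) β = -pI α β := by
  rw [pI_eq_iff, negRoot_apply, apply_coroot]; simp

@[simp] lemma pI_neg_right (α β : H.root) : pI α (negRoot β) = -pI α β := by
  rw [pI_eq_iff, coroot_negRoot, root_apply_neg, apply_coroot]; simp

/-- The root `γ` is the sum of the roots `α` and `β`. -/
def IsSum (α β γ : H.root) : Prop := ∀ h : H, γ.1 h = α.1 h + β.1 h

lemma IsSum.pI_left {α β γ : H.root} (h : IsSum α β γ) (δ : H.root) :
    pI γ δ = pI α δ + pI β δ := by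
  rw [pI_eq_iff, h, apply_coroot, apply_coroot]; push_cast; rfl

lemma root_ext {α β : H.root} (h : ∀ x : H, α.1 x = β.1 x) : α = β :=
  Subtype.ext (LieModule.Weight.ext h)

lemma root_eq_iff {α : H.root} {f : Module.Dual ℂ H} :
    (rootSystem H).root α = f ↔ ∀ x : H, α.1 x = f x := by
  constructor
  · rintro rfl x; rfl
  · intro h; ext x; exact h x

variable [SimplyLaced H]

lemma pI_symm (α β : H.root) : pI α β = pI β α := SimplyLaced.pairing_symm α β

lemma pI_mem (α β : H.root) :
    pI α β = -2 ∨ pI α β = -1 ∨ pI α β = 0 ∨ pI α β = 1 ∨ pI α β = 2 := by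
  have h := (rootSystem H).pairingIn_pairingIn_mem_set_of_isCrystal_of_isRed α β
  have h' := pI_symm α β
  unfold pI at *
  simp only [Set.mem_insert_iff, Set.mem_singleton_iff, Prod.mk.injEq] at h
  omega

lemma pI_eq_two_iff {α β : H.root} : pI α β = 2 ↔ α = β := by
  constructor
  · intro h
    have h' := pI_symm α β
    unfold pI at *
    exact ((rootSystem H).pairingIn_two_two_iff ℤ α β).mp ⟨h, h' ▸ h⟩
  · rintro rfl; simp

lemma pI_eq_neg_two_iff {α β : H.root} : pI α β = -2 ↔ α = negRoot β := by
  rw [← pI_eq_two_iff, pI_neg_right]; omega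

lemma IsSum.pI_right {α β γ : H.root} (h : IsSum α β γ) (δ : H.root) :
    pI δ γ = pI δ α + pI δ β := by
  rw [pI_symm, h.pI_left, pI_symm α, pI_symm β]

/-- All roots have squared length 2, so 2 = 2 + 2 + 2⟨α,β⟩. -/
lemma IsSum.pI_eq {α β γ : H.root} (h : IsSum α β γ) : pI α β = -1 := by
  have h₁ := h.pI_left γ
  have h₂ := h.pI_right α
  have h₃ := h.pI_right β
  have h₄ := pI_symm α β
  simp only [pI_self] at *
  omega

lemma exists_isSum {α β : H.root} (h : pI α β = -1) : ∃ γ, IsSum α β γ := by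
  have h' : (rootSystem H).root α ≠ -(rootSystem H).root β := by
    intro h'
    have : α = negRoot β := root_ext fun x => root_eq_iff.mp h' x
    rw [← pI_eq_neg_two_iff] at this
    omega
  obtain ⟨γ, hγ⟩ := (rootSystem H).root_add_root_mem_of_pairingIn_neg
    (i := α) (j := β) (by unfold pI at h; omega) h'
  exact ⟨γ, root_eq_iff.mp hγ⟩

section Irreducible

variable [(rootSystem H).IsIrreducible]

lemma span_coroot_eq_top : Submodule.span ℂ (Set.range fun α : H.root => coroot α.1) = ⊤ :=
  RootPairing.IsRootSystem.span_coroot_eq_top (P := rootSystem H)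

lemma span_coroot_nonorthogonal (α : H.root) :
    Submodule.span ℂ ((fun γ : H.root => coroot γ.1) '' {γ | pI γ α ≠ 0}) = ⊤ := by
  have h (γ : H.root) : pI γ α ≠ 0 ↔ (rootSystem H).pairing γ α ≠ 0 := by
    rw [rootSystem_pairing_apply, apply_coroot, Int.cast_ne_zero]
  simp only [h]
  exact (rootSystem H).span_coroot_pairing_ne_zero α

end Irreducible

end SimplyLaced

/-! ### From the Cartan matrix to simple lacedness -/

section Bridge

variable {L : Type*} [LieRing L] [LieAlgebra ℂ L] [FiniteDimensional ℂ L] [IsKilling ℂ L]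
variable {H : LieSubalgebra ℂ L} [H.IsCartanSubalgebra]

lemma _root_.Matrix.IsSimplyLaced.of_reindex {ι κ : Type*} {A : Matrix ι ι ℤ} {B : Matrix κ κ ℤ}
    (f : ι ≃ κ) (h : A.reindex f f = B) (hB : B.IsSimplyLaced) : A.IsSimplyLaced := by
  intro i j hij
  have := hB (f.injective.ne hij)
  rw [← h] at this
  simpa using this

lemma IsADE.isSimplyLaced {b : (rootSystem H).Base} (hb : IsADE b) :
    b.cartanMatrix.IsSimplyLaced := by
  rcases hb with ⟨n, -, f, h⟩ | ⟨n, -, f, h⟩ | ⟨f, h⟩ | ⟨f, h⟩ | ⟨f, h⟩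
  · exact .of_reindex f h (CartanMatrix.isSimplyLaced_A n)
  · exact .of_reindex f h (CartanMatrix.isSimplyLaced_D n)
  · exact .of_reindex f h CartanMatrix.isSimplyLaced_E₆
  · exact .of_reindex f h CartanMatrix.isSimplyLaced_E₇
  · exact .of_reindex f h CartanMatrix.isSimplyLaced_E₈

/-- Simple roots joined by an edge have equal length because both Cartan entries are -1, and the
diagram is connected. Lengths are invariant under reflections, and every root is reached from simple
ones by reflections. With all lengths equal, the pairing is symmetric. -/
lemma IsADE.simplyLaced [(rootSystem H).IsIrreducible] {b : (rootSystem H).Base}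
    (hb : IsADE b) (ω : H.root) : SimplyLaced H := by
  have hsl := hb.isSimplyLaced
  let P := rootSystem H
  let B := (P.posRootForm ℤ).toInvariantForm
  let len : H.root → ℂ := fun i => B.form (P.root i) (P.root i)
  have hswap : ∀ i j, P.pairing j i * len i = P.pairing i j * len j :=
    fun i j => B.pairing_mul_eq_pairing_mul_swap i j
  have hlen : ∀ i j, P.pairingIn ℤ i j = -1 → P.pairingIn ℤ j i = -1 → len i = len j := by
    intro i j h₁ h₂
    have := hswap i j
    rw [← P.algebraMap_pairingIn ℤ, ← P.algebraMap_pairingIn ℤ, h₁, h₂] at this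
    simpa using this
  have hrefl : ∀ i j, len (P.reflectionPerm j i) = len i := by
    intro i j
    simp only [len, RootPairing.root_reflectionPerm]
    exact B.apply_reflection_reflection _ _ _
  have : Nonempty H.root := ⟨ω⟩
  obtain ⟨i₀, hi₀⟩ := b.support_nonempty
  have hbase : ∀ i : b.support, len i = len i₀ := by
    intro i
    refine b.induction_on_cartanMatrix (p := fun i => len i = len i₀) (i := ⟨i₀, hi₀⟩) rfl ?_
    intro i j hi hij
    rcases eq_or_ne j i with rfl | hne
    · exact hi
    rw [← hi]
    have h₁ := (hsl hne).resolve_left hij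
    have h₂ := (hsl hne.symm).resolve_left
      (fun h => hij (b.cartanMatrix_apply_eq_zero_iff_symm.mp h))
    exact hlen _ _ h₁ h₂
  have hall : ∀ i, len i = len i₀ := by
    intro i
    refine b.induction_reflect i (p := fun i => len i = len i₀) ?_ (fun i hi => hbase ⟨i, hi⟩) ?_
    · intro i hi; rw [hrefl, hi]
    · intro i j hi _; rw [hrefl, hi]
  refine ⟨fun α β => ?_⟩
  have h := hswap β α
  rw [hall α, hall β] at h
  have h' := mul_right_cancel₀ (B.ne_zero i₀) h
  rw [← P.algebraMap_pairingIn ℤ, ← P.algebraMap_pairingIn ℤ] at h'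
  exact FaithfulSMul.algebraMap_injective ℤ ℂ h'

end Bridge

/-! ### Root vectors, brackets and the normalised Killing form -/

section LieAlgebraFacts

variable {L : Type*} [LieRing L] [LieAlgebra ℂ L] [FiniteDimensional ℂ L] [IsKilling ℂ L]
variable {H : LieSubalgebra ℂ L} [H.IsCartanSubalgebra]
variable [SimplyLaced H] [(rootSystem H).IsIrreducible]
variable (C : Chevalley H) (ω : H.root)

lemma eq_zero_of_forall_root {h : H} (h0 : ∀ α : H.root, α.1 h = 0) : h = 0 := by
  have h1 : h ∈ (⨅ α : LieModule.Weight ℂ H L, α.ker) := by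
    rw [Submodule.mem_iInf]
    intro α
    by_cases hα : α.IsZero
    · have : α h = 0 := congrFun hα h
      exact this
    · exact h0 ⟨α, by simpa [LieSubalgebra.root] using hα⟩
  rw [iInf_ker_weight_eq_bot] at h1
  exact h1

/-- The coroots of roots not orthogonal to β span `H`, and α does not vanish on `H`. Thus any two
roots are linked through a third, which lets a property that passes between non-orthogonal roots
spread from ω to all roots in two moves. -/
lemma exists_apply_coroot_ne_zero (α β : H.root) : ∃ γ, pI γ β ≠ 0 ∧ pI α γ ≠ 0 := by
  by_contra! hcon
  have h1 : (⊤ : Submodule ℂ H) ≤ α.1.ker := by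
    rw [← span_coroot_nonorthogonal β, Submodule.span_le]
    rintro _ ⟨γ, hγ, rfl⟩
    change α.1 (coroot γ.1) = 0
    rw [apply_coroot, hcon γ hγ]; simp
  have h2 : α.1 (coroot α.1) = 0 := h1 Submodule.mem_top
  rw [apply_coroot, pI_self] at h2
  norm_num at h2

lemma kappa_hh (α : H.root) (x : H) : kappa ω (hh α) (x : L) = α.1 x := by
  let k : H.root → ℂ := fun α => 2 * (α.1 ((cartanEquivDual H).symm α.1))⁻¹
  have hk : ∀ (α : H.root) (x : H), killingForm ℂ L (hh α) (x : L) = k α * α.1 x := by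
    intro α x
    have h := traceForm_coroot α.1 x
    change killingForm ℂ L (hh α) (x : L) = _ at h
    rw [h]
    simp only [nsmul_eq_mul, Nat.cast_ofNat, smul_eq_mul, k]
    ring
  have hk' : ∀ α β : H.root, killingForm ℂ L (hh α) (hh β) = k α * pI α β := by
    intro α β
    rw [← apply_coroot]; exact hk α _
  have hk0 : ∀ α, k α ≠ 0 := fun α => mul_ne_zero two_ne_zero
    (inv_ne_zero (root_apply_cartanEquivDual_symm_ne_zero (LieSubalgebra.isNonZero_coe_root α)))
  -- The Killing form is symmetric and so is `pI`, which forces equal factors on non-orthogonal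
  -- roots; the link to ω then shows that normalising at ω normalises at every root.
  have hkk : ∀ α β, pI α β ≠ 0 → k α = k β := by
    intro α β h
    have h1 := hk' α β
    rw [LieModule.traceForm_comm, hk', pI_symm β α] at h1
    exact (mul_right_cancel₀ (by exact_mod_cast h) h1).symm
  obtain ⟨γ, h1, h2⟩ := exists_apply_coroot_ne_zero α ω
  have hαω : k α = k ω := (hkk _ _ h2).trans (hkk _ _ h1)
  simp only [kappa, LinearMap.smul_apply, smul_eq_mul, hk, hk', pI_self, hαω]
  push_cast
  field_simp [hk0 ω]

lemma kappa_hh_hh (α β : H.root) : kappa ω (hh α) (hh β : L) = pI α β := by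
  rw [← apply_coroot]; exact kappa_hh ω α _

lemma kappa_lie (x y z : L) : kappa ω ⁅x, y⁆ z = -kappa ω y ⁅x, z⁆ :=
  kappa_lieInvariant ω x y z

lemma kappa_lie' (x y z : L) : kappa ω ⁅x, y⁆ z = kappa ω x ⁅y, z⁆ := by
  rw [← lie_skew, map_neg, LinearMap.neg_apply, kappa_lie, neg_neg]

lemma lie_h_e (h : H) (α : H.root) : ⁅(h : L), C.e α⁆ = α.1 h • C.e α :=
  lie_eq_smul_of_mem_rootSpace (C.e_mem α) h

lemma lie_e_h (h : H) (α : H.root) : ⁅C.e α, (h : L)⁆ = -α.1 h • C.e α := by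
  rw [← lie_skew, lie_h_e, neg_smul]

lemma lie_h_h (h h' : H) : ⁅(h : L), (h' : L)⁆ = 0 :=
  congrArg (fun x : H => (x : L)) (LieModule.IsTrivial.trivial h h')

lemma hh_eq_coe (α : H.root) : (hh α : L) = ((coroot α.1 : H) : L) := rfl

lemma lie_hh_e (α β : H.root) : ⁅(hh α : L), C.e β⁆ = (pI β α : ℂ) • C.e β := by
  rw [hh_eq_coe, lie_h_e, apply_coroot]

lemma hh_negRoot (α : H.root) : (hh (negRoot α) : L) = -hh α := by
  rw [hh_eq_coe, coroot_negRoot]; rfl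

lemma kappa_e_neg (α : H.root) : kappa ω (C.e α) (C.e (negRoot α)) = 1 := by
  have h := kappa_lie' ω (C.e α) (C.e (negRoot α)) (hh α)
  rw [C.lie_e_neg, kappa_hh_hh, pI_self, hh_eq_coe, lie_e_h, negRoot_apply, apply_coroot, pI_self,
    map_smul] at h
  simp only [smul_eq_mul] at h
  push_cast at h
  linear_combination -(1 / 2 : ℂ) * h

lemma kappa_h_e (h : H) (α : H.root) : kappa ω (h : L) (C.e α) = 0 := by
  refine kappa_eq_zero ω (α := 0) ?_ (C.e_mem α) ?_
  · rw [rootSpace_zero_eq]; exact h.2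
  · rw [zero_add]; exact root_coe_ne_zero α

lemma kappa_e_h (h : H) (α : H.root) : kappa ω (C.e α) (h : L) = 0 := by
  rw [kappa_comm, kappa_h_e]

lemma e_ne_zero (α : H.root) : C.e α ≠ 0 := by
  intro h
  have := kappa_e_neg C α α
  rw [h] at this
  simp at this

lemma mem_rootSpace_iff {α : H.root} {x : L} (hx : x ∈ rootSpace H α.1) :
    ∃ c : ℂ, x = c • C.e α := by
  have h1 := finrank_rootSpace_eq_one α.1 (LieSubalgebra.isNonZero_coe_root α)
  obtain ⟨c, hc⟩ := (finrank_eq_one_iff_of_nonzero' (⟨C.e α, C.e_mem α⟩ : rootSpace H α.1)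
    (fun h => e_ne_zero C α (congrArg Subtype.val h))).mp h1 ⟨x, hx⟩
  exact ⟨c, (congrArg Subtype.val hc).symm⟩

lemma span_eq_top : Submodule.span ℂ (Set.range ((↑) : H → L) ∪ Set.range C.e) = ⊤ := by
  rw [eq_top_iff]
  have h := congrArg LieSubmodule.toSubmodule (LieModule.iSup_genWeightSpace_eq_top' ℂ H L)
  rw [LieSubmodule.iSup_toSubmodule, LieSubmodule.top_toSubmodule] at h
  rw [← h, iSup_le_iff]
  intro α x hx
  by_cases hα : α.IsZero
  · have h0 : x ∈ rootSpace H (0 : H → ℂ) := by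
      rw [← show (α : H → ℂ) = 0 from hα]; exact hx
    rw [rootSpace_zero_eq] at h0
    exact Submodule.subset_span (Or.inl ⟨⟨x, h0⟩, rfl⟩)
  · obtain ⟨c, rfl⟩ := mem_rootSpace_iff C
      (α := ⟨α, by simpa [LieSubalgebra.root] using hα⟩) hx
    exact Submodule.smul_mem _ _ (Submodule.subset_span (Or.inr ⟨_, rfl⟩))

lemma induction_L {p : L → Prop} (hH : ∀ h : H, p h) (he : ∀ α, p (C.e α))
    (hadd : ∀ x y, p x → p y → p (x + y)) (hsmul : ∀ (c : ℂ) x, p x → p (c • x)) (x : L) : p x := by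
  have hx : x ∈ Submodule.span ℂ (Set.range ((↑) : H → L) ∪ Set.range C.e) := by
    rw [span_eq_top]; trivial
  induction hx using Submodule.span_induction with
  | mem x hx =>
    rcases hx with ⟨h, rfl⟩ | ⟨α, rfl⟩
    exacts [hH h, he α]
  | zero => simpa using hH 0
  | add x y _ _ hx hy => exact hadd _ _ hx hy
  | smul c x _ hx => exact hsmul _ _ hx

lemma lie_e_e_mem (α β : H.root) :
    ⁅C.e α, C.e β⁆ ∈ rootSpace H ((α.1 : H → ℂ) + (β.1 : H → ℂ)) :=
  lie_mem_genWeightSpace_of_mem_genWeightSpace (C.e_mem α) (C.e_mem β)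

lemma isSum_of_eq {f : H → ℂ} {x : L} (hx : x ∈ rootSpace H f) (hx0 : x ≠ 0) (hf : f ≠ 0) :
    ∃ γ : H.root, ∀ h, γ.1 h = f h := by
  have hne : rootSpace H f ≠ ⊥ := fun h => hx0 (by rw [h] at hx; exact hx)
  refine ⟨⟨⟨f, hne⟩, ?_⟩, fun h => rfl⟩
  simp only [LieSubalgebra.root, Finset.mem_filter_univ]
  exact hf

lemma lie_e_e_of_isSum {α β γ : H.root} (h : IsSum α β γ) :
    ∃ c : ℂ, ⁅C.e α, C.e β⁆ = c • C.e γ := by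
  refine mem_rootSpace_iff C ?_
  rw [show (γ.1 : H → ℂ) = (α.1 : H → ℂ) + (β.1 : H → ℂ) from funext h]
  exact lie_e_e_mem C α β

lemma lie_e_e_eq_zero {α β : H.root} (h : 0 ≤ pI α β) : ⁅C.e α, C.e β⁆ = 0 := by
  by_contra hne
  obtain ⟨γ, hγ⟩ := isSum_of_eq (lie_e_e_mem C α β) hne fun h0 => by
    have : α = negRoot β := root_ext fun x => by
      rw [negRoot_apply]; exact eq_neg_of_add_eq_zero_left (congrFun h0 x)
    rw [← pI_eq_neg_two_iff] at this
    omega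
  have := IsSum.pI_eq (α := α) (β := β) (γ := γ) hγ
  omega

/-- Jacobi: [e_{-β}, e_γ] = 0, so only [-h_β, e_γ] = -γ(h_β) e_γ survives. In particular brackets of
root vectors with pairing -1 never vanish. -/
lemma lie_neg_lie {β γ : H.root} (h : pI β γ = -1) :
    ⁅C.e (negRoot β), ⁅C.e β, C.e γ⁆⁆ = C.e γ := by
  have h1 : ⁅C.e (negRoot β), C.e β⁆ = -hh β := by
    rw [← lie_skew, C.lie_e_neg]
  rw [leibniz_lie, h1, lie_e_e_eq_zero C (α := negRoot β) (β := γ) (by rw [pI_neg_left, h]; simp),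
    lie_zero, add_zero, neg_lie, lie_hh_e, pI_symm, h]
  simp

lemma lie_e_e_ne_zero {β γ : H.root} (h : pI β γ = -1) : ⁅C.e β, C.e γ⁆ ≠ 0 := by
  intro h0
  have := lie_neg_lie C h
  rw [h0, lie_zero] at this
  exact e_ne_zero C γ this.symm

lemma exists_lie_e_e {α β : H.root} (h : pI α β = -1) :
    ∃ (γ : H.root) (c : ℂ), IsSum α β γ ∧ c ≠ 0 ∧ ⁅C.e α, C.e β⁆ = c • C.e γ := by
  obtain ⟨γ, hγ⟩ := exists_isSum h
  obtain ⟨c, hc⟩ := lie_e_e_of_isSum C hγ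
  refine ⟨γ, c, hγ, ?_, hc⟩
  rintro rfl
  rw [zero_smul] at hc
  exact lie_e_e_ne_zero C h hc

/-- The root vectors are extremal elements. -/
lemma lie_e_lie_e (α : H.root) (z : L) :
    ⁅C.e α, ⁅C.e α, z⁆⁆ = (-2 * kappa ω (C.e α) z) • C.e α := by
  refine induction_L C (p := fun z => ⁅C.e α, ⁅C.e α, z⁆⁆ = (-2 * kappa ω (C.e α) z) • C.e α)
    ?_ ?_ ?_ ?_ z
  · intro h
    simp [lie_e_h, kappa_e_h]
  · intro β
    by_cases hβ : β = negRoot α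
    · subst hβ
      rw [C.lie_e_neg, kappa_e_neg, hh_eq_coe, lie_e_h, apply_coroot, pI_self]
      norm_num
    · rw [kappa_e_e C ω α β hβ, mul_zero, zero_smul]
      -- For β ≠ -α the double bracket would have weight 2α + β, which is not a root: pairing -1
      -- makes α + β pair to 1 with α.
      rcases le_or_gt 0 (pI α β) with h | h
      · rw [lie_e_e_eq_zero C h, lie_zero]
      · have h1 : pI α β = -1 := by
          have := pI_mem α β
          have h2 : pI α β ≠ -2 := fun h2 => hβ (by
            rw [pI_symm, pI_eq_neg_two_iff] at h2; exact h2)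
          omega
        obtain ⟨γ, c, hγ, -, hc⟩ := exists_lie_e_e C h1
        rw [hc, lie_smul, lie_e_e_eq_zero C (by rw [hγ.pI_right, pI_self, h1]; norm_num), smul_zero]
  · intro x y hx hy
    simp only [lie_add, map_add, hx, hy, mul_add, add_smul]
  · intro c x hx
    simp only [lie_smul, map_smul, hx, smul_eq_mul, smul_smul]
    congr 1; ring

/-- Invariance moves one bracket across and extremality evaluates the result. The constant is
exactly what places e_α e_α in the radical of `lieForm` - 2B. -/
lemma kappa_lie_e_lie_e (α : H.root) (z w : L) :
    kappa ω ⁅C.e α, z⁆ ⁅C.e α, w⁆ = 2 * (kappa ω (C.e α) z * kappa ω (C.e α) w) := by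
  rw [← neg_neg (kappa ω ⁅C.e α, z⁆ ⁅C.e α, w⁆), ← kappa_lie, lie_e_lie_e C ω, map_smul,
    LinearMap.smul_apply, smul_eq_mul]
  ring

lemma kappa_nondegenerate : (kappa ω : LinearMap.BilinForm ℂ L).Nondegenerate := by
  have h0 : (killingForm ℂ L (hh ω) (hh ω) : ℂ) ≠ 0 := by
    intro h
    have h1 := kappa_hh_hh ω ω ω
    simp [kappa, h] at h1
  have h1 := IsKilling.killingForm_nondegenerate ℂ L
  have h2 : ∀ x y : L, kappa ω x y = (2 * (killingForm ℂ L (hh ω) (hh ω))⁻¹) *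
      killingForm ℂ L x y :=
    fun x y => rfl
  have h3 : (2 * (killingForm ℂ L (hh ω) (hh ω))⁻¹ : ℂ) ≠ 0 :=
    mul_ne_zero two_ne_zero (inv_ne_zero h0)
  refine ⟨fun x hx => h1.1 x fun y => ?_, fun y hy => h1.2 y fun x => ?_⟩
  · have := hx y; rw [h2] at this; exact (mul_eq_zero.mp this).resolve_left h3
  · have := hy x; rw [h2] at this; exact (mul_eq_zero.mp this).resolve_left h3

lemma eq_zero_of_kappa {h : H} (h0 : ∀ h' : H, kappa ω (h : L) (h' : L) = 0) : h = 0 := by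
  refine eq_zero_of_forall_root fun α => ?_
  rw [← kappa_hh ω α h, kappa_comm]
  exact h0 _

end LieAlgebraFacts

/-! ### The symmetric square as an algebra of endomorphisms -/

section SymmetricSquareFacts

variable {L : Type*} [LieRing L] [LieAlgebra ℂ L]

lemma sprod_comm (x y : L) : sprod x y = sprod y x := by
  rw [← sub_eq_zero]
  change LieSubmodule.Quotient.mk' (antisymm L) (x ⊗ₜ[ℂ] y) -
    LieSubmodule.Quotient.mk' (antisymm L) (y ⊗ₜ[ℂ] x) = 0
  rw [← map_sub]
  refine LieSubmodule.Quotient.mk_eq_zero'.mpr ?_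
  exact Submodule.subset_span ⟨x, y, rfl⟩

lemma S2.linearMap_ext {N : Type*} [AddCommGroup N] [Module ℂ N] {f g : S2 L →ₗ[ℂ] N}
    (h : ∀ x y, f (sprod x y) = g (sprod x y)) : f = g := by
  ext a
  change f a = g a
  induction a using S2.induction with
  | h x y => exact h x y
  | hadd a b ha hb => rw [map_add, map_add, ha, hb]

variable {κ : LinearMap.BilinForm ℂ L}

/-- This turns entries of x with respect to B into matrix entries of ζ(x) with respect to κ; the
symmetry of ζ(x) and the injectivity of ζ are read off from it. -/
lemma bform_sprod_right (x : S2 L) (y z : L) :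
    bform κ x (sprod y z) = κ (zeta κ x y) z := by
  induction x using S2.induction with
  | h a b =>
    rw [bform_sprod, zeta_sprod, map_smul, map_add, map_smul, map_smul]
    simp only [LinearMap.smul_apply, LinearMap.add_apply, smul_eq_mul]
    ring
  | hadd a b ha hb => simp only [map_add, LinearMap.add_apply, ha, hb]

lemma bform_comm (hκs : ∀ x y, κ x y = κ y x) (x y : S2 L) : bform κ x y = bform κ y x := by
  induction x using S2.induction with
  | hadd a b ha hb => simp only [map_add, LinearMap.add_apply, ha, hb]
  | h a b =>
    induction y using S2.induction with
    | hadd c d hc hd => simp only [map_add, LinearMap.add_apply, hc, hd]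
    | h c d =>
      rw [bform_sprod, bform_sprod, hκs c a, hκs d b, hκs c b, hκs d a]
      ring

lemma zeta_symm (x : S2 L) (y z : L) :
    κ (zeta κ x y) z = κ (zeta κ x z) y := by
  rw [← bform_sprod_right, ← bform_sprod_right, sprod_comm]

/-- The four terms of • contract one factor of x with one factor of y z, and contracting a factor is
applying ζ(x) to it. Multiplication by x is thus half the derivation induced by ζ(x). -/
lemma bullet_sprod_right (x : S2 L) (y z : L) :
    bullet κ x (sprod y z) = (1 / 2 : ℂ) • (sprod (zeta κ x y) z + sprod y (zeta κ x z)) := by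
  induction x using S2.induction with
  | h a b =>
    rw [bullet_sprod, zeta_sprod, zeta_sprod]
    simp only [map_smul, map_add, LinearMap.smul_apply, LinearMap.add_apply, sprod_comm y]
    module
  | hadd a b ha hb =>
    simp only [map_add, LinearMap.add_apply, ha, hb]
    module

lemma zeta_bullet (hκs : ∀ x y, κ x y = κ y x) (x y : S2 L) :
    zeta κ (bullet κ x y) = jordan L (zeta κ x) (zeta κ y) := by
  induction y using S2.induction with
  | hadd a b ha hb => simp only [map_add, ha, hb]
  | h a b =>
    ext ℓ
    rw [bullet_sprod_right, jordan_apply]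
    simp only [map_smul, map_add, LinearMap.smul_apply, LinearMap.add_apply, zeta_sprod,
      Module.End.mul_apply, hκs _ (zeta κ x ℓ), zeta_symm x ℓ]
    module

lemma bullet_comm (hκs : ∀ x y, κ x y = κ y x) (x y : S2 L) : bullet κ x y = bullet κ y x := by
  induction x using S2.induction with
  | hadd a b ha hb => simp only [map_add, LinearMap.add_apply, ha, hb]
  | h a b =>
    induction y using S2.induction with
    | hadd c d hc hd => simp only [map_add, LinearMap.add_apply, hc, hd]
    | h c d =>
      rw [bullet_sprod, bullet_sprod, hκs c a, hκs c b, hκs d a, hκs d b, sprod_comm c a,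
        sprod_comm c b, sprod_comm d a, sprod_comm d b]
      module

lemma lie_bullet (hκ : κ.lieInvariant L) (ℓ : L) (x y : S2 L) :
    ⁅ℓ, bullet κ x y⁆ = bullet κ ⁅ℓ, x⁆ y + bullet κ x ⁅ℓ, y⁆ := by
  induction x using S2.induction with
  | hadd a b ha hb =>
    simp only [map_add, LinearMap.add_apply, lie_add, ha, hb]; abel
  | h a b =>
    induction y using S2.induction with
    | hadd c d hc hd => simp only [map_add, lie_add, hc, hd]; abel
    | h c d =>
      simp only [bullet_sprod, lie_sprod, map_add, LinearMap.add_apply, lie_smul, lie_add, hκ ℓ]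
      module

variable [FiniteDimensional ℂ L]

lemma bform_eq_trForm (hκs : ∀ x y, κ x y = κ y x) (x y : S2 L) :
    bform κ x y = trForm L (zeta κ x) (zeta κ y) := by
  induction y using S2.induction with
  | hadd a b ha hb => simp only [map_add, ha, hb]
  | h a b =>
    have h : zeta κ x * zeta κ (sprod a b) = (1 / 2 : ℂ) •
        ((κ b).smulRight (zeta κ x a) + (κ a).smulRight (zeta κ x b)) := by
      ext ℓ
      simp [zeta_sprod]
    rw [trForm_apply, h, map_smul, map_add, LinearMap.trace_smulRight,
      LinearMap.trace_smulRight, hκs b, hκs a, ← bform_sprod_right,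
      ← bform_sprod_right, sprod_comm b a, smul_eq_mul]
    ring

lemma trForm_jordan (f g h : Module.End ℂ L) :
    trForm L (jordan L f g) h = trForm L f (jordan L g h) := by
  rw [trForm_apply, trForm_apply, jordan_apply, jordan_apply, smul_mul_assoc, mul_smul_comm,
    map_smul, map_smul, add_mul, mul_add, map_add, map_add, mul_assoc g f h,
    LinearMap.trace_mul_comm ℂ g, mul_assoc, mul_assoc]

/-- Under ζ this is the associativity of the trace form for the Jordan product. -/
lemma bform_bullet (hκs : ∀ x y, κ x y = κ y x) (x y z : S2 L) :
    bform κ (bullet κ x y) z = bform κ x (bullet κ y z) := by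
  rw [bform_eq_trForm hκs, bform_eq_trForm hκs, zeta_bullet hκs, zeta_bullet hκs, trForm_jordan]

/-- The left inverse of `ζ` for a nondegenerate form. -/
def zetaInv (hκ : κ.Nondegenerate) : Module.End ℂ L →ₗ[ℂ] S2 L :=
  ∑ i, (sprod.flip (κ.dualBasis hκ (Module.finBasis ℂ L) i)) ∘ₗ
    LinearMap.applyₗ (Module.finBasis ℂ L i)

lemma zetaInv_zeta (hκ : κ.Nondegenerate) (x : S2 L) :
    zetaInv hκ (zeta κ x) = x := by
  -- Expansion of z in the κ-dual basis; contracting ζ(x) against the pair of dual bases recovers x.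
  have h : ∀ z : L, ∑ i, κ z (Module.finBasis ℂ L i) •
      κ.dualBasis hκ (Module.finBasis ℂ L) i = z := fun z => by
    conv_rhs => rw [← (κ.dualBasis hκ (Module.finBasis ℂ L)).sum_repr z]
    simp only [LinearMap.BilinForm.dualBasis_repr_apply]
  refine LinearMap.congr_fun (f := zetaInv hκ ∘ₗ zeta κ) (g := LinearMap.id)
    (S2.linearMap_ext fun a b => ?_) x
  simp only [zetaInv, LinearMap.comp_apply, LinearMap.sum_apply, LinearMap.applyₗ_apply_apply,
    LinearMap.flip_apply, zeta_sprod, LinearMap.id_apply, map_smul, map_add]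
  rw [← Finset.smul_sum, Finset.sum_add_distrib]
  have h' : ∀ u v : L, ∑ i, κ v (Module.finBasis ℂ L i) •
      sprod u (κ.dualBasis hκ (Module.finBasis ℂ L) i) = sprod u v := fun u v => by
    conv_rhs => rw [← h v, map_sum]
    simp only [map_smul]
  rw [h', h', sprod_comm b a]
  module

lemma zeta_injective (hκ : κ.Nondegenerate) :
    Function.Injective (zeta κ) :=
  Function.LeftInverse.injective (zetaInv_zeta hκ)

lemma bform_nondegenerate (hκ : κ.Nondegenerate) {x : S2 L}
    (h : ∀ y z, bform κ x (sprod y z) = 0) : x = 0 := by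
  apply zeta_injective hκ
  rw [map_zero]
  ext y
  refine hκ.1 _ fun z => ?_
  rw [← bform_sprod_right]; exact h y z

variable (κ) in
/-- The bilinear form `(a b, c d) ↦ (κ([a, c], [b, d]) + κ([a, d], [b, c])) / 2` on `S²(L)`. -/
def lieForm : LinearMap.BilinForm ℂ (S2 L) :=
  symLift <| LinearMap.mk₂ ℂ
    (fun x y => symLift (LinearMap.mk₂ ℂ (fun c d => κ ⁅x, c⁆ ⁅y, d⁆)
      (fun c c' d => by simp) (fun r c d => by simp)
      (fun c d d' => by simp) (fun r c d => by simp)))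
    (fun x x' y => by rw [← map_add]; congr 1; ext c d; simp)
    (fun r x y => by rw [← map_smul]; congr 1; ext c d; simp)
    (fun x y y' => by rw [← map_add]; congr 1; ext c d; simp)
    (fun r x y => by rw [← map_smul]; congr 1; ext c d; simp)

lemma lieForm_sprod (a b c d : L) : lieForm κ (sprod a b) (sprod c d) =
    (1 / 4 : ℂ) * (κ ⁅a, c⁆ ⁅b, d⁆ + κ ⁅a, d⁆ ⁅b, c⁆ + κ ⁅b, c⁆ ⁅a, d⁆ + κ ⁅b, d⁆ ⁅a, c⁆) := by
  simp only [lieForm, symLift_sprod, LinearMap.mk₂_apply, LinearMap.smul_apply,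
    LinearMap.add_apply, smul_eq_mul]
  ring

lemma lieForm_sprod' (hκs : ∀ x y, κ x y = κ y x) (a b c d : L) :
    lieForm κ (sprod a b) (sprod c d) = (1 / 2 : ℂ) * (κ ⁅a, c⁆ ⁅b, d⁆ + κ ⁅a, d⁆ ⁅b, c⁆) := by
  rw [lieForm_sprod, hκs ⁅b, c⁆, hκs ⁅b, d⁆]; ring

lemma lieForm_comm (x y : S2 L) : lieForm κ x y = lieForm κ y x := by
  induction x using S2.induction with
  | hadd a b ha hb => simp only [map_add, LinearMap.add_apply, ha, hb]
  | h a b =>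
    induction y using S2.induction with
    | hadd c d hc hd => simp only [map_add, LinearMap.add_apply, hc, hd]
    | h c d =>
      rw [lieForm_sprod, lieForm_sprod, ← lie_skew c a, ← lie_skew d b, ← lie_skew c b,
        ← lie_skew d a]
      simp only [map_neg, LinearMap.neg_apply, neg_neg]
      ring

lemma lieForm_lieInvariant (hκ : κ.lieInvariant L) : (lieForm κ).lieInvariant L := by
  have h : ∀ ℓ a c y : L, κ ⁅⁅ℓ, a⁆, c⁆ y = -κ ⁅a, c⁆ ⁅ℓ, y⁆ - κ ⁅a, ⁅ℓ, c⁆⁆ y := by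
    intro ℓ a c y
    rw [← hκ, leibniz_lie ℓ a c, map_add, LinearMap.add_apply]; ring
  have h' : ∀ ℓ a c y : L, κ y ⁅⁅ℓ, a⁆, c⁆ = κ y ⁅ℓ, ⁅a, c⁆⁆ - κ y ⁅a, ⁅ℓ, c⁆⁆ := by
    intro ℓ a c y
    rw [leibniz_lie ℓ a c, map_add]; ring
  intro ℓ a b
  induction a using S2.induction with
  | hadd a a' ha ha' => simp only [lie_add, map_add, LinearMap.add_apply, ha, ha']; ring
  | h x y =>
    induction b using S2.induction with
    | hadd b b' hb hb' => simp only [lie_add, map_add, hb, hb']; ring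
    | h c d =>
      simp only [lie_sprod, map_add, LinearMap.add_apply, lieForm_sprod, h, h']
      ring

end SymmetricSquareFacts

/-! ### The submodule 𝒱: its defining identity and explicit elements -/

section SubmoduleV

variable {L : Type*} [LieRing L] [LieAlgebra ℂ L] [FiniteDimensional ℂ L] [IsKilling ℂ L]
variable {H : LieSubalgebra ℂ L} [H.IsCartanSubalgebra]
variable [SimplyLaced H] [(rootSystem H).IsIrreducible]
variable (C : Chevalley H) (ω : H.root)

/-- The vectors E-orthogonal to everything form a submodule because E is invariant, and extremality
puts the generator e_ω e_ω there. Every upper bound on `𝒱` below comes from this identity. -/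
lemma lieForm_eq_of_mem_calV {v : S2 L} (hv : v ∈ calV C ω) (y : S2 L) :
    lieForm (kappa ω) v y = 2 * bform (kappa ω) v y := by
  rw [lieForm_comm, bform_comm (kappa_comm ω)]
  let E : LinearMap.BilinForm ℂ (S2 L) := lieForm (kappa ω) - (2 : ℂ) • bform (kappa ω)
  have hE : E.lieInvariant L := by
    intro ℓ x y
    simp only [E, LinearMap.sub_apply, LinearMap.smul_apply,
      lieForm_lieInvariant (kappa_lieInvariant ω) ℓ, bform_lieInvariant _ (kappa_lieInvariant ω) ℓ]
    module
  have hle : calV C ω ≤ LieAlgebra.InvariantForm.orthogonal E hE ⊤ := by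
    rw [calV, LieSubmodule.lieSpan_le, Set.singleton_subset_iff, SetLike.mem_coe,
      LieAlgebra.InvariantForm.mem_orthogonal]
    intro x _
    clear * - x
    change lieForm (kappa ω) x _ - (2 : ℂ) • bform (kappa ω) x _ = 0
    induction x using S2.induction with
    | h a b =>
      rw [lieForm_sprod' (kappa_comm ω), bform_sprod, ← lie_skew a, ← lie_skew b]
      simp only [map_neg, LinearMap.neg_apply, neg_neg, kappa_lie_e_lie_e, smul_eq_mul,
        kappa_comm ω _ (C.e ω)]
      ring
    | hadd a b ha hb =>
      simp only [map_add, LinearMap.add_apply, smul_add] at ha hb ⊢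
      linear_combination ha + hb
  have h := (LieAlgebra.InvariantForm.mem_orthogonal E hE ⊤ v).mp (hle hv) y trivial
  exact sub_eq_zero.mp h

variable {C ω} in
lemma lie_mem_calV {v : S2 L} (hv : v ∈ calV C ω) (ℓ : L) : ⁅ℓ, v⁆ ∈ calV C ω :=
  LieSubmodule.lie_mem _ hv

variable {C ω} in
lemma of_smul_mem_calV {v : S2 L} {c : ℂ} (hc : c ≠ 0) (hv : c • v ∈ calV C ω) : v ∈ calV C ω :=
  ((calV C ω).toSubmodule.smul_mem_iff hc).mp hv

lemma lie_neg_e (α : H.root) : ⁅C.e (negRoot α), C.e α⁆ = -hh α := by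
  rw [← lie_skew, C.lie_e_neg]

lemma lie_neg_hh (α : H.root) : ⁅C.e (negRoot α), hh α⁆ = (2 : ℂ) • C.e (negRoot α) := by
  rw [hh_eq_coe, lie_e_h, negRoot_apply, apply_coroot, pI_self]; norm_num

variable {C ω}

-- Applying e_{-α} repeatedly to e_α e_α yields multiples of e_α h_α, of 2 e_α e_{-α} - h_α h_α, of
-- e_{-α} h_α and finally of e_{-α} e_{-α}.
section Strings

variable {α : H.root} (h : sprod (C.e α) (C.e α) ∈ calV C ω)
include h

lemma e_hh_mem_of_mem : sprod (C.e α) (hh α) ∈ calV C ω := by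
  have h1 := lie_mem_calV h (C.e (negRoot α))
  rw [lie_sprod, lie_neg_e, sprod_comm, ← map_add] at h1
  refine of_smul_mem_calV (c := -2) (by norm_num) ?_
  convert h1 using 1
  simp only [map_add, map_neg]
  module

lemma v_mem_of_mem :
    (2 : ℂ) • sprod (C.e α) (C.e (negRoot α)) - sprod (hh α) (hh α) ∈ calV C ω := by
  have h1 := lie_mem_calV (e_hh_mem_of_mem h) (C.e (negRoot α))
  rw [lie_sprod, lie_neg_e, lie_neg_hh] at h1
  convert h1 using 1
  simp only [map_smul, map_neg, LinearMap.neg_apply]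
  module

lemma neg_mem_of_mem : sprod (C.e (negRoot α)) (C.e (negRoot α)) ∈ calV C ω := by
  have h1 : ⁅C.e (negRoot α), (2 : ℂ) • sprod (C.e α) (C.e (negRoot α)) - sprod (hh α) (hh α)⁆ =
      (-6 : ℂ) • sprod (C.e (negRoot α)) (hh α) := by
    rw [lie_sub, lie_smul, lie_sprod, lie_sprod, lie_neg_e, lie_neg_hh, lie_self,
      sprod_comm (hh α), map_zero, add_zero, sprod_comm (-hh α)]
    simp only [map_neg, map_smul, LinearMap.smul_apply]
    module
  have h2 := lie_mem_calV (v_mem_of_mem h) (C.e (negRoot α))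
  rw [h1] at h2
  have h3 := lie_mem_calV (of_smul_mem_calV (by norm_num) h2) (C.e (negRoot α))
  rw [lie_sprod, lie_self, lie_neg_hh, map_zero, LinearMap.zero_apply, zero_add, map_smul] at h3
  exact of_smul_mem_calV (by norm_num) h3

/-- With δ = β - α one has [e_δ, e_α] = c e_β and [e_δ,[e_δ,e_α]] = 0, so applying e_δ twice to e_α
e_α gives 2c² e_β e_β. -/
lemma mem_of_mem_of_pI_eq_one {β : H.root} (hβ : pI α β = 1) :
    sprod (C.e β) (C.e β) ∈ calV C ω := by
  obtain ⟨δ, hδ⟩ := exists_isSum (α := negRoot α) (β := β) (by simp [hβ])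
  have hδα : pI δ α = -1 := by
    rw [hδ.pI_left, pI_neg_left, pI_self, pI_symm, hβ]; norm_num
  obtain ⟨γ, c, hγ, hc, hlie⟩ := exists_lie_e_e C hδα
  have hγβ : γ = β := root_ext fun x => by rw [hγ, hδ, negRoot_apply]; ring
  subst hγβ
  have h1 := lie_mem_calV (lie_mem_calV h (C.e δ)) (C.e δ)
  have h2 : ⁅C.e δ, ⁅C.e δ, C.e α⁆⁆ = 0 := by
    rw [lie_e_lie_e C ω, kappa_e_e, mul_zero, zero_smul]
    rintro rfl
    simp at hδα
  rw [lie_sprod, lie_add, lie_sprod, lie_sprod, h2] at h1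
  refine of_smul_mem_calV (c := 2 * c ^ 2) (by simpa using hc) ?_
  convert h1 using 1
  simp only [map_zero, LinearMap.zero_apply, hlie, map_smul, LinearMap.smul_apply]
  module

end Strings

lemma mem_of_mem_of_pI_ne_zero {α β : H.root} (h : sprod (C.e α) (C.e α) ∈ calV C ω)
    (hβ : pI α β ≠ 0) : sprod (C.e β) (C.e β) ∈ calV C ω := by
  rcases pI_mem α β with h1 | h1 | h1 | h1 | h1
  · rw [pI_eq_neg_two_iff] at h1
    subst h1
    simpa [negRoot_negRoot] using neg_mem_of_mem h
  · have h2 := neg_mem_of_mem (mem_of_mem_of_pI_eq_one h (β := negRoot β) (by simp [h1]))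
    simpa [negRoot_negRoot] using h2
  · exact absurd h1 hβ
  · exact mem_of_mem_of_pI_eq_one h h1
  · rw [pI_eq_two_iff] at h1
    subst h1; exact h

variable (C ω)

/-- Membership passes between non-orthogonal roots, and two such moves lead from ω to any root. -/
lemma e_e_mem_calV (α : H.root) : sprod (C.e α) (C.e α) ∈ calV C ω := by
  obtain ⟨γ, h1, h2⟩ := exists_apply_coroot_ne_zero α ω
  have h0 : sprod (C.e ω) (C.e ω) ∈ calV C ω := LieSubmodule.subset_lieSpan rfl
  rw [pI_symm] at h1 h2
  exact mem_of_mem_of_pI_ne_zero (mem_of_mem_of_pI_ne_zero h0 h1) h2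

lemma e_hh_mem_calV (α : H.root) : sprod (C.e α) (hh α) ∈ calV C ω :=
  e_hh_mem_of_mem (e_e_mem_calV C ω α)

lemma v_mem_calV (α : H.root) :
    (2 : ℂ) • sprod (C.e α) (C.e (negRoot α)) - sprod (hh α) (hh α) ∈ calV C ω :=
  v_mem_of_mem (e_e_mem_calV C ω α)

/-- Apply e_{α-β} to e_β e_β. -/
lemma e_e_mem_calV_of_pI_eq_one {α β : H.root} (h : pI α β = 1) :
    sprod (C.e α) (C.e β) ∈ calV C ω := by
  obtain ⟨δ, hδ⟩ := exists_isSum (α := α) (β := negRoot β) (by simp [h])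
  have hδβ : pI δ β = -1 := by
    rw [hδ.pI_left, pI_neg_left, pI_self, h]; norm_num
  obtain ⟨γ, c, hγ, hc, hlie⟩ := exists_lie_e_e C hδβ
  have hγα : γ = α := root_ext fun x => by rw [hγ, hδ, negRoot_apply]; ring
  subst hγα
  have h1 := lie_mem_calV (e_e_mem_calV C ω β) (C.e δ)
  refine of_smul_mem_calV (c := 2 * c) (by simpa using hc) ?_
  convert h1 using 1
  rw [lie_sprod, hlie, sprod_comm (C.e β)]
  simp only [map_smul, LinearMap.smul_apply]
  module

/-- Apply e_β to e_α e_{-β}, whose roots have pairing 1. Modulo `𝒱` this trades a product of two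
root vectors with pairing -1 for a root vector times a coroot. -/
lemma lie_sprod_add_mem_calV {α β : H.root} (h : pI β α = -1) :
    sprod ⁅C.e β, C.e α⁆ (C.e (negRoot β)) + sprod (C.e α) (hh β) ∈ calV C ω := by
  have h1 := lie_mem_calV (e_e_mem_calV_of_pI_eq_one C ω (α := α) (β := negRoot β)
    (by rw [pI_symm]; simp [h])) (C.e β)
  rwa [lie_sprod, C.lie_e_neg] at h1

/-- The root α + γ has pairing 1 with β, so [e_γ, e_α] e_β is in `𝒱`; applying e_{-γ} gives the
relation. It compares the different decompositions of the same sum of orthogonal roots. -/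
lemma lie_sprod_lie_add_mem_calV {α β γ : H.root} (hαβ : pI α β = 0) (hα : pI γ α = -1)
    (hβ : pI γ β = 1) :
    sprod ⁅C.e γ, C.e α⁆ ⁅C.e (negRoot γ), C.e β⁆ + sprod (C.e α) (C.e β) ∈ calV C ω := by
  obtain ⟨δ, c, hδ, -, hlie⟩ := exists_lie_e_e C hα
  have h1 : sprod ⁅C.e γ, C.e α⁆ (C.e β) ∈ calV C ω := by
    rw [hlie, map_smul, LinearMap.smul_apply]
    exact Submodule.smul_mem _ _ (e_e_mem_calV_of_pI_eq_one C ω (by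
      rw [hδ.pI_left, hβ, hαβ]; norm_num))
  have h2 := lie_mem_calV h1 (C.e (negRoot γ))
  rwa [lie_sprod, lie_neg_lie C hα, add_comm] at h2

end SubmoduleV

/-! ### Zero-weight elements of 𝒱 and a positive definite matrix -/

section ZeroWeight

variable {L : Type*} [LieRing L] [LieAlgebra ℂ L] [FiniteDimensional ℂ L] [IsKilling ℂ L]
variable {H : LieSubalgebra ℂ L} [H.IsCartanSubalgebra]
variable [SimplyLaced H] [(rootSystem H).IsIrreducible]
variable (C : Chevalley H) (ω : H.root)

lemma exists_eq_add_sum (x : L) :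
    ∃ h : H, x = h + ∑ β : H.root, kappa ω (C.e (negRoot β)) x • C.e β := by
  refine induction_L C (p := fun x => ∃ h : H, x = h + ∑ β : H.root,
    kappa ω (C.e (negRoot β)) x • C.e β) ?_ ?_ ?_ ?_ x
  · exact fun h => ⟨h, by simp [kappa_e_h]⟩
  · intro α
    refine ⟨0, ?_⟩
    rw [Finset.sum_eq_single α, kappa_comm, kappa_e_neg]
    · simp
    · intro β _ hβ
      rw [kappa_e_e, zero_smul]
      rw [negRoot_negRoot]; exact hβ.symm
    · simp
  · rintro x y ⟨h, hx⟩ ⟨h', hy⟩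
    refine ⟨h + h', ?_⟩
    simp only [map_add, add_smul, Finset.sum_add_distrib]
    conv_lhs => rw [hx, hy]
    push_cast
    abel
  · rintro c x ⟨h, hx⟩
    refine ⟨c • h, ?_⟩
    simp only [map_smul, smul_assoc, ← Finset.smul_sum]
    conv_lhs => rw [hx]
    rw [smul_add]; rfl

lemma kappa_eq_sum {x y : L} (h : ∀ h : H, kappa ω (h : L) y = 0) :
    kappa ω x y = ∑ β : H.root, kappa ω (C.e (negRoot β)) x * kappa ω (C.e β) y := by
  obtain ⟨h', hx⟩ := exists_eq_add_sum C ω x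
  conv_lhs => rw [hx]
  simp [map_add, h]

lemma lieForm_h_h (x : S2 L) (h h' : H) :
    lieForm (kappa ω) x (sprod (h : L) (h' : L)) =
      -∑ β : H.root, β.1 h * β.1 h' * bform (kappa ω) x (sprod (C.e β) (C.e (negRoot β))) := by
  have key : ∀ (z w : L) (h h' : H), kappa ω ⁅z, (h : L)⁆ ⁅w, (h' : L)⁆ =
      -∑ β : H.root, β.1 h * β.1 h' * (kappa ω (C.e (negRoot β)) z * kappa ω (C.e β) w) := by
    intro z w h h'
    -- The bracket [w, h'] has no component in `H`, so only root vectors contribute to the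
    -- expansion.
    rw [kappa_eq_sum C, ← Finset.sum_neg_distrib]
    · refine Finset.sum_congr rfl fun β _ => ?_
      rw [← lie_skew, map_neg, ← kappa_lie, lie_h_e, negRoot_apply,
        ← lie_skew, map_neg, ← kappa_lie, lie_h_e, map_smul, map_smul,
        LinearMap.smul_apply, LinearMap.smul_apply, smul_eq_mul, smul_eq_mul]
      ring
    · intro h''
      rw [← lie_skew, map_neg, ← kappa_lie, lie_h_h, map_zero, LinearMap.zero_apply]
  induction x using S2.induction with
  | hadd a b ha hb =>
    simp only [map_add, LinearMap.add_apply, ha, hb, mul_add, Finset.sum_add_distrib]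
    ring
  | h z w =>
    rw [lieForm_sprod' (kappa_comm ω), key z w h h', kappa_comm ω ⁅z, (h' : L)⁆, key w z h h',
      ← neg_add, ← Finset.sum_add_distrib, mul_neg, Finset.mul_sum]
    congr 1
    refine Finset.sum_congr rfl fun β _ => ?_
    rw [bform_sprod, kappa_comm ω z, kappa_comm ω w, kappa_comm ω z, kappa_comm ω w]
    ring

variable (H) in
-- On `H` the Killing form is the sum of γ ⊗ γ over the roots, and κ is its rescaling by 2/N with N
-- the Killing square of h_ω. Up to a positive factor the matrix `pI` is therefore a Gram matrix.
lemma exists_pI_eq_sum [Nonempty H.root] : ∃ N : ℕ, 0 < N ∧ ∀ α β : H.root,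
    (N : ℤ) * pI α β = 2 * ∑ γ : H.root, pI γ α * pI γ β := by
  obtain ⟨ω⟩ := ‹Nonempty H.root›
  have hkill : ∀ α β : H.root, killingForm ℂ L (hh α) (hh β) =
      ((∑ γ : H.root, pI γ α * pI γ β : ℤ) : ℂ) := by
    intro α β
    have h := LinearMap.congr_fun₂ (restrict_killingForm_eq_sum (K := ℂ) (L := L) (H := H))
      (coroot α.1) (coroot β.1)
    change killingForm ℂ L (hh α) (hh β) = _ at h
    rw [h, LinearMap.sum_apply, LinearMap.sum_apply, Int.cast_sum, ← Finset.sum_coe_sort]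
    refine Finset.sum_congr rfl fun γ _ => ?_
    push_cast
    rw [← apply_coroot, ← apply_coroot]
    rfl
  have hpos : 0 < ∑ γ : H.root, pI γ ω * pI γ ω := by
    refine Finset.sum_pos' (fun γ _ => mul_self_nonneg _) ⟨ω, Finset.mem_univ _, by simp⟩
  have hN : ((∑ γ : H.root, pI γ ω * pI γ ω).toNat : ℤ) = ∑ γ : H.root, pI γ ω * pI γ ω :=
    Int.toNat_of_nonneg hpos.le
  refine ⟨(∑ γ : H.root, pI γ ω * pI γ ω).toNat, by omega, fun α β => ?_⟩
  rw [hN]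
  have h := kappa_hh_hh ω α β
  simp only [kappa, LinearMap.smul_apply, smul_eq_mul, hkill] at h
  have h0 : ((∑ γ : H.root, pI γ ω * pI γ ω : ℤ) : ℂ) ≠ 0 := by exact_mod_cast hpos.ne'
  have h' : ((∑ γ : H.root, pI γ ω * pI γ ω : ℤ) : ℂ) * pI α β =
      2 * ((∑ γ : H.root, pI γ α * pI γ β : ℤ) : ℂ) := by
    rw [← h]; field_simp
  exact_mod_cast h'

/-- The Schur product argument: the entrywise square of a Gram matrix is the Gram matrix of the
products a_k a_l, and its quadratic form is a sum of squares indexed by pairs (k, l). -/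
lemma sum_sum_gram_sq_nonneg {ι : Type*} [Fintype ι] (a : ι → ι → ℝ) (g : ι → ℝ) :
    0 ≤ ∑ i, ∑ j, g i * (∑ k, a k j * a k i) ^ 2 * g j := by
  have h : ∑ i, ∑ j, g i * (∑ k, a k j * a k i) ^ 2 * g j =
      ∑ k, ∑ l, (∑ i, g i * a k i * a l i) ^ 2 := by
    simp only [sq, Finset.sum_mul_sum]
    simp only [Finset.mul_sum, Finset.sum_mul]
    rw [Finset.sum_congr rfl fun i _ => Finset.sum_comm, Finset.sum_comm]
    refine Finset.sum_congr rfl fun k _ => ?_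
    rw [Finset.sum_congr rfl fun i _ => Finset.sum_comm, Finset.sum_comm]
    refine Finset.sum_congr rfl fun l _ => Finset.sum_congr rfl fun i _ =>
      Finset.sum_congr rfl fun j _ => by ring
  rw [h]
  positivity

/-- The matrix with entries β(h_α)² is positive semidefinite, so adding 4 times the identity makes
it definite: pair the equation with g. -/
lemma real_eq_zero_of_gram [Nonempty H.root] (g : H.root → ℝ)
    (hg : ∀ α, 4 * g α + ∑ β : H.root, (pI β α : ℝ) ^ 2 * g β = 0) : g = 0 := by
  obtain ⟨N, hN, hp⟩ := exists_pI_eq_sum H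
  have hp' : ∀ α β : H.root, (N : ℝ) * pI α β = 2 * ∑ γ : H.root, (pI γ α : ℝ) * pI γ β := by
    intro α β; exact_mod_cast hp α β
  have h4 : 0 ≤ ∑ α : H.root, ∑ β : H.root, g α * ((pI β α : ℝ) ^ 2 * g β) := by
    have h1 : ∀ α β : H.root, g α * ((pI β α : ℝ) ^ 2 * g β) = ((N : ℝ) ^ 2)⁻¹ * 4 *
        (g α * (∑ γ : H.root, (pI γ β : ℝ) * pI γ α) ^ 2 * g β) := by
      intro α β
      have h2 := hp' β α
      have h3 : (∑ γ : H.root, (pI γ β : ℝ) * pI γ α) = N * pI β α / 2 := by linarith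
      rw [h3]
      field_simp
      ring
    simp only [h1, ← Finset.mul_sum]
    exact mul_nonneg (by positivity) (sum_sum_gram_sq_nonneg (fun γ α => (pI γ α : ℝ)) g)
  have h3 : ∑ α : H.root, g α * (4 * g α + ∑ β : H.root, (pI β α : ℝ) ^ 2 * g β) = 0 :=
    Finset.sum_eq_zero fun α _ => by rw [hg, mul_zero]
  simp only [mul_add, Finset.mul_sum, Finset.sum_add_distrib] at h3
  have h5 : ∑ α : H.root, g α * (4 * g α) = 0 := by
    refine le_antisymm (by linarith) (Finset.sum_nonneg fun α _ => ?_)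
    nlinarith [mul_self_nonneg (g α)]
  rw [Finset.sum_eq_zero_iff_of_nonneg (fun α _ => by nlinarith [mul_self_nonneg (g α)])] at h5
  funext α
  have := h5 α (Finset.mem_univ _)
  have h6 : g α * g α = 0 := by linarith
  exact mul_self_eq_zero.mp h6

lemma eq_zero_of_gram [Nonempty H.root] (f : H.root → ℂ)
    (hf : ∀ α, 4 * f α + ∑ β : H.root, (pI β α : ℂ) ^ 2 * f β = 0) : f = 0 := by
  have hre := real_eq_zero_of_gram (fun α => (f α).re) fun α => by
    have := congrArg Complex.re (hf α)
    simp only [Complex.add_re, Complex.re_sum, Complex.zero_re] at this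
    rw [← this]
    congr 1
    · simp
    · refine Finset.sum_congr rfl fun β _ => ?_
      rw [← Int.cast_pow, ← Int.cast_pow, ← Complex.ofReal_intCast, Complex.re_ofReal_mul]
  have him := real_eq_zero_of_gram (fun α => (f α).im) fun α => by
    have := congrArg Complex.im (hf α)
    simp only [Complex.add_im, Complex.im_sum, Complex.zero_im] at this
    rw [← this]
    congr 1
    · simp
    · refine Finset.sum_congr rfl fun β _ => ?_
      rw [← Int.cast_pow, ← Int.cast_pow, ← Complex.ofReal_intCast, Complex.im_ofReal_mul]
  funext α
  exact Complex.ext (congrFun hre α) (congrFun him α)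

/-- `v` is a weight vector for `H` of weight `χ`. -/
def HasWt (χ : H → ℂ) (v : S2 L) : Prop := ∀ h : H, ⁅(h : L), v⁆ = χ h • v

lemma hasWt_h_h (h h' : H) : HasWt (H := H) 0 (sprod (h : L) (h' : L)) := fun x => by
  rw [lie_sprod, lie_h_h, lie_h_h]; simp

lemma hasWt_e_h (α : H.root) (h : H) : HasWt α.1 (sprod (C.e α) (h : L)) := fun x => by
  rw [lie_sprod, lie_h_h, lie_h_e]; simp

lemma hasWt_e_e (α β : H.root) :
    HasWt (fun h => α.1 h + β.1 h) (sprod (C.e α) (C.e β)) := fun x => by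
  rw [lie_sprod, lie_h_e, lie_h_e]; simp [add_smul]

variable {C ω}

lemma HasWt.add {χ : H → ℂ} {v w : S2 L} (hv : HasWt χ v) (hw : HasWt χ w) : HasWt χ (v + w) :=
  fun h => by rw [lie_add, hv, hw, smul_add]

lemma HasWt.smul {χ : H → ℂ} {v : S2 L} (c : ℂ) (hv : HasWt χ v) : HasWt χ (c • v) :=
  fun h => by rw [lie_smul, hv, smul_comm]

lemma HasWt.sub {χ : H → ℂ} {v w : S2 L} (hv : HasWt χ v) (hw : HasWt χ w) : HasWt χ (v - w) :=
  fun h => by rw [lie_sub, hv, hw, smul_sub]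

lemma HasWt.zero {χ : H → ℂ} : HasWt χ (0 : S2 L) := fun h => by simp

lemma HasWt.lie_e {χ : H → ℂ} {v : S2 L} (hv : HasWt χ v) (α : H.root) :
    HasWt (fun h => α.1 h + χ h) ⁅C.e α, v⁆ := fun h => by
  rw [leibniz_lie, lie_h_e, smul_lie, hv, lie_smul, add_smul]

lemma HasWt.congr {χ χ' : H → ℂ} {v : S2 L} (hv : HasWt χ v) (h : ∀ x, χ x = χ' x) :
    HasWt χ' v := fun x => by rw [hv, h]

lemma HasWt.add_eq_zero_of_lieInvariant {E : LinearMap.BilinForm ℂ (S2 L)} (hE : E.lieInvariant L)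
    {χ χ' : H → ℂ} {v w : S2 L} (hv : HasWt χ v) (hw : HasWt χ' w) (h : E v w ≠ 0) (x : H) :
    χ x + χ' x = 0 := by
  have h1 := hE (x : L) v w
  rw [hv, hw, map_smul, map_smul, LinearMap.smul_apply, smul_eq_mul, smul_eq_mul] at h1
  have h2 : (χ x + χ' x) * E v w = 0 := by linear_combination h1
  exact (mul_eq_zero.mp h2).resolve_right h

lemma HasWt.add_eq_zero {χ χ' : H → ℂ} {v w : S2 L} (hv : HasWt χ v) (hw : HasWt χ' w)
    (h : bform (kappa ω) v w ≠ 0) (x : H) : χ x + χ' x = 0 :=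
  hv.add_eq_zero_of_lieInvariant (bform_lieInvariant _ (kappa_lieInvariant ω)) hw h x

variable (C ω)

lemma induction_sprod {p : S2 L → Prop} (hHH : ∀ h h' : H, p (sprod (h : L) (h' : L)))
    (heH : ∀ α, ∀ h : H, p (sprod (C.e α) (h : L))) (hee : ∀ α β, p (sprod (C.e α) (C.e β)))
    (hadd : ∀ x y, p x → p y → p (x + y)) (hsmul : ∀ (c : ℂ) x, p x → p (c • x)) (x : S2 L) :
    p x := by
  refine S2.induction (fun x y => ?_) hadd x
  refine induction_L C (p := fun x => p (sprod x y)) ?_ ?_ ?_ ?_ x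
  · intro h
    refine induction_L C (p := fun y => p (sprod (h : L) y)) ?_ ?_ ?_ ?_ y
    · exact hHH h
    · intro α; rw [sprod_comm]; exact heH α h
    · intro a b ha hb; rw [map_add]; exact hadd _ _ ha hb
    · intro c a ha; rw [map_smul]; exact hsmul _ _ ha
  · intro α
    refine induction_L C (p := fun y => p (sprod (C.e α) y)) ?_ ?_ ?_ ?_ y
    · exact heH α
    · exact hee α
    · intro a b ha hb; rw [map_add]; exact hadd _ _ ha hb
    · intro c a ha; rw [map_smul]; exact hsmul _ _ ha
  · intro a b ha hb; rw [map_add, LinearMap.add_apply]; exact hadd _ _ ha hb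
  · intro c a ha; rw [map_smul, LinearMap.smul_apply]; exact hsmul _ _ ha

lemma eq_zero_of_bform {x : S2 L}
    (hHH : ∀ h h' : H, bform (kappa ω) x (sprod (h : L) (h' : L)) = 0)
    (heH : ∀ α, ∀ h : H, bform (kappa ω) x (sprod (C.e α) (h : L)) = 0)
    (hee : ∀ α β, bform (kappa ω) x (sprod (C.e α) (C.e β)) = 0) : x = 0 := by
  refine bform_nondegenerate (kappa_nondegenerate ω) fun y z => ?_
  refine induction_sprod C (p := fun y => bform (kappa ω) x y = 0) hHH heH hee ?_ ?_ _
  · intro a b ha hb; rw [map_add, ha, hb, add_zero]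
  · intro c a ha; rw [map_smul, ha, smul_zero]

lemma two_mul_bform_h_h {v : S2 L} (hv : v ∈ calV C ω) (h h' : H) :
    2 * bform (kappa ω) v (sprod (h : L) (h' : L)) =
      -∑ β : H.root, β.1 h * β.1 h' * bform (kappa ω) v (sprod (C.e β) (C.e (negRoot β))) := by
  rw [← lieForm_eq_of_mem_calV C ω hv, lieForm_h_h C ω]

/-- The entries of v on H × H are combinations of those on the e_β e_{-β} by the identity for `𝒱`;
all remaining entries vanish for weight reasons. -/
lemma eq_zero_of_hasWt_zero_of_e {v : S2 L} (hv : v ∈ calV C ω) (h0 : HasWt (H := H) 0 v)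
    (h : ∀ α, bform (kappa ω) v (sprod (C.e α) (C.e (negRoot α))) = 0) : v = 0 := by
  refine eq_zero_of_bform C ω ?_ ?_ ?_
  · intro x x'
    have := two_mul_bform_h_h C ω hv x x'
    simpa [h] using this
  · intro α h
    by_contra hne
    exact root_coe_ne_zero α (funext fun x => by simpa using h0.add_eq_zero (hasWt_e_h C α h) hne x)
  · intro α β
    by_contra hne
    have h3 := h0.add_eq_zero (hasWt_e_e C α β) hne
    have h4 : β = negRoot α := root_ext fun x => by
      rw [negRoot_apply]; linear_combination (by simpa using h3 x : α.1 x + β.1 x = 0)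
    subst h4
    exact hne (h α)

/-- Put f(α) = B(v, e_α e_{-α}). Orthogonality to v_α makes the entry at h_α h_α equal to 2f(α), so
the identity for `𝒱` becomes 4f(α) + ∑ β(h_α)² f(β) = 0, and positivity gives f = 0. -/
lemma eq_zero_of_hasWt_zero {v : S2 L} (hv : v ∈ calV C ω) (h0 : HasWt (H := H) 0 v)
    (h : ∀ α, bform (kappa ω) v
      ((2 : ℂ) • sprod (C.e α) (C.e (negRoot α)) - sprod (hh α) (hh α)) = 0) : v = 0 := by
  have : Nonempty H.root := ⟨ω⟩
  refine eq_zero_of_hasWt_zero_of_e C ω hv h0 (congrFun (eq_zero_of_gram _ fun α => ?_))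
  have h3 := two_mul_bform_h_h C ω hv (coroot α.1) (coroot α.1)
  have h4 := h α
  rw [map_sub, map_smul, sub_eq_zero] at h4
  rw [← hh_eq_coe, ← h4] at h3
  simp only [apply_coroot, smul_eq_mul, ← sq] at h3
  linear_combination h3

end ZeroWeight

/-! ### The two orthogonal decompositions and bijectivity of π_J -/

section Complements

variable {L : Type*} [LieRing L] [LieAlgebra ℂ L] [FiniteDimensional ℂ L] [IsKilling ℂ L]
variable {H : LieSubalgebra ℂ L} [H.IsCartanSubalgebra]
variable [SimplyLaced H] [(rootSystem H).IsIrreducible]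
variable (C : Chevalley H) (ω : H.root)

variable {C} in
lemma HasWt.eq_zero_of_lie_eq_zero {χ : H → ℂ} {v : S2 L} (hv : HasWt χ v) (α : H.root) {n : ℤ}
    (hn : 0 < n) (hχ : χ (coroot α.1) = n) (h : ⁅C.e (negRoot α), v⁆ = 0) : v = 0 := by
  by_contra hv0
  have h0 : (hh α : L) ≠ 0 := by
    intro h0
    have := kappa_hh_hh α α α
    rw [h0] at this
    simp at this
  -- For the opposite triple, v would be a primitive vector of weight -n < 0, while such weights are
  -- natural numbers in finite dimension.
  have t : IsSl2Triple (-hh α : L) (C.e (negRoot α)) (C.e α) := by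
    refine ⟨neg_ne_zero.mpr h0, lie_neg_e C α, ?_, ?_⟩
    · rw [neg_lie, lie_hh_e, pI_neg_left, pI_self, ← neg_smul, ← Nat.cast_smul_eq_nsmul ℂ]
      norm_num
    · rw [neg_lie, lie_hh_e, pI_self, ← Nat.cast_smul_eq_nsmul ℂ]
      norm_num
  have P : t.HasPrimitiveVectorWith v (-(n : ℂ)) := by
    refine ⟨hv0, ?_, h⟩
    rw [neg_lie, hh_eq_coe, hv, hχ, neg_smul]
  obtain ⟨m, hm⟩ := P.exists_nat
  have : -n = (m : ℤ) := by exact_mod_cast hm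
  omega

variable {C ω} in
lemma bform_eq_zero_of_mem {v w : S2 L} (hv : v ∈ calV C ω) (hw : w ∈ calA C ω) :
    bform (kappa ω) v w = 0 :=
  (LieAlgebra.InvariantForm.mem_orthogonal _ _ _ _).mp hw v hv

lemma mem_calA_iff {w : S2 L} : w ∈ calA C ω ↔ ∀ v ∈ calV C ω, bform (kappa ω) v w = 0 :=
  LieAlgebra.InvariantForm.mem_orthogonal _ _ _ _

/-- A nonzero v pairs with some product of basis vectors, so its weight is 0, a root, or a sum of
two roots. Weight zero is settled by orthogonality to the v_α. A root weight α is lowered to 0 by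
e_{-α}, and a weight α + β with nonnegative pairing is lowered to α by e_{-β}; both lowerings are
injective on weight vectors of positive h-weight. -/
lemma eq_zero_of_hasWt_of_mem {χ : H → ℂ} {v : S2 L} (hχ : HasWt χ v) (hv : v ∈ calV C ω)
    (hv' : v ∈ calA C ω) : v = 0 := by
  have hzero : ∀ w : S2 L, w ∈ calV C ω → w ∈ calA C ω → HasWt (H := H) 0 w → w = 0 := by
    intro w hw hw' h0
    refine eq_zero_of_hasWt_zero C ω hw h0 fun α => ?_
    rw [bform_comm (kappa_comm ω)]
    exact bform_eq_zero_of_mem (v_mem_calV C ω α) hw'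
  have hroot : ∀ (α : H.root) (w : S2 L), w ∈ calV C ω → w ∈ calA C ω → HasWt α.1 w → w = 0 := by
    intro α w hw hw' h0
    refine h0.eq_zero_of_lie_eq_zero (C := C) α (n := 2) (by norm_num)
      (by rw [apply_coroot, pI_self]) ?_
    refine hzero _ (LieSubmodule.lie_mem _ hw) (LieSubmodule.lie_mem _ hw')
      ((h0.lie_e (C := C) (negRoot α)).congr fun x => ?_)
    rw [negRoot_apply]; simp
  refine eq_zero_of_bform C ω ?_ ?_ ?_
  · intro h h'
    by_contra hne
    have h1 := hχ.add_eq_zero (hasWt_h_h h h') hne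
    rw [hzero v hv hv' (hχ.congr fun x => by simpa using h1 x)] at hne
    simp at hne
  · intro α h
    by_contra hne
    have h1 := hχ.add_eq_zero (hasWt_e_h C α h) hne
    rw [hroot (negRoot α) v hv hv' (hχ.congr fun x => by
      rw [negRoot_apply]; linear_combination h1 x)] at hne
    simp at hne
  · intro α' β'
    -- Test vectors of weight -α - β are named so that v has weight α + β.
    obtain ⟨α, rfl⟩ : ∃ α, negRoot α = α' := ⟨negRoot α', negRoot_negRoot _⟩
    obtain ⟨β, rfl⟩ : ∃ β, negRoot β = β' := ⟨negRoot β', negRoot_negRoot _⟩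
    by_contra hne
    have h1 := hχ.add_eq_zero (hasWt_e_e C _ _) hne
    have h2 : HasWt (fun x => α.1 x + β.1 x) v := hχ.congr fun x => by
      have := h1 x
      rw [negRoot_apply, negRoot_apply] at this
      linear_combination this
    have hv0 : v ≠ 0 := by rintro rfl; simp at hne
    rcases le_or_gt 0 (pI α β) with h3 | h3
    · refine hv0 (h2.eq_zero_of_lie_eq_zero (C := C) β (n := pI α β + 2) (by omega) ?_ ?_)
      · rw [apply_coroot, apply_coroot, pI_self]; push_cast; ring
      · refine hroot α _ (LieSubmodule.lie_mem _ hv) (LieSubmodule.lie_mem _ hv')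
          ((h2.lie_e (C := C) (negRoot β)).congr fun x => ?_)
        rw [negRoot_apply]; ring
    · have h4 := pI_mem α β
      by_cases h5 : pI α β = -1
      · obtain ⟨γ, hγ⟩ := exists_isSum h5
        exact hv0 (hroot γ v hv hv' (h2.congr fun x => (hγ x).symm))
      · have h6 : α = negRoot β := pI_eq_neg_two_iff.mp (by omega)
        subst h6
        exact hv0 (hzero v hv hv' (h2.congr fun x => by rw [negRoot_apply]; simp))

/-- The intersection is a finite-dimensional L-submodule, so if it were nonzero it would contain a
weight vector for `H`. -/
lemma calV_inf_calA : calV C ω ⊓ calA C ω = ⊥ := by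
  by_contra hne
  have : Nontrivial ↥(calV C ω ⊓ calA C ω) :=
    (LieSubmodule.nontrivial_iff_ne_bot ℂ L (S2 L)).mpr hne
  obtain ⟨χ, hχ⟩ := LieModule.exists_nontrivial_weightSpace_of_isSolvable ℂ H
    ↥(calV C ω ⊓ calA C ω)
  obtain ⟨⟨u, hu⟩, hu0⟩ := exists_ne (0 : LieModule.weightSpace ↥(calV C ω ⊓ calA C ω) χ)
  rw [LieModule.mem_weightSpace] at hu
  refine hu0 (Subtype.ext (Subtype.ext ?_))
  refine eq_zero_of_hasWt_of_mem C ω (χ := χ) (fun h => ?_) u.2.1 u.2.2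
  exact congrArg Subtype.val (hu h)

lemma isCompl_calA_calV : IsCompl (calA C ω).toSubmodule (calV C ω).toSubmodule := by
  refine IsCompl.symm ?_
  refine (LinearMap.BilinForm.isCompl_orthogonal_iff_disjoint (B := bform (kappa ω))
    (W := (calV C ω).toSubmodule) ?_).mpr ?_
  · intro x y h; rw [bform_comm (kappa_comm ω)]; exact h
  · rw [disjoint_iff]
    have := congrArg LieSubmodule.toSubmodule (calV_inf_calA C ω)
    exact this

/-- The element `2 e_α e_{-α} - h_α h_α` of `S²(L)`. -/
def vv (α : H.root) : S2 L :=
  (2 : ℂ) • sprod (C.e α) (C.e (negRoot α)) - sprod (hh α) (hh α)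

lemma vv_mem (α : H.root) : vv C α ∈ calV C ω := v_mem_calV C ω α

lemma hasWt_e_neg (α : H.root) : HasWt (H := H) 0 (sprod (C.e α) (C.e (negRoot α))) :=
  (hasWt_e_e C _ _).congr fun x => by rw [negRoot_apply]; simp

lemma hasWt_vv (α : H.root) : HasWt (H := H) 0 (vv C α) :=
  ((hasWt_e_neg C α).smul 2).sub (hasWt_h_h (coroot α.1) (coroot α.1))

lemma zeta_vv (α : H.root) : zeta (kappa ω) (vv C α) = vEnd C ω α := by
  rw [vv, map_sub, map_smul]; rfl

/-- This places `𝔙` inside the image of the zero-weight part of `𝒱`, so that the vanishing criteria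
apply to it. -/
lemma exists_zeta_of_mem_frakV {f : frakS C ω} (hf : f ∈ frakV C ω) :
    ∃ u ∈ calV C ω, HasWt (H := H) 0 u ∧ zeta (kappa ω) u = f := by
  induction hf using Submodule.span_induction with
  | mem f hf =>
    obtain ⟨α, rfl⟩ := hf
    exact ⟨vv C α, vv_mem C ω α, hasWt_vv C α, zeta_vv C ω α⟩
  | zero => exact ⟨0, Submodule.zero_mem _, HasWt.zero, map_zero _⟩
  | add f g _ _ hf hg =>
    obtain ⟨u, hu, hu', hf⟩ := hf
    obtain ⟨v, hv, hv', hg⟩ := hg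
    exact ⟨u + v, Submodule.add_mem _ hu hv, hu'.add hv', by rw [map_add, hf, hg]; rfl⟩
  | smul c f _ hf =>
    obtain ⟨u, hu, hu', hf⟩ := hf
    exact ⟨c • u, Submodule.smul_mem _ c hu, hu'.smul c, by rw [map_smul, hf]; rfl⟩

lemma sForm_apply (f g : frakS C ω) : sForm C ω f g = trForm L f g := rfl

lemma mem_frakA₀_iff (f : frakS C ω) :
    f ∈ frakA₀ C ω ↔ ∀ α, trForm L (vEnd C ω α : Module.End ℂ L) f = 0 := by
  rw [frakA₀, LinearMap.BilinForm.mem_orthogonal_iff]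
  constructor
  · intro h α
    exact h _ (Submodule.subset_span ⟨α, rfl⟩)
  · intro h g hg
    change sForm C ω g f = 0
    induction hg using Submodule.span_induction with
    | mem g hg => obtain ⟨α, rfl⟩ := hg; exact h α
    | zero => simp
    | add a b _ _ ha hb => rw [map_add, LinearMap.add_apply, ha, hb, add_zero]
    | smul c a _ ha => rw [map_smul, LinearMap.smul_apply, ha, smul_zero]

lemma isCompl_frakA₀_frakV : IsCompl (frakA₀ C ω) (frakV C ω) := by
  refine IsCompl.symm ?_
  refine (LinearMap.BilinForm.isCompl_orthogonal_iff_disjoint (B := sForm C ω)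
    (W := frakV C ω) ?_).mpr ?_
  · intro x y h
    rw [sForm_apply, trForm_apply, LinearMap.trace_mul_comm]; exact h
  · rw [Submodule.disjoint_def]
    intro f hf hf'
    obtain ⟨u, hu, h0, hfu⟩ := exists_zeta_of_mem_frakV C ω hf
    -- The trace form on ζ-images is B, so the criterion used for `𝒱 ∩ 𝒜` also settles `𝔙 ∩ 𝔄₀`.
    have h1 : u = 0 := eq_zero_of_hasWt_zero C ω hu h0 fun α => by
      rw [bform_comm (kappa_comm ω), bform_eq_trForm (kappa_comm ω)]
      change trForm L (zeta (kappa ω) (vv C α)) _ = 0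
      rw [zeta_vv, hfu]
      exact (mem_frakA₀_iff C ω f).mp hf' α
    rw [h1, map_zero] at hfu
    exact Subtype.ext hfu.symm

lemma apply_e_eq_zero_of_mem_frakJ {f : Module.End ℂ L} (hf : f ∈ frakJ ω) (β : H.root) :
    f (C.e β) = 0 := by
  induction hf using Submodule.span_induction with
  | mem f hf => obtain ⟨α, rfl⟩ := hf; rw [jEnd_apply, kappa_hh_e, zero_smul]
  | zero => rfl
  | add f g _ _ hf hg => rw [LinearMap.add_apply, hf, hg, add_zero]
  | smul c f _ hf => rw [LinearMap.smul_apply, hf, smul_zero]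

lemma exists_eq_add_of_mem_frakS {f : Module.End ℂ L} (hf : f ∈ frakS C ω) :
    ∃ j ∈ frakJ ω, ∃ v ∈ frakV C ω, f = j + v := by
  obtain ⟨j, hj, z, hz, rfl⟩ := Submodule.mem_sup.mp hf
  suffices h : ∃ j ∈ frakJ ω, ∃ v ∈ frakV C ω, z = j + v by
    obtain ⟨j', hj', v, hv, rfl⟩ := h
    exact ⟨j + j', Submodule.add_mem _ hj hj', v, hv, by rw [add_assoc]⟩
  clear hf
  induction hz using Submodule.span_induction with
  | mem z hz =>
    obtain ⟨α, rfl⟩ := hz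
    refine ⟨(1 / 2 : ℂ) • jEnd ω α, Submodule.smul_mem _ _ (Submodule.subset_span ⟨α, rfl⟩),
      (1 / 2 : ℂ) • vEnd C ω α, Submodule.smul_mem _ _ (Submodule.subset_span ⟨α, rfl⟩), ?_⟩
    rw [Submodule.coe_smul, vEnd]
    module
  | zero => exact ⟨0, Submodule.zero_mem _, 0, Submodule.zero_mem _, by simp⟩
  | add z w _ _ hz hw =>
    obtain ⟨j, hj, v, hv, rfl⟩ := hz
    obtain ⟨j', hj', v', hv', rfl⟩ := hw
    exact ⟨j + j', Submodule.add_mem _ hj hj', v + v', Submodule.add_mem _ hv hv', by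
      rw [Submodule.coe_add]; abel⟩
  | smul c z _ hz =>
    obtain ⟨j, hj, v, hv, rfl⟩ := hz
    exact ⟨c • j, Submodule.smul_mem _ c hj, c • v, Submodule.smul_mem _ c hv, by
      rw [Submodule.coe_smul, smul_add]⟩

/-- The inclusion of `𝔍` in `𝔖₀`. -/
def inclJ : frakJ ω →ₗ[ℂ] frakS C ω := Submodule.inclusion le_sup_left

lemma coe_inclJ (a : frakJ ω) : (inclJ C ω a : Module.End ℂ L) = a := rfl

variable {C ω} in
lemma piJ_apply (hV₀ : IsCompl (frakA₀ C ω) (frakV C ω)) (a : frakJ ω) :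
    piJ hV₀ a = Submodule.projectionOnto _ _ hV₀ (inclJ C ω a) := rfl

variable {C ω} in
-- The kernel is `𝔍 ∩ 𝔙`. Elements of `𝔍` kill all root vectors, so their entries on the e_β e_{-β}
-- vanish, which forces 0 inside `𝒱`. Surjectivity is `𝔖₀ = 𝔍 + 𝔙`, from z_α = ½(j_α + v_α).
lemma piJ_bijective (hV₀ : IsCompl (frakA₀ C ω) (frakV C ω)) : Function.Bijective (piJ hV₀) := by
  constructor
  · refine (injective_iff_map_eq_zero (piJ hV₀)).mpr fun a ha => ?_
    rw [piJ_apply, Submodule.projectionOnto_apply_eq_zero_iff] at ha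
    obtain ⟨u, hu, h0, hau⟩ := exists_zeta_of_mem_frakV C ω ha
    have h1 : u = 0 := eq_zero_of_hasWt_zero_of_e C ω hu h0 fun α => by
      rw [bform_sprod_right, hau, coe_inclJ, apply_e_eq_zero_of_mem_frakJ C ω a.2, map_zero,
        LinearMap.zero_apply]
    rw [h1, map_zero] at hau
    exact Subtype.ext hau.symm
  · intro x
    obtain ⟨j, hj, v, hv, hx⟩ := exists_eq_add_of_mem_frakS C ω x.1.2
    refine ⟨⟨j, hj⟩, ?_⟩
    have h1 : (x : frakS C ω) = inclJ C ω ⟨j, hj⟩ + v := Subtype.ext hx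
    have h2 := Submodule.projectionOnto_apply_left hV₀ x
    rw [h1, map_add, (Submodule.projectionOnto_apply_eq_zero_iff hV₀).mpr hv, add_zero] at h2
    exact h2

end Complements

/-! ### Products of Cartan elements, and relations in the quotient by 𝒱 -/

section Theta

variable {L : Type*} [LieRing L] [LieAlgebra ℂ L] [FiniteDimensional ℂ L] [IsKilling ℂ L]
variable {H : LieSubalgebra ℂ L} [H.IsCartanSubalgebra]
variable [SimplyLaced H] [(rootSystem H).IsIrreducible]

lemma IsSum.coroot_eq {α β γ : H.root} (h : IsSum α β γ) :
    coroot γ.1 = coroot α.1 + coroot β.1 := by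
  rw [← sub_eq_zero]
  refine eq_zero_of_kappa α fun x => ?_
  have h1 : ((coroot γ.1 - (coroot α.1 + coroot β.1) : H) : L) = hh γ - (hh α + hh β) := rfl
  rw [h1, map_sub, map_add]
  simp only [LinearMap.sub_apply, LinearMap.add_apply, kappa_hh, h x]
  ring

lemma IsSum.hh_eq {α β γ : H.root} (h : IsSum α β γ) : (hh γ : L) = hh α + hh β :=
  congrArg (fun x : H => (x : L)) h.coroot_eq

variable (ω : H.root)

lemma zeta_hh_hh_mem_of_isSum {α β γ : H.root} (h : IsSum α β γ) :
    zeta (kappa ω) (sprod (hh α) (hh β)) ∈ frakJ ω := by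
  have hmem : ∀ δ : H.root, zeta (kappa ω) (sprod (hh δ) (hh δ)) ∈ frakJ ω :=
    fun δ => Submodule.subset_span ⟨δ, rfl⟩
  have h1 : sprod (hh α) (hh β) = (1 / 2 : ℂ) •
      (sprod (hh γ) (hh γ) - sprod (hh α) (hh α) - sprod (hh β : L) (hh β)) := by
    rw [h.hh_eq]
    simp only [map_add, LinearMap.add_apply, sprod_comm (hh β) (hh α)]
    module
  rw [h1, map_smul, map_sub, map_sub]
  exact Submodule.smul_mem _ _
    (Submodule.sub_mem _ (Submodule.sub_mem _ (hmem _) (hmem _)) (hmem _))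

/-- For non-orthogonal α and γ one of α ± γ is a root or γ = ±α, and polarisation writes h_α h_γ
through squares of coroots. Orthogonal pairs need not be treated, since the coroots not orthogonal
to α already span `H`. -/
lemma zeta_h_h_mem (h h' : H) : zeta (kappa ω) (sprod (h : L) (h' : L)) ∈ frakJ ω := by
  have key : ∀ (α : H.root) (x : H), zeta (kappa ω) (sprod (hh α) (x : L)) ∈ frakJ ω := by
    intro α x
    have hx : x ∈ Submodule.span ℂ ((fun γ : H.root => coroot γ.1) '' {γ | pI γ α ≠ 0}) := by
      rw [span_coroot_nonorthogonal]; trivial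
    induction hx using Submodule.span_induction with
    | mem x hx =>
      obtain ⟨γ, hγ, rfl⟩ := hx
      change zeta (kappa ω) (sprod (hh α) (hh γ)) ∈ frakJ ω
      have hneg : zeta (kappa ω) (sprod (hh α) (hh (negRoot γ))) ∈ frakJ ω →
          zeta (kappa ω) (sprod (hh α) (hh γ)) ∈ frakJ ω := by
        intro h1
        rwa [hh_negRoot, map_neg, map_neg, Submodule.neg_mem_iff] at h1
      rcases pI_mem α γ with h1 | h1 | h1 | h1 | h1
      · refine hneg ?_
        rw [← pI_eq_neg_two_iff.mp h1]
        exact Submodule.subset_span ⟨α, rfl⟩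
      · obtain ⟨δ, hδ⟩ := exists_isSum h1
        exact zeta_hh_hh_mem_of_isSum ω hδ
      · rw [pI_symm] at h1; exact absurd h1 hγ
      · obtain ⟨δ, hδ⟩ := exists_isSum (α := α) (β := negRoot γ) (by simp [h1])
        exact hneg (zeta_hh_hh_mem_of_isSum ω hδ)
      · rw [pI_eq_two_iff.mp h1]
        exact Submodule.subset_span ⟨γ, rfl⟩
    | zero => simp
    | add x y _ _ hx hy =>
      rw [Submodule.coe_add, map_add, map_add]; exact Submodule.add_mem _ hx hy
    | smul c x _ hx =>
      rw [Submodule.coe_smul, map_smul, map_smul]; exact Submodule.smul_mem _ c hx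
  have hh : h ∈ Submodule.span ℂ (Set.range fun α : H.root => coroot α.1) := by
    rw [span_coroot_eq_top]; trivial
  induction hh using Submodule.span_induction with
  | mem x hx => obtain ⟨α, rfl⟩ := hx; exact key α h'
  | zero => simp
  | add x y _ _ hx hy =>
    rw [Submodule.coe_add, map_add, LinearMap.add_apply, map_add]; exact Submodule.add_mem _ hx hy
  | smul c x _ hx =>
    rw [Submodule.coe_smul, map_smul, LinearMap.smul_apply, map_smul]
    exact Submodule.smul_mem _ c hx

/-- The element of `S²(L)` corresponding to an endomorphism under `ζ`. -/
def lift : Module.End ℂ L →ₗ[ℂ] S2 L := zetaInv (kappa_nondegenerate ω)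

@[simp] lemma lift_zeta (x : S2 L) : lift ω (zeta (kappa ω) x) = x := zetaInv_zeta _ x

lemma induction_frakJ {p : Module.End ℂ L → Prop} (hj : ∀ α, p (jEnd ω α))
    (hadd : ∀ x y, p x → p y → p (x + y)) (hsmul : ∀ (c : ℂ) x, p x → p (c • x))
    {f : Module.End ℂ L} (hf : f ∈ frakJ ω) : p f := by
  induction hf using Submodule.span_induction with
  | mem f hf => obtain ⟨α, rfl⟩ := hf; exact hj α
  | zero => simpa using hsmul 0 _ (hj ω)
  | add f g _ _ hf hg => exact hadd _ _ hf hg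
  | smul c f _ hf => exact hsmul _ _ hf

lemma zeta_lift {f : Module.End ℂ L} (hf : f ∈ frakJ ω) : zeta (kappa ω) (lift ω f) = f := by
  refine induction_frakJ ω (p := fun f => zeta (kappa ω) (lift ω f) = f) ?_ ?_ ?_ hf
  · intro α; rw [jEnd, lift_zeta]
  · intro x y hx hy; rw [map_add, map_add, hx, hy]
  · intro c x hx; rw [map_smul, map_smul, hx]

lemma hasWt_lift {f : Module.End ℂ L} (hf : f ∈ frakJ ω) : HasWt (H := H) 0 (lift ω f) := by
  refine induction_frakJ ω (p := fun f => HasWt (H := H) 0 (lift ω f)) ?_ ?_ ?_ hf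
  · intro α; rw [jEnd, lift_zeta]; exact hasWt_h_h (coroot α.1) (coroot α.1)
  · intro x y hx hy; rw [map_add]; exact hx.add hy
  · intro c x hx; rw [map_smul]; exact hx.smul c

variable (C : Chevalley H)

lemma bform_lift_e {f : Module.End ℂ L} (hf : f ∈ frakJ ω) (α : H.root) (y : L) :
    bform (kappa ω) (lift ω f) (sprod (C.e α) y) = 0 := by
  rw [bform_sprod_right, zeta_lift ω hf, apply_e_eq_zero_of_mem_frakJ C ω hf, map_zero,
    LinearMap.zero_apply]

section Bar

variable {C ω} (hV : IsCompl (calA C ω).toSubmodule (calV C ω).toSubmodule)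

lemma bar_eq_zero {v : S2 L} (hv : v ∈ calV C ω) : bar hV v = 0 :=
  (Submodule.projectionOnto_apply_eq_zero_iff hV).mpr hv

lemma bar_eq_zero_iff {v : S2 L} : bar hV v = 0 ↔ v ∈ calV C ω :=
  Submodule.projectionOnto_apply_eq_zero_iff hV

lemma bar_of_mem {v : S2 L} (hv : v ∈ calA C ω) : bar hV v = ⟨v, hv⟩ :=
  Submodule.projectionOnto_apply_of_mem_left hV hv

lemma bar_coe (v : calA C ω) : bar hV v = v := bar_of_mem hV v.2

lemma sub_bar_mem (v : S2 L) : v - bar hV v ∈ calV C ω := by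
  rw [← bar_eq_zero_iff hV, map_sub, bar_coe, sub_self]

lemma bar_eq_of_sub_mem {v w : S2 L} (h : v - w ∈ calV C ω) : bar hV v = bar hV w := by
  rw [← sub_eq_zero, ← map_sub, bar_eq_zero hV h]

lemma bar_lie (ℓ : L) (v : S2 L) : bar hV ⁅ℓ, v⁆ = ⁅ℓ, bar hV v⁆ := by
  have h := lie_mem_calV (sub_bar_mem hV v) ℓ
  rw [lie_sub] at h
  rw [bar_eq_of_sub_mem hV h]
  exact bar_coe hV ⁅ℓ, bar hV v⁆

lemma bform_bar (v : S2 L) {w : S2 L} (hw : w ∈ calA C ω) :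
    bform (kappa ω) (bar hV v) w = bform (kappa ω) v w := by
  have h := bform_eq_zero_of_mem (sub_bar_mem hV v) hw
  rw [map_sub, LinearMap.sub_apply, sub_eq_zero] at h
  exact h.symm

lemma hasWt_bar {χ : H → ℂ} {v : S2 L} (hv : HasWt χ v) : HasWt χ (bar hV v : S2 L) := fun h => by
  have h1 := bar_lie hV (h : L) v
  rw [hv h, map_smul] at h1
  exact congrArg Subtype.val h1.symm

lemma bar_e_e_eq_zero {α β : H.root} (h : 0 < pI α β) : bar hV (sprod (C.e α) (C.e β)) = 0 := by
  have h1 := pI_mem α β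
  by_cases h2 : pI α β = 1
  · exact bar_eq_zero hV (e_e_mem_calV_of_pI_eq_one C ω h2)
  · have h3 := pI_eq_two_iff.mp (show pI α β = 2 by omega)
    subst h3
    exact bar_eq_zero hV (e_e_mem_calV C ω α)

lemma two_smul_bar_e_neg (α : H.root) :
    (2 : ℂ) • bar hV (sprod (C.e α) (C.e (negRoot α))) = bar hV (sprod (hh α) (hh α)) := by
  rw [← map_smul]
  exact bar_eq_of_sub_mem hV (v_mem_calV C ω α)

lemma bar_lie_sprod {α β : H.root} (h : pI β α = -1) :
    bar hV (sprod ⁅C.e β, C.e α⁆ (C.e (negRoot β))) = -bar hV (sprod (C.e α) (hh β)) := by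
  have h1 := bar_eq_zero hV (lie_sprod_add_mem_calV C ω h)
  rw [map_add] at h1
  exact eq_neg_of_add_eq_zero_left h1

lemma bar_lie_sprod_lie {α β γ : H.root} (hαβ : pI α β = 0) (hα : pI γ α = -1)
    (hβ : pI γ β = 1) :
    bar hV (sprod ⁅C.e γ, C.e α⁆ ⁅C.e (negRoot γ), C.e β⁆) =
      -bar hV (sprod (C.e α) (C.e β)) := by
  have h1 := bar_eq_zero hV (lie_sprod_lie_add_mem_calV C ω hαβ hα hβ)
  rw [map_add] at h1
  exact eq_neg_of_add_eq_zero_left h1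

lemma bar_e_toPerp (α : H.root) (h : H) :
    bar hV (sprod (C.e α) (((toPerp α h : perp α) : H) : L)) = bar hV (sprod (C.e α) (h : L)) := by
  refine bar_eq_of_sub_mem hV ?_
  have h1 : (((toPerp α h : perp α) : H) : L) =
      h - ((1 / 2 : ℂ) * (rootSystem H).root α h) • hh α := rfl
  rw [h1, map_sub, sub_sub_cancel_left, map_smul, ← smul_neg, smul_neg, ← neg_smul]
  exact Submodule.smul_mem _ _ (e_hh_mem_calV C ω α)

/-- If the orthogonal roots `α, β` and `γ, δ` have the same sum, then `e_γ e_δ` is a multiple of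
`e_α e_β` modulo `𝒱`. -/
lemma bar_e_e_mem_span {α β γ δ : H.root} (hαβ : pI α β = 0) (hγδ : pI γ δ = 0)
    (h : ∀ x : H, α.1 x + β.1 x = γ.1 x + δ.1 x) :
    ∃ c : ℂ, bar hV (sprod (C.e γ) (C.e δ)) = c • bar hV (sprod (C.e α) (C.e β)) := by
  have hp : ∀ ε : H.root, pI α ε + pI β ε = pI γ ε + pI δ ε := by
    intro ε
    have := h (coroot ε.1)
    simp only [apply_coroot] at this
    exact_mod_cast this
  have h1 := hp γ
  have h2 := hp α
  have h3 := hp β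
  have h4 := hp δ
  simp only [pI_self, pI_symm β α, pI_symm δ γ, pI_symm γ α, pI_symm δ α, pI_symm γ β,
    pI_symm δ β, hαβ, hγδ] at h1 h2 h3 h4
  have h5 := pI_mem α γ
  by_cases hαγ : α = γ
  · subst hαγ
    have : δ = β := root_ext fun x => by linear_combination -h x
    subst this
    exact ⟨1, (one_smul _ _).symm⟩
  by_cases hαδ : α = δ
  · subst hαδ
    have : γ = β := root_ext fun x => by linear_combination -h x
    subst this
    exact ⟨1, by rw [one_smul, sprod_comm]⟩
  have h6 : pI α γ ≠ 2 := fun h => hαγ (pI_eq_two_iff.mp h)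
  have h7 : pI α δ ≠ 2 := fun h => hαδ (pI_eq_two_iff.mp h)
  have h8 := pI_mem α δ
  have h9 : pI α γ = 1 := by omega
  -- For distinct decompositions α pairs to 1 with both γ and δ. With ε = γ - α, the vectors [e_ε,
  -- e_α] and [e_{-ε}, e_β] are nonzero multiples of e_γ and e_δ.
  obtain ⟨ε, hε⟩ := exists_isSum (α := γ) (β := negRoot α) (by rw [pI_symm]; simp [h9])
  have hεα : pI ε α = -1 := by
    rw [hε.pI_left, pI_neg_left, pI_self, pI_symm, h9]; norm_num
  have hεβ : pI ε β = 1 := by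
    rw [hε.pI_left, pI_neg_left, hαβ, pI_symm]; omega
  obtain ⟨γ', c, hγ', hc, hlie⟩ := exists_lie_e_e C hεα
  obtain ⟨δ', d, hδ', hd, hlie'⟩ := exists_lie_e_e C (α := negRoot ε) (β := β) (by simp [hεβ])
  have h10 : γ' = γ := root_ext fun x => by rw [hγ', hε, negRoot_apply]; ring
  have h11 : δ' = δ := root_ext fun x => by
    rw [hδ', negRoot_apply, hε, negRoot_apply]; linear_combination h x
  subst h10 h11
  have h12 := bar_lie_sprod_lie hV hαβ hεα hεβ
  rw [hlie, hlie', map_smul, map_smul, map_smul, LinearMap.smul_apply, map_smul, smul_smul] at h12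
  refine ⟨-(d * c)⁻¹, ?_⟩
  rw [neg_smul, ← smul_neg, ← h12, smul_smul, inv_mul_cancel₀ (mul_ne_zero hd hc), one_smul]

end Bar

end Theta

/-! ### The isomorphism θ -/

section ThetaMap

variable {L : Type*} [LieRing L] [LieAlgebra ℂ L] [FiniteDimensional ℂ L] [IsKilling ℂ L]
variable {H : LieSubalgebra ℂ L} [H.IsCartanSubalgebra]
variable [SimplyLaced H] [(rootSystem H).IsIrreducible]
variable (C : Chevalley H) (ω : H.root)

open Classical in
variable {ω} in
lemma FrakA.hom_ext {N : Type*} [AddCommGroup N] [Module ℂ N] {f g : FrakA ω →ₗ[ℂ] N}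
    (hJ : ∀ u, f (inJ ω u) = g (inJ ω u)) (hp : ∀ α h, f (inPerp ω α h) = g (inPerp ω α h))
    (hx : ∀ μ, f (xx ω μ) = g (xx ω μ)) : f = g := by
  refine LinearMap.prod_ext (LinearMap.ext hJ) (LinearMap.prod_ext ?_ ?_)
  · refine DirectSum.linearMap_ext ℂ fun α => LinearMap.ext fun h => ?_
    exact hp α h
  · refine Finsupp.lhom_ext' fun μ => LinearMap.ext_ring ?_
    exact hx μ

open Classical in
/-- The map `𝔄 → S²(L)` with `j ↦ ζ⁻¹(j)`, `h ↦ e_α h` for `h ∈ α^⊥`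
and `x_μ ↦ e_{a(μ)} e_{b(μ)}`. -/
def preTheta (a b : Lam₀ H → H.root) : FrakA ω →ₗ[ℂ] S2 L :=
  LinearMap.coprod (lift ω ∘ₗ (frakJ ω).subtype) (LinearMap.coprod
    (DirectSum.toModule ℂ H.root (S2 L)
      (fun α => sprod (C.e α) ∘ₗ H.toSubmodule.subtype ∘ₗ (perp α).subtype))
    (Finsupp.linearCombination ℂ fun μ => sprod (C.e (a μ)) (C.e (b μ))))

variable (a b : Lam₀ H → H.root)

@[simp] lemma preTheta_inJ (u : frakJ ω) : preTheta C ω a b (inJ ω u) = lift ω u := by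
  simp [preTheta, inJ]

@[simp] lemma preTheta_inPerp (α : H.root) (h : perp α) :
    preTheta C ω a b (inPerp ω α h) = sprod (C.e α) ((h : H) : L) := by
  simp only [preTheta, inPerp, LinearMap.comp_apply, LinearMap.coprod_apply,
    LinearMap.inr_apply, LinearMap.inl_apply, map_zero, zero_add, add_zero]
  rw [DirectSum.toModule_lof]
  rfl

@[simp] lemma preTheta_xx (μ : Lam₀ H) :
    preTheta C ω a b (xx ω μ) = sprod (C.e (a μ)) (C.e (b μ)) := by
  simp [preTheta, xx]

/-- The sum γ + δ has squared length 4, and α + β has squared length 4 + 2⟨α,β⟩. -/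
lemma pI_eq_zero_of_add_eq {α β γ δ : H.root} (hγδ : pI γ δ = 0)
    (h : ∀ x : H, α.1 x + β.1 x = γ.1 x + δ.1 x) : pI α β = 0 := by
  have hp : ∀ ε : H.root, pI α ε + pI β ε = pI γ ε + pI δ ε := by
    intro ε
    have := h (coroot ε.1)
    simp only [apply_coroot] at this
    exact_mod_cast this
  have h1 := hp γ
  have h2 := hp α
  have h3 := hp β
  have h4 := hp δ
  simp only [pI_self, pI_symm β α, pI_symm δ γ, pI_symm γ α, pI_symm δ α, pI_symm γ β,
    pI_symm δ β, hγδ] at h1 h2 h3 h4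
  omega

lemma Lam₀.exists_eq (μ : Lam₀ H) : ∃ α β : H.root, pI α β = 0 ∧
    ∀ x : H, α.1 x + β.1 x = μ.1 x := by
  obtain ⟨α, β, h, h'⟩ := μ.2
  refine ⟨α, β, ?_, fun x => LinearMap.congr_fun h' x⟩
  rw [rootSystem_pairing_apply, apply_coroot] at h
  exact_mod_cast h

variable {a b}
variable (hab : ∀ μ, (rootSystem H).root (a μ) + (rootSystem H).root (b μ) = μ.1)
include hab

lemma hab_apply (μ : Lam₀ H) (x : H) : (a μ).1 x + (b μ).1 x = μ.1 x :=
  LinearMap.congr_fun (hab μ) x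

lemma pI_a_b (μ : Lam₀ H) : pI (a μ) (b μ) = 0 := by
  obtain ⟨α, β, h, h'⟩ := Lam₀.exists_eq μ
  exact pI_eq_zero_of_add_eq h fun x => by rw [hab_apply hab, h']

lemma not_isSum (μ : Lam₀ H) (γ : H.root) : ¬ IsSum (a μ) (b μ) γ := fun h => by
  have := h.pI_eq
  rw [pI_a_b hab] at this
  norm_num at this

lemma ne_neg (μ : Lam₀ H) : a μ ≠ negRoot (b μ) := fun h => by
  have := pI_eq_neg_two_iff.mpr h
  rw [pI_a_b hab] at this
  norm_num at this

lemma a_ne_b (μ : Lam₀ H) : a μ ≠ b μ := fun h => by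
  have := pI_eq_two_iff.mpr h
  rw [pI_a_b hab] at this
  norm_num at this

open Classical in
-- The form E = `lieForm` - 2B vanishes on `𝒱`. Tested against h h', against e_{-α} h' with h' in
-- α^⊥, and against e_{-a(μ)} e_{-b(μ)}, it sees only the matching summand of `𝔄`, through -2B, -κ
-- and -1 respectively. Hence every component of x is zero.
lemma preTheta_mem_calV {x : FrakA ω} (hx : preTheta C ω a b x ∈ calV C ω) : x = 0 := by
  let E : LinearMap.BilinForm ℂ (S2 L) := lieForm (kappa ω) - (2 : ℂ) • bform (kappa ω)
  have hEi : E.lieInvariant L := by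
    intro ℓ x y
    simp only [E, LinearMap.sub_apply, LinearMap.smul_apply,
      lieForm_lieInvariant (kappa_lieInvariant ω) ℓ, bform_lieInvariant _ (kappa_lieInvariant ω) ℓ]
    module
  have hE : ∀ v y, E v y = lieForm (kappa ω) v y - 2 * bform (kappa ω) v y := fun _ _ => rfl
  have hE0 : ∀ y, E (preTheta C ω a b x) y = 0 := fun y => by
    rw [hE, lieForm_eq_of_mem_calV C ω hx, sub_self]
  have hHH : ∀ h h' : H, E.flip (sprod (h : L) (h' : L)) ∘ₗ preTheta C ω a b =
      ((-2 : ℂ) • bform (kappa ω)).flip (sprod (h : L) (h' : L)) ∘ₗ lift ω ∘ₗ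
        (frakJ ω).subtype ∘ₗ LinearMap.fst ℂ _ _ := by
    intro h h'
    -- `lieForm` against h h' involves only the entries on the e_β e_{-β}, so it drops out for every
    -- v in the image of the three summands.
    have hE' : ∀ v, (∀ β, bform (kappa ω) v (sprod (C.e β) (C.e (negRoot β))) = 0) →
        E v (sprod (h : L) (h' : L)) = -2 * bform (kappa ω) v (sprod (h : L) (h' : L)) := by
      intro v hv
      rw [hE, lieForm_h_h C]
      simp [hv]
    refine FrakA.hom_ext (fun u => ?_) (fun α y => ?_) (fun μ => ?_)
    · simp only [LinearMap.comp_apply, LinearMap.BilinForm.flip_apply, preTheta_inJ]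
      rw [hE' _ fun β => bform_lift_e ω C u.2 _ _]
      rfl
    · simp only [LinearMap.comp_apply, LinearMap.BilinForm.flip_apply, preTheta_inPerp]
      rw [hE' _ fun β => by simp [bform_sprod, kappa_h_e]]
      simp [bform_sprod, kappa_e_h, inPerp]
    · simp only [LinearMap.comp_apply, LinearMap.BilinForm.flip_apply, preTheta_xx]
      rw [hE' _ fun β => ?_]
      · simp [bform_sprod, kappa_e_h, xx]
      · by_contra hne
        have h1 := (hasWt_e_e C _ _).add_eq_zero (hasWt_e_neg C β) hne
        refine ne_neg hab μ (root_ext fun x => ?_)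
        rw [negRoot_apply]
        linear_combination (by simpa using h1 x : (a μ).1 x + (b μ).1 x = 0)
  have hJ : x.1 = 0 := by
    have h1 : lift ω (x.1 : Module.End ℂ L) = 0 := by
      refine eq_zero_of_bform C ω (fun h h' => ?_) (fun α h => bform_lift_e ω C x.1.2 _ _)
        (fun α β => bform_lift_e ω C x.1.2 _ _)
      have h1 := LinearMap.congr_fun (hHH h h') x
      simp only [LinearMap.comp_apply, LinearMap.BilinForm.flip_apply, hE0] at h1
      have h2 : (0 : ℂ) = -2 * bform (kappa ω) (lift ω (x.1 : Module.End ℂ L))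
        (sprod (h : L) (h' : L)) := h1
      linear_combination (-1 / 2 : ℂ) * h2.symm
    have h2 := zeta_lift ω x.1.2
    rw [h1, map_zero] at h2
    exact Subtype.ext h2.symm
  have heH : ∀ (α : H.root) (h' : perp α),
      E.flip (sprod (C.e (negRoot α)) ((h' : H) : L)) ∘ₗ preTheta C ω a b =
      -(kappa ω).flip ((h' : H) : L) ∘ₗ H.toSubmodule.subtype ∘ₗ (perp α).subtype ∘ₗ
        DirectSum.component ℂ H.root (fun α => perp α) α ∘ₗ LinearMap.fst ℂ _ _ ∘ₗ
        LinearMap.snd ℂ _ _ := by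
    intro α h'
    have hh' : α.1 (h' : H) = 0 := h'.2
    refine FrakA.hom_ext (fun u => ?_) (fun β y => ?_) (fun μ => ?_)
    · simp only [LinearMap.comp_apply, LinearMap.BilinForm.flip_apply, preTheta_inJ]
      have h0 : E (lift ω u) (sprod (C.e (negRoot α)) ((h' : H) : L)) = 0 := by
        by_contra hne
        have h1 := (hasWt_lift ω u.2).add_eq_zero_of_lieInvariant hEi (hasWt_e_h C _ _) hne
        exact root_coe_ne_zero (negRoot α) (funext fun x => by simpa using h1 x)
      rw [h0]
      simp [inJ]
    · simp only [LinearMap.comp_apply, LinearMap.BilinForm.flip_apply, preTheta_inPerp]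
      change E _ _ = -kappa ω ((((DirectSum.component ℂ H.root (fun α => perp α) α)
        (DirectSum.lof ℂ H.root (fun α => perp α) β y) : perp α) : H) : L) ((h' : H) : L)
      by_cases hβ : β = α
      · subst hβ
        have hy : β.1 (y : H) = 0 := y.2
        rw [DirectSum.component.lof_self, hE, lieForm_sprod' (kappa_comm ω), bform_sprod, lie_h_h,
          lie_e_h, hh', kappa_e_neg, kappa_e_h]
        simp
      · have h0 : E (sprod (C.e β) ((y : H) : L)) (sprod (C.e (negRoot α)) ((h' : H) : L)) = 0 := by
          by_contra hne
          have h1 := (hasWt_e_h C β _).add_eq_zero_of_lieInvariant hEi (hasWt_e_h C _ _) hne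
          exact hβ (root_ext fun x => by
            have := h1 x
            rw [negRoot_apply] at this
            linear_combination this)
        rw [h0, DirectSum.component.of, dif_neg hβ]
        simp
    · simp only [LinearMap.comp_apply, LinearMap.BilinForm.flip_apply, preTheta_xx]
      have h0 : E (sprod (C.e (a μ)) (C.e (b μ))) (sprod (C.e (negRoot α)) ((h' : H) : L)) = 0 := by
        by_contra hne
        have h1 := (hasWt_e_e C _ _).add_eq_zero_of_lieInvariant hEi (hasWt_e_h C _ _) hne
        refine not_isSum hab μ α fun x => ?_
        have := h1 x
        rw [negRoot_apply] at this
        linear_combination -this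
      rw [h0]
      simp [xx]
  have hP : x.2.1 = 0 := by
    refine DirectSum.ext fun α => Subtype.ext (eq_zero_of_kappa ω fun z => ?_)
    have h1 := LinearMap.congr_fun (heH α (toPerp α z)) x
    simp only [LinearMap.comp_apply, LinearMap.BilinForm.flip_apply, hE0] at h1
    have h2 : (0 : ℂ) = -kappa ω (((x.2.1 α : perp α) : H) : L)
      (((toPerp α z : perp α) : H) : L) := h1
    have h3 : (((toPerp α z : perp α) : H) : L) =
      z - ((1 / 2 : ℂ) * (rootSystem H).root α z) • hh α := rfl
    -- The component lies in α^⊥, so replacing z by its projection does not change the pairing and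
    -- all of `H` may be used as test space.
    have h4 : kappa ω (((x.2.1 α : perp α) : H) : L) (hh α) = 0 := by
      rw [kappa_comm, kappa_hh]; exact (x.2.1 α).2
    rw [h3, map_sub, map_smul, h4] at h2
    change kappa ω (((x.2.1 α : perp α) : H) : L) (z : L) = 0
    simp only [smul_zero, sub_zero] at h2
    linear_combination h2
  have hee : ∀ μ : Lam₀ H,
      E.flip (sprod (C.e (negRoot (a μ))) (C.e (negRoot (b μ)))) ∘ₗ preTheta C ω a b =
      -Finsupp.lapply μ ∘ₗ LinearMap.snd ℂ _ _ ∘ₗ LinearMap.snd ℂ _ _ := by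
    intro μ
    refine FrakA.hom_ext (fun u => ?_) (fun β y => ?_) (fun μ' => ?_)
    · simp only [LinearMap.comp_apply, LinearMap.BilinForm.flip_apply, preTheta_inJ]
      have h0 : E (lift ω u) (sprod (C.e (negRoot (a μ))) (C.e (negRoot (b μ)))) = 0 := by
        by_contra hne
        have h1 := (hasWt_lift ω u.2).add_eq_zero_of_lieInvariant hEi (hasWt_e_e C _ _) hne
        refine ne_neg hab μ (root_ext fun x => ?_)
        have := h1 x
        simp only [negRoot_apply, Pi.zero_apply] at this ⊢
        linear_combination -this
      rw [h0]
      simp [inJ]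
    · simp only [LinearMap.comp_apply, LinearMap.BilinForm.flip_apply, preTheta_inPerp]
      have h0 : E (sprod (C.e β) ((y : H) : L))
          (sprod (C.e (negRoot (a μ))) (C.e (negRoot (b μ)))) = 0 := by
        by_contra hne
        have h1 := (hasWt_e_h C β _).add_eq_zero_of_lieInvariant hEi (hasWt_e_e C _ _) hne
        refine not_isSum hab μ β fun x => ?_
        have := h1 x
        simp only [negRoot_apply] at this
        linear_combination this
      rw [h0]
      simp [inPerp]
    · simp only [LinearMap.comp_apply, LinearMap.BilinForm.flip_apply, preTheta_xx]
      by_cases hμ : μ' = μ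
      · subst hμ
        have h1 : kappa ω (C.e (a μ')) (C.e (negRoot (b μ'))) = 0 := by
          refine kappa_e_e C ω _ _ fun h => a_ne_b hab μ' ?_
          rw [← negRoot_negRoot (a μ'), ← h, negRoot_negRoot]
        have h2 : ⁅C.e (a μ'), C.e (negRoot (b μ'))⁆ = 0 :=
          lie_e_e_eq_zero C (by rw [pI_neg_right, pI_a_b hab]; norm_num)
        rw [hE, lieForm_sprod' (kappa_comm ω), bform_sprod, C.lie_e_neg, C.lie_e_neg, h1, h2,
          kappa_hh_hh, pI_a_b hab, kappa_e_neg, kappa_e_neg]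
        simp [xx]
      · have h0 : E (sprod (C.e (a μ')) (C.e (b μ')))
            (sprod (C.e (negRoot (a μ))) (C.e (negRoot (b μ)))) = 0 := by
          by_contra hne
          have h1 := (hasWt_e_e C _ _).add_eq_zero_of_lieInvariant hEi (hasWt_e_e C _ _) hne
          refine hμ (Subtype.ext (LinearMap.ext fun x => ?_))
          have := h1 x
          simp only [negRoot_apply] at this
          rw [← hab_apply hab, ← hab_apply hab]
          linear_combination this
        rw [h0]
        simp [xx, hμ]
  have hX : x.2.2 = 0 := by
    ext μ
    have h1 := LinearMap.congr_fun (hee μ) x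
    simp only [LinearMap.comp_apply, LinearMap.BilinForm.flip_apply, hE0] at h1
    have h2 : (0 : ℂ) = -x.2.2 μ := h1
    exact neg_eq_zero.mp h2.symm
  exact Prod.ext hJ (Prod.ext hP hX)

variable {C ω} (hV : IsCompl (calA C ω).toSubmodule (calV C ω).toSubmodule)

lemma theta_injective : Function.Injective (bar hV ∘ₗ preTheta C ω a b) :=
  (injective_iff_map_eq_zero _).mpr fun _ hx =>
    preTheta_mem_calV C ω hab ((bar_eq_zero_iff hV).mp hx)

/-- Modulo `𝒱` a product e_α e_β is 0 for pairing 1 or 2, half of h_α h_α for -2, a multiple of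
e_{α+β} h_β for -1, and a multiple of a chosen x_μ for 0. -/
lemma theta_surjective : Function.Surjective (bar hV ∘ₗ preTheta C ω a b) := by
  have heH : ∀ (α : H.root) (h : H),
      bar hV (sprod (C.e α) (h : L)) ∈ LinearMap.range (bar hV ∘ₗ preTheta C ω a b) := by
    intro α h
    refine ⟨inPerp ω α (toPerp α h), ?_⟩
    rw [LinearMap.comp_apply, preTheta_inPerp, bar_e_toPerp]
  have hHH : ∀ h h' : H,
      bar hV (sprod (h : L) (h' : L)) ∈ LinearMap.range (bar hV ∘ₗ preTheta C ω a b) := by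
    intro h h'
    refine ⟨inJ ω ⟨_, zeta_h_h_mem ω h h'⟩, ?_⟩
    rw [LinearMap.comp_apply, preTheta_inJ, lift_zeta]
  have key : ∀ v, bar hV v ∈ LinearMap.range (bar hV ∘ₗ preTheta C ω a b) := by
    refine induction_sprod C hHH heH ?_ ?_ ?_
    · intro α β
      by_cases h0 : 0 < pI α β
      · rw [bar_e_e_eq_zero hV h0]; exact Submodule.zero_mem _
      rcases pI_mem α β with h1 | h1 | h1 | h1 | h1
      · rw [pI_symm, pI_eq_neg_two_iff] at h1
        subst h1
        refine ((LinearMap.range _).smul_mem_iff (two_ne_zero (α := ℂ))).mp ?_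
        rw [two_smul_bar_e_neg]
        exact hHH _ _
      · obtain ⟨γ, hγ⟩ := exists_isSum h1
        -- With γ = α + β, the bracket [e_{-β}, e_γ] is a multiple of e_α, so the relation for e_γ
        -- and -β applies.
        have h2 : pI (negRoot β) γ = -1 := by
          rw [hγ.pI_right, pI_neg_left, pI_neg_left, pI_self, pI_symm, h1]; norm_num
        obtain ⟨δ, c, hδ, hc, hlie⟩ := exists_lie_e_e C h2
        have h3 : δ = α := root_ext fun x => by rw [hδ, hγ, negRoot_apply]; ring
        subst h3
        have h4 := bar_lie_sprod hV h2
        rw [hlie, negRoot_negRoot, map_smul, LinearMap.smul_apply, map_smul] at h4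
        refine ((LinearMap.range _).smul_mem_iff hc).mp ?_
        rw [h4]
        exact Submodule.neg_mem _ (heH _ _)
      · let μ : Lam₀ H := ⟨(rootSystem H).root α + (rootSystem H).root β, α, β, by
          rw [rootSystem_pairing_apply, apply_coroot, h1]; simp, rfl⟩
        obtain ⟨c, hc⟩ := bar_e_e_mem_span hV (pI_a_b hab μ) h1 (hab_apply hab μ)
        rw [hc]
        refine Submodule.smul_mem _ _ ⟨xx ω μ, ?_⟩
        rw [LinearMap.comp_apply, preTheta_xx]
      · omega
      · omega
    · intro x y hx hy; rw [map_add]; exact Submodule.add_mem _ hx hy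
    · intro c x hx; rw [map_smul]; exact Submodule.smul_mem _ c hx
  intro v
  obtain ⟨x, hx⟩ := key v
  exact ⟨x, by rw [hx, bar_coe]⟩

/-- The isomorphism `θ : 𝔄 → 𝒜`. -/
def theta : FrakA ω ≃ₗ[ℂ] calA C ω :=
  LinearEquiv.ofBijective (bar hV ∘ₗ preTheta C ω a b)
    ⟨theta_injective hab hV, theta_surjective hab hV⟩

lemma theta_inJ (u : frakJ ω) : theta hab hV (inJ ω u) = bar hV (lift ω u) :=
  congrArg (bar hV) (preTheta_inJ C ω a b u)

lemma theta_inPerp (α : H.root) (h : perp α) :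
    theta hab hV (inPerp ω α h) = bar hV (sprod (C.e α) ((h : H) : L)) :=
  congrArg (bar hV) (preTheta_inPerp C ω a b α h)

lemma theta_xx (μ : Lam₀ H) :
    theta hab hV (xx ω μ) = bar hV (sprod (C.e (a μ)) (C.e (b μ))) :=
  congrArg (bar hV) (preTheta_xx C ω a b μ)

lemma isTheta_theta : IsTheta hV a b (theta hab hV) where
  map_j α := by rw [theta_inJ]; congr 1; exact lift_zeta ω _
  map_br α h := by rw [br, theta_inPerp, bar_e_toPerp]
  map_x μ := theta_xx hab hV μ

end ThetaMap

/-! ### Frobenius structures on 𝒜 and 𝔄, and products inside 𝔍 -/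

section FrobeniusStructure

variable {L : Type*} [LieRing L] [LieAlgebra ℂ L] [FiniteDimensional ℂ L] [IsKilling ℂ L]
variable {H : LieSubalgebra ℂ L} [H.IsCartanSubalgebra]
variable [SimplyLaced H] [(rootSystem H).IsIrreducible]
variable {C : Chevalley H} {ω : H.root}

variable (hV : IsCompl (calA C ω).toSubmodule (calV C ω).toSubmodule)

lemma calMul_apply (v w : calA C ω) :
    calMul hV v w = bar hV (bullet (kappa ω) (v : S2 L) (w : S2 L)) := rfl

lemma calMul_comm (v w : calA C ω) : calMul hV v w = calMul hV w v :=
  congrArg (bar hV) (bullet_comm (kappa_comm ω) _ _)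

lemma lie_calMul (ℓ : L) (v w : calA C ω) :
    ⁅ℓ, calMul hV v w⁆ = calMul hV ⁅ℓ, v⁆ w + calMul hV v ⁅ℓ, w⁆ := by
  rw [calMul_apply, calMul_apply, calMul_apply, ← bar_lie, lie_bullet (kappa_lieInvariant ω),
    map_add]
  rfl

include hV in
lemma calForm_eq_zero {v : calA C ω} (h : ∀ w, calForm C ω v w = 0) : v = 0 := by
  refine Subtype.ext (bform_nondegenerate (kappa_nondegenerate ω) fun y z => ?_)
  rw [bform_comm (kappa_comm ω), ← bform_bar hV _ v.2, bform_comm (kappa_comm ω)]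
  exact h _

lemma calForm_comm (v w : calA C ω) : calForm C ω v w = calForm C ω w v :=
  bform_comm (kappa_comm ω) _ _

/-- The projection can be dropped when pairing with an element of `𝒜`, so associativity of the form
and nondegeneracy descend from S²(L); equivariance of the product uses that the projection is a
module map. -/
lemma isFrobeniusFor_calA : IsFrobeniusFor (calAct C ω) (calMul hV) (calForm C ω) where
  form_symm := calForm_comm
  form_nondeg := by
    refine ⟨fun v h => calForm_eq_zero hV h, fun v h => calForm_eq_zero hV fun w => ?_⟩
    rw [calForm_comm]; exact h w
  mul_comm := calMul_comm hV
  form_assoc u v w := by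
    change bform (kappa ω) (bar hV (bullet (kappa ω) u v) : S2 L) w =
      bform (kappa ω) u (bar hV (bullet (kappa ω) v w) : S2 L)
    rw [bform_bar hV _ w.2, bform_comm (kappa_comm ω) u, bform_bar hV _ u.2,
      bform_bullet (kappa_comm ω), bform_comm (kappa_comm ω)]
  mul_equivariant := lie_calMul hV
  form_equivariant ℓ v w := by
    change bform (kappa ω) ⁅ℓ, (v : S2 L)⁆ w + bform (kappa ω) v ⁅ℓ, (w : S2 L)⁆ = 0
    rw [bform_lieInvariant _ (kappa_lieInvariant ω) ℓ, neg_add_cancel]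

lemma hasWt_of_zeta_mem_frakS {x : S2 L} (hx : zeta (kappa ω) x ∈ frakS C ω) :
    HasWt (H := H) 0 x := by
  obtain ⟨j, hj, v, hv, h⟩ := exists_eq_add_of_mem_frakS C ω hx
  obtain ⟨u, -, hu, huv⟩ := exists_zeta_of_mem_frakV C ω hv
  have h1 : x = lift ω j + u := zeta_injective (kappa_nondegenerate ω) (by
    rw [h, map_add, zeta_lift ω hj, huv])
  rw [h1]
  exact (hasWt_lift ω hj).add hu

/-- On `ζ⁻¹(𝔖₀)` the projection onto `𝒜` corresponds to the projection of `𝔖₀` onto `𝔄₀`. -/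
lemma zeta_bar (hV₀ : IsCompl (frakA₀ C ω) (frakV C ω)) {x : S2 L} (f : frakS C ω)
    (hx : zeta (kappa ω) x = f) :
    zeta (kappa ω) (bar hV x) = (Submodule.projectionOnto _ _ hV₀ f : frakA₀ C ω) := by
  set p := Submodule.projectionOnto _ _ hV₀ f with hp
  have hfp : f - p ∈ frakV C ω := by
    rw [← Submodule.projectionOnto_apply_eq_zero_iff hV₀, map_sub,
      Submodule.projectionOnto_apply_left, sub_self]
  obtain ⟨u, hu, hu0, huf⟩ := exists_zeta_of_mem_frakV C ω hfp
  have hx0 : HasWt (H := H) 0 x := hasWt_of_zeta_mem_frakS (C := C) (ω := ω) (by rw [hx]; exact f.2)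
  have hζ : zeta (kappa ω) (x - u) = (p : frakS C ω) := by
    rw [map_sub, hx, huf]; simp
  -- This difference of two candidate `𝒱`-components is a zero-weight element of `𝒱` orthogonal to
  -- every v_α.
  have h1 : (x - bar hV x) - u = 0 := by
    refine eq_zero_of_hasWt_zero C ω (Submodule.sub_mem _ (sub_bar_mem hV x) hu)
      ((hx0.sub (hasWt_bar hV hx0)).sub hu0) fun α => ?_
    have h2 : bform (kappa ω) (bar hV x : S2 L) (vv C α) = 0 := by
      rw [bform_comm (kappa_comm ω)]
      exact bform_eq_zero_of_mem (vv_mem C ω α) (bar hV x).2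
    have h3 : bform (kappa ω) (x - u) (vv C α) = 0 := by
      rw [bform_comm (kappa_comm ω), bform_eq_trForm (kappa_comm ω), hζ, zeta_vv]
      exact (mem_frakA₀_iff C ω _).mp p.2 α
    change bform (kappa ω) _ (vv C α) = 0
    rw [show x - (bar hV x : S2 L) - u = (x - u) - (bar hV x : S2 L) by abel, map_sub,
      LinearMap.sub_apply, h2, h3, sub_zero]
  have h4 : (bar hV x : S2 L) = x - u := by
    rw [sub_sub, sub_eq_zero] at h1
    exact eq_sub_of_add_eq h1.symm
  rw [h4, hζ]

variable {a b : Lam₀ H → H.root}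
variable (hab : ∀ μ, (rootSystem H).root (a μ) + (rootSystem H).root (b μ) = μ.1)
variable (hV₀ : IsCompl (frakA₀ C ω) (frakV C ω)) (hJ : Function.Bijective (piJ hV₀))

lemma zeta_bar_lift (v : frakJ ω) : zeta (kappa ω) (bar hV (lift ω v)) = (piJ hV₀ v).1 :=
  zeta_bar hV hV₀ (inclJ C ω v) (zeta_lift ω v.2)

variable {hV₀} in
-- Both projections agree under ζ, and ζ carries • to the Jordan product, so the two products have
-- the same image.
lemma bar_lift_diamond (v w : frakJ ω) :
    bar hV (lift ω (diamond hV₀ hJ v w)) = calMul hV (bar hV (lift ω v)) (bar hV (lift ω w)) := by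
  refine Subtype.ext (zeta_injective (kappa_nondegenerate ω) ?_)
  rw [zeta_bar_lift hV hV₀, calMul_apply,
    zeta_bar hV hV₀ (sMul C ω (piJ hV₀ v) (piJ hV₀ w))]
  · have h : piJ hV₀ (diamond hV₀ hJ v w) = diamond₀ hV₀ (piJ hV₀ v) (piJ hV₀ w) :=
      (LinearEquiv.ofBijective (piJ hV₀) hJ).apply_symm_apply _
    rw [h]
    rfl
  · rw [zeta_bullet (kappa_comm ω), zeta_bar_lift hV hV₀, zeta_bar_lift hV hV₀]
    rfl

lemma formJ_eq (v w : frakJ ω) :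
    formJ hV₀ v w = calForm C ω (bar hV (lift ω v)) (bar hV (lift ω w)) := by
  change trForm L (piJ hV₀ v).1.1 (piJ hV₀ w).1.1 = bform (kappa ω) (bar hV (lift ω v) : S2 L)
    (bar hV (lift ω w) : S2 L)
  rw [bform_eq_trForm (kappa_comm ω), zeta_bar_lift hV hV₀, zeta_bar_lift hV hV₀]

/-- The product on `𝔄`. -/
def frakMul : FrakA ω →ₗ[ℂ] FrakA ω →ₗ[ℂ] FrakA ω :=
  ((calMul hV).compl₁₂ (theta hab hV).toLinearMap (theta hab hV).toLinearMap).compr₂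
    (theta hab hV).symm.toLinearMap

/-- The form on `𝔄`. -/
def frakForm : LinearMap.BilinForm ℂ (FrakA ω) :=
  (calForm C ω).compl₁₂ (theta hab hV).toLinearMap (theta hab hV).toLinearMap

lemma theta_frakMul (v w : FrakA ω) : theta hab hV (frakMul hV hab v w) =
    calMul hV (theta hab hV v) (theta hab hV w) :=
  (theta hab hV).apply_symm_apply _

lemma frakForm_apply (v w : FrakA ω) : frakForm hV hab v w =
    calForm C ω (theta hab hV v) (theta hab hV w) := rfl

lemma theta_frakAct (ℓ : L) (v : FrakA ω) :
    theta hab hV (frakAct (theta hab hV) ℓ v) = ⁅ℓ, theta hab hV v⁆ := by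
  rw [frakAct_apply, LinearEquiv.apply_symm_apply]

lemma isFrobeniusHom_theta : IsFrobeniusHom (frakAct (theta hab hV)) (frakMul hV hab)
    (frakForm hV hab) (calAct C ω) (calMul hV) (calForm C ω) (theta hab hV).toLinearMap where
  map_mul := theta_frakMul hV hab
  map_form v w := (frakForm_apply hV hab v w).symm
  equivariant := theta_frakAct hV hab

lemma isFrobeniusFor_frakA :
    IsFrobeniusFor (frakAct (theta hab hV)) (frakMul hV hab) (frakForm hV hab) where
  form_symm v w := calForm_comm _ _
  form_nondeg := by
    have h : ∀ v, (∀ w, frakForm hV hab v w = 0) → v = 0 := fun v h => by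
      refine (theta hab hV).map_eq_zero_iff.mp (calForm_eq_zero hV fun w => ?_)
      rw [← (theta hab hV).apply_symm_apply w]
      exact h _
    exact ⟨h, fun v hv => h v fun w => (calForm_comm _ _).trans (hv w)⟩
  mul_comm v w := congrArg (theta hab hV).symm (calMul_comm hV _ _)
  form_assoc u v w := by
    rw [frakForm_apply, frakForm_apply, theta_frakMul, theta_frakMul]
    exact (isFrobeniusFor_calA hV).form_assoc _ _ _
  mul_equivariant ℓ v w := (theta hab hV).injective (by
    rw [map_add]
    simp only [theta_frakAct, theta_frakMul, lie_calMul])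
  form_equivariant ℓ v w := by
    simp only [frakForm_apply, theta_frakAct]
    exact (isFrobeniusFor_calA hV).form_equivariant _ _ _

lemma frakMul_inJ_inJ (v w : frakJ ω) :
    frakMul hV hab (inJ ω v) (inJ ω w) = inJ ω (diamond hV₀ hJ v w) :=
  (theta hab hV).injective (by
    rw [theta_frakMul, theta_inJ, theta_inJ, theta_inJ, bar_lift_diamond])

lemma frakForm_inJ_inJ (v w : frakJ ω) :
    frakForm hV hab (inJ ω v) (inJ ω w) = formJ hV₀ v w := by
  rw [frakForm_apply, theta_inJ, theta_inJ, formJ_eq hV]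

lemma calForm_eq_zero_of_hasWt {χ : H → ℂ} {v w : calA C ω} (hv : HasWt (H := H) 0 (v : S2 L))
    (hw : HasWt χ (w : S2 L)) (hχ : χ ≠ 0) : calForm C ω v w = 0 := by
  by_contra hne
  exact hχ (funext fun x => by simpa using hv.add_eq_zero hw hne x)

lemma hasWt_theta_inJ (v : frakJ ω) : HasWt (H := H) 0 (theta hab hV (inJ ω v) : S2 L) := by
  rw [theta_inJ]; exact hasWt_bar hV (hasWt_lift ω v.2)

lemma frakForm_inJ_inPerp (v : frakJ ω) (α : H.root) (h : perp α) :
    frakForm hV hab (inJ ω v) (inPerp ω α h) = 0 := by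
  refine calForm_eq_zero_of_hasWt (hasWt_theta_inJ hV hab v) ?_ (root_coe_ne_zero α)
  change HasWt _ (theta hab hV (inPerp ω α h) : S2 L)
  rw [theta_inPerp]; exact hasWt_bar hV (hasWt_e_h C α _)

lemma frakForm_inJ_xx (v : frakJ ω) (μ : Lam₀ H) :
    frakForm hV hab (inJ ω v) (xx ω μ) = 0 := by
  refine calForm_eq_zero_of_hasWt (hasWt_theta_inJ hV hab v) (χ := fun x => (a μ).1 x + (b μ).1 x)
    ?_ fun h => ?_
  · change HasWt _ (theta hab hV (xx ω μ) : S2 L)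
    rw [theta_xx]; exact hasWt_bar hV (hasWt_e_e C _ _)
  · refine ne_neg hab μ (root_ext fun x => ?_)
    rw [negRoot_apply]
    exact eq_neg_of_add_eq_zero_left (congrFun h x)

lemma lie_neg_e_h {α : H.root} {h : H} (hh' : α.1 h = 0) :
    ⁅C.e (negRoot α), sprod (C.e α) (h : L)⁆ = -sprod (hh α) (h : L) := by
  rw [lie_sprod, lie_neg_e, lie_e_h, negRoot_apply, hh']
  simp

lemma frakAct_inPerp (α : H.root) (h : perp α) :
    frakAct (theta hab hV) (C.e (negRoot α)) (inPerp ω α h) =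
      inJ ω (-⟨_, zeta_h_h_mem ω (coroot α.1) (h : H)⟩) := by
  refine (theta hab hV).injective ?_
  rw [theta_frakAct, theta_inPerp, ← bar_lie, lie_neg_e_h h.2, theta_inJ]
  congr 1
  rw [Submodule.coe_neg, map_neg, lift_zeta]
  rfl

end FrobeniusStructure

/-! ### Products of 𝔍 with the components [h]_α -/

section RootComponents

variable {L : Type*} [LieRing L] [LieAlgebra ℂ L] [FiniteDimensional ℂ L] [IsKilling ℂ L]
variable {H : LieSubalgebra ℂ L} [H.IsCartanSubalgebra]
variable [SimplyLaced H] [(rootSystem H).IsIrreducible]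
variable (C : Chevalley H) (ω : H.root)

lemma eq_of_kappa {x y : L} (hH : ∀ h : H, kappa ω x (h : L) = kappa ω y (h : L))
    (he : ∀ α, kappa ω x (C.e α) = kappa ω y (C.e α)) : x = y := by
  rw [← sub_eq_zero]
  refine (kappa_nondegenerate ω).1 _ fun z => ?_
  rw [map_sub, LinearMap.sub_apply, sub_eq_zero]
  refine induction_L C (p := fun z => kappa ω x z = kappa ω y z) hH he ?_ ?_ z
  · intro u v hu hv; rw [map_add, map_add, hu, hv]
  · intro c u hu; rw [map_smul, map_smul, hu]

variable {C ω}

/-- A zero-weight x acts diagonally on root vectors, hence • by x is diagonal on the products e_γ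
e_δ. -/
lemma zeta_e {x : S2 L} (hx : HasWt (H := H) 0 x) (γ : H.root) :
    zeta (kappa ω) x (C.e γ) =
      bform (kappa ω) x (sprod (C.e γ) (C.e (negRoot γ))) • C.e γ := by
  refine eq_of_kappa C ω (fun h => ?_) fun δ => ?_
  · rw [← bform_sprod_right, map_smul, LinearMap.smul_apply, kappa_e_h, smul_zero]
    by_contra hne
    exact root_coe_ne_zero γ (funext fun y => by simpa using hx.add_eq_zero (hasWt_e_h C γ h) hne y)
  · rw [← bform_sprod_right, map_smul, LinearMap.smul_apply]
    by_cases hδ : δ = negRoot γ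
    · subst hδ
      rw [kappa_e_neg, smul_eq_mul, mul_one]
    · rw [kappa_e_e C ω γ δ hδ, smul_zero]
      by_contra hne
      refine hδ (root_ext fun y => ?_)
      rw [negRoot_apply]
      exact eq_neg_of_add_eq_zero_right
        (by simpa using hx.add_eq_zero (hasWt_e_e C γ δ) hne y : γ.1 y + δ.1 y = 0)

lemma bform_e_neg {x : S2 L} (hx : x ∈ calA C ω) (γ : H.root) :
    bform (kappa ω) x (sprod (C.e γ) (C.e (negRoot γ))) =
      (1 / 2 : ℂ) * bform (kappa ω) x (sprod (hh γ) (hh γ)) := by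
  have h := bform_eq_zero_of_mem (v_mem_calV C ω γ) hx
  rw [bform_comm (kappa_comm ω), map_sub, map_smul, smul_eq_mul] at h
  linear_combination (1 / 2 : ℂ) * h

lemma bullet_e_e {x : S2 L} (hx : HasWt (H := H) 0 x) (γ δ : H.root) :
    bullet (kappa ω) x (sprod (C.e γ) (C.e δ)) = ((1 / 2 : ℂ) *
      (bform (kappa ω) x (sprod (C.e γ) (C.e (negRoot γ))) +
        bform (kappa ω) x (sprod (C.e δ) (C.e (negRoot δ))))) • sprod (C.e γ) (C.e δ) := by
  rw [bullet_sprod_right, zeta_e hx, zeta_e hx]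
  simp only [map_smul, LinearMap.smul_apply]
  module

variable (C ω)

lemma lieForm_e_h (x : S2 L) (α : H.root) (h : H) :
    lieForm (kappa ω) x (sprod (C.e α) (h : L)) =
      ∑ β : H.root, β.1 h * bform (kappa ω) x (sprod ⁅C.e α, C.e (negRoot β)⁆ (C.e β)) := by
  have key : ∀ z w : L, kappa ω ⁅z, C.e α⁆ ⁅w, (h : L)⁆ =
      ∑ β : H.root, β.1 h * (kappa ω z ⁅C.e α, C.e (negRoot β)⁆ * kappa ω w (C.e β)) := by
    intro z w
    rw [kappa_eq_sum C ω]
    · refine Finset.sum_congr rfl fun β _ => ?_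
      rw [kappa_comm ω (C.e (negRoot β)), kappa_lie', kappa_comm ω (C.e β), kappa_lie', lie_h_e,
        map_smul, smul_eq_mul]
      ring
    · intro h'
      rw [kappa_comm, kappa_lie', lie_h_h, map_zero]
  induction x using S2.induction with
  | hadd a b ha hb =>
    simp only [map_add, LinearMap.add_apply, ha, hb, mul_add, Finset.sum_add_distrib]
  | h z w =>
    rw [lieForm_sprod' (kappa_comm ω), key z w, kappa_comm ω ⁅z, (h : L)⁆, key w z,
      ← Finset.sum_add_distrib, Finset.mul_sum]
    refine Finset.sum_congr rfl fun β _ => ?_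
    rw [bform_sprod]
    ring

/-- The element `e_α h - ½ ∑ β(h) [e_α, e_{-β}] e_β` of `𝒜`. -/
def yy (α : H.root) : H →ₗ[ℂ] S2 L :=
  sprod (C.e α) ∘ₗ H.toSubmodule.subtype - (1 / 2 : ℂ) • ∑ β : H.root,
    ((rootSystem H).root β).smulRight (sprod ⁅C.e α, C.e (negRoot β)⁆ (C.e β))

lemma yy_apply (α : H.root) (h : H) : yy C α h = sprod (C.e α) (h : L) - (1 / 2 : ℂ) •
    ∑ β : H.root, β.1 h • sprod ⁅C.e α, C.e (negRoot β)⁆ (C.e β) := by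
  simp only [yy, LinearMap.sub_apply, LinearMap.smul_apply, LinearMap.sum_apply,
    LinearMap.smulRight_apply]
  rfl

/-- On `𝒱` the sum in the definition computes `lieForm` against e_α h, which is 2B there; the factor
½ makes the two contributions cancel. -/
lemma yy_mem (α : H.root) (h : H) : yy C α h ∈ calA C ω := by
  rw [mem_calA_iff]
  intro v hv
  have h1 := lieForm_eq_of_mem_calV C ω hv (sprod (C.e α) (h : L))
  rw [lieForm_e_h C ω] at h1
  rw [yy_apply, map_sub, map_smul, map_sum]
  simp only [map_smul, smul_eq_mul]
  rw [h1]
  ring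

lemma bform_yy (α : H.root) {h : H} (hα : α.1 h = 0) (h' : H) :
    bform (kappa ω) (yy C α h) (sprod (C.e (negRoot α)) (h' : L)) =
      (1 / 2 : ℂ) * kappa ω (h : L) (h' : L) := by
  rw [yy_apply, map_sub, map_smul, map_sum, LinearMap.sub_apply, LinearMap.smul_apply,
    LinearMap.sum_apply, Finset.sum_eq_zero, smul_zero, sub_zero, bform_sprod, kappa_e_neg,
    kappa_e_h]
  · ring
  · intro β _
    by_cases hβ : β = α
    · rw [hβ, hα, zero_smul]; simp
    · rw [map_smul, LinearMap.smul_apply, bform_sprod, kappa_e_h,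
        kappa_comm ω (C.e β), kappa_e_e C ω (negRoot α) β (by rw [negRoot_negRoot]; exact hβ)]
      simp

variable {C ω} (hV : IsCompl (calA C ω).toSubmodule (calV C ω).toSubmodule)

/-- The map `α^⊥ → 𝒜`, `h ↦ bar (e_α h)`. -/
def barE (α : H.root) : perp α →ₗ[ℂ] calA C ω :=
  bar hV ∘ₗ sprod (C.e α) ∘ₗ H.toSubmodule.subtype ∘ₗ (perp α).subtype

lemma barE_apply (α : H.root) (h : perp α) : barE hV α h = bar hV (sprod (C.e α) ((h : H) : L)) :=
  rfl

lemma bar_e_h_mem (α : H.root) (h : H) :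
    bar hV (sprod (C.e α) (h : L)) ∈ LinearMap.range (barE hV α) :=
  ⟨toPerp α h, bar_e_toPerp hV α h⟩

lemma bar_yy_mem (α : H.root) {h : H} (hα : α.1 h = 0) :
    bar hV (yy C α h) ∈ LinearMap.range (barE hV α) := by
  rw [yy_apply, map_sub, map_smul, map_sum]
  refine Submodule.sub_mem _ (bar_e_h_mem hV α h) (Submodule.smul_mem _ _
    (Submodule.sum_mem _ fun β _ => ?_))
  rw [map_smul]
  by_cases hβ : β = α
  · rw [hβ, hα, zero_smul]; exact Submodule.zero_mem _
  refine Submodule.smul_mem _ _ ?_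
  by_cases h1 : pI α β = 1
  · have h2 := bar_lie_sprod hV (α := α) (β := negRoot β) (by rw [pI_symm]; simp [h1])
    rw [negRoot_negRoot] at h2
    rw [← lie_skew, map_neg, LinearMap.neg_apply, map_neg, h2, neg_neg]
    exact bar_e_h_mem hV α (coroot (negRoot β).1)
  · have h2 := pI_mem α β
    have h3 : pI α β ≠ 2 := fun h => hβ (pI_eq_two_iff.mp h).symm
    rw [lie_e_e_eq_zero C (by rw [pI_neg_right]; omega)]
    simp

/-- The map h ↦ bar(y_α(h)) is injective on α^⊥ by its entries against e_{-α} h'. Its range lies in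
that of h ↦ bar(e_α h), whose dimension is at most dim α^⊥, so the ranges coincide. -/
lemma exists_eq_yy (α : H.root) (h : perp α) :
    ∃ h' : perp α, bar hV (sprod (C.e α) ((h : H) : L)) = bar hV (yy C α (h' : H)) := by
  let Y : perp α →ₗ[ℂ] calA C ω := bar hV ∘ₗ yy C α ∘ₗ (perp α).subtype
  have hYi : Function.Injective Y := by
    refine (injective_iff_map_eq_zero Y).mpr fun x hx => ?_
    have hx' : yy C α (x : H) = 0 := by
      have h1 : Y x = ⟨_, yy_mem C ω α (x : H)⟩ := bar_of_mem hV _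
      rw [h1] at hx
      exact congrArg Subtype.val hx
    refine Subtype.ext (eq_zero_of_kappa ω fun z => ?_)
    have h2 := bform_yy C ω α x.2 z
    rw [hx', map_zero, LinearMap.zero_apply] at h2
    linear_combination -2 * h2
  have hle : LinearMap.range Y ≤ LinearMap.range (barE hV α) := by
    rintro _ ⟨x, rfl⟩
    exact bar_yy_mem hV α x.2
  have heq : LinearMap.range Y = LinearMap.range (barE hV α) := by
    refine Submodule.eq_of_le_of_finrank_le hle ?_
    rw [LinearMap.finrank_range_of_inj hYi]
    exact LinearMap.finrank_range_le _
  have hmem : barE hV α h ∈ LinearMap.range Y := by rw [heq]; exact ⟨h, rfl⟩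
  obtain ⟨h', hh'⟩ := hmem
  exact ⟨h', hh'.symm⟩

/-- In the leading term ζ(x) kills e_α and sends h to a multiple of h_α, and e_α h_α is in `𝒱`. In
the term of β with pairing 1, put γ = α - β and let p be the projection of h_β to α^⊥. Then h_β =
½h_α + p and h_γ = ½h_α - p, so the eigenvalues of x at β and γ cancel by the two vanishing
hypotheses. -/
lemma calMul_yy_eq_zero {x : S2 L} (hx : HasWt (H := H) 0 x) (hxA : x ∈ calA C ω) (α : H.root)
    (hperp : ∀ h h' : perp α, bform (kappa ω) x (sprod ((h : H) : L) ((h' : H) : L)) = 0)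
    (hα : bform (kappa ω) x (sprod (hh α) (hh α)) = 0) (h : perp α) :
    bar hV (bullet (kappa ω) x (yy C α (h : H))) = 0 := by
  have hdec : ∀ z : H, (z : L) = (((toPerp α z : perp α) : H) : L) +
      ((1 / 2 : ℂ) * α.1 z) • hh α := by
    intro z
    have h1 : (((toPerp α z : perp α) : H) : L) = z - ((1 / 2 : ℂ) * α.1 z) • hh α := rfl
    rw [h1, sub_add_cancel]
  rw [yy_apply, map_sub, map_smul, map_sum, map_sub, map_smul, map_sum, Finset.sum_eq_zero]
  · have hz : zeta (kappa ω) x ((h : H) : L) =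
        ((1 / 2 : ℂ) * bform (kappa ω) x (sprod ((h : H) : L) (hh α))) • hh α := by
      refine eq_of_kappa C ω (fun z => ?_) fun δ => ?_
      · rw [← bform_sprod_right, map_smul, LinearMap.smul_apply, kappa_hh]
        conv_lhs => rw [hdec z, map_add, map_add, hperp, map_smul, map_smul]
        simp only [smul_eq_mul]
        ring
      · rw [← bform_sprod_right, map_smul, LinearMap.smul_apply, kappa_hh_e, smul_zero, sprod_comm]
        by_contra hne
        exact root_coe_ne_zero δ (funext fun y => by
          simpa using hx.add_eq_zero (hasWt_e_h C δ _) hne y)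
    have h1 : bform (kappa ω) x (sprod (C.e α) (C.e (negRoot α))) = 0 := by
      rw [bform_e_neg hxA, hα, mul_zero]
    rw [bullet_sprod_right, zeta_e hx, h1, hz, zero_smul, map_zero, LinearMap.zero_apply, zero_add,
      map_smul, map_smul, map_smul, bar_eq_zero hV (e_hh_mem_calV C ω α)]
    simp
  · intro β _
    rw [map_smul, map_smul]
    by_cases hβ : β = α
    · have h0 : α.1 (h : H) = 0 := h.2
      rw [hβ, h0, zero_smul]
    by_cases h1 : pI α β = 1
    · obtain ⟨γ, c, hγ, -, hlie⟩ := exists_lie_e_e C (α := α) (β := negRoot β) (by simp [h1])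
      have h2 : (((toPerp α (coroot β.1) : perp α) : H) : L) + (1 / 2 : ℂ) • hh α = hh β := by
        rw [hh_eq_coe β, hdec (coroot β.1), apply_coroot, h1]
        norm_num
      have h3 : (hh γ : L) = (1 / 2 : ℂ) • hh α -
          (((toPerp α (coroot β.1) : perp α) : H) : L) := by
        rw [hγ.hh_eq, hh_negRoot, ← h2]
        module
      have h4 := hperp (toPerp α (coroot β.1)) (toPerp α (coroot β.1))
      have h5 : bform (kappa ω) x (sprod (C.e γ) (C.e (negRoot γ))) +
          bform (kappa ω) x (sprod (C.e β) (C.e (negRoot β))) = 0 := by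
        rw [bform_e_neg hxA, bform_e_neg hxA, h3, ← h2]
        simp only [map_add, map_sub, map_smul, LinearMap.add_apply, LinearMap.sub_apply,
          LinearMap.smul_apply, h4, hα, sprod_comm (hh α)]
        simp only [smul_eq_mul]
        ring
      rw [hlie, map_smul, LinearMap.smul_apply, map_smul, bullet_e_e hx, h5]
      simp
    · have h2 := pI_mem α β
      have h3 : pI α β ≠ 2 := fun h => hβ (pI_eq_two_iff.mp h).symm
      rw [lie_e_e_eq_zero C (by rw [pI_neg_right]; omega)]
      simp

/-- Up to sign bar(h_α h') is e_{-α} applied to bar(e_α h'), so invariance moves e_{-α} to the test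
vector. It kills products from α^⊥ and sends h_α h_α into `𝒱`, which are the vanishing conditions
required of a factor annihilating y_α. -/
lemma calMul_bar_e_h_bar_h_h (α : H.root) (h h' : perp α) :
    calMul hV (bar hV (sprod (C.e α) ((h : H) : L))) (bar hV (sprod (hh α) ((h' : H) : L))) =
      0 := by
  obtain ⟨k, hk⟩ := exists_eq_yy hV α h
  rw [calMul_comm, hk, calMul_apply, bar_of_mem hV (yy_mem C ω α (k : H))]
  have hB : ∀ y : S2 L, bform (kappa ω) (bar hV (sprod (hh α) ((h' : H) : L)) : S2 L) y =
      bform (kappa ω) (bar hV (sprod (C.e α) ((h' : H) : L)) : S2 L) ⁅C.e (negRoot α), y⁆ := by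
    intro y
    have h1 : bar hV (sprod (hh α) ((h' : H) : L)) =
        -⁅C.e (negRoot α), bar hV (sprod (C.e α) ((h' : H) : L))⁆ := by
      rw [← bar_lie, lie_neg_e_h h'.2, map_neg, neg_neg]
    have h2 := bform_lieInvariant _ (kappa_lieInvariant ω) (C.e (negRoot α))
      (bar hV (sprod (C.e α) ((h' : H) : L)) : S2 L) y
    rw [h1]
    change bform (kappa ω) (-⁅C.e (negRoot α),
      (bar hV (sprod (C.e α) ((h' : H) : L)) : S2 L)⁆) y = _
    rw [map_neg, LinearMap.neg_apply, h2, neg_neg]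
  have hw : HasWt (H := H) 0 (bar hV (sprod (hh α) ((h' : H) : L)) : S2 L) :=
    hasWt_bar hV (hasWt_h_h (coroot α.1) (h' : H))
  refine calMul_yy_eq_zero hV hw (Subtype.prop _) α
    (fun z z' => ?_) ?_ k
  · have h0 : ∀ z : perp α, (negRoot α).1 (z : H) = 0 := fun z => by
      rw [negRoot_apply]; exact neg_eq_zero.mpr z.2
    rw [hB, lie_sprod, lie_e_h, lie_e_h, h0, h0]
    simp
  · rw [hB, lie_sprod, lie_neg_hh, sprod_comm (hh α), ← two_smul ℂ, map_smul, map_smul,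
      LinearMap.smul_apply, map_smul, bform_comm (kappa_comm ω)]
    have h1 := e_hh_mem_calV C ω (negRoot α)
    rw [hh_negRoot, map_neg] at h1
    rw [bform_eq_zero_of_mem (neg_mem_iff.mp h1) (Subtype.prop _)]
    simp

lemma lie_e_bar_h_h_mem (α : H.root) (h h' : H) :
    ⁅C.e α, bar hV (sprod (h : L) (h' : L))⁆ ∈ LinearMap.range (barE hV α) := by
  rw [← bar_lie, lie_sprod, lie_e_h, lie_e_h, sprod_comm (h : L), map_add]
  simp only [map_smul, LinearMap.smul_apply]
  exact Submodule.add_mem _ (Submodule.smul_mem _ _ (bar_e_h_mem hV α _))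
    (Submodule.smul_mem _ _ (bar_e_h_mem hV α _))

lemma lie_e_bar_lift_mem (α : H.root) (v : frakJ ω) :
    ⁅C.e α, bar hV (lift ω v)⁆ ∈ LinearMap.range (barE hV α) := by
  refine induction_frakJ ω (p := fun f => ⁅C.e α, bar hV (lift ω f)⁆ ∈ LinearMap.range (barE hV α))
    ?_ ?_ ?_ v.2
  · intro β
    rw [jEnd, lift_zeta]
    exact lie_e_bar_h_h_mem hV α (coroot β.1) (coroot β.1)
  · intro x y hx hy; rw [map_add, map_add, lie_add]; exact Submodule.add_mem _ hx hy
  · intro c x hx; rw [map_smul, map_smul, lie_smul]; exact Submodule.smul_mem _ c hx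

/-- Write w = bar(e_α h). By the Leibniz rule e_α(v ∗ e_{-α}w) is (e_α v) ∗ (e_{-α}w) + v ∗ (e_α
e_{-α}w). The first term vanishes since e_α v has the form bar(e_α k), and e_α e_{-α}w = 2w. -/
lemma half_smul_lie_calMul (v : frakJ ω) (α : H.root) (h : perp α) :
    (1 / 2 : ℂ) • ⁅C.e α, calMul hV (bar hV (lift ω v))
      ⁅C.e (negRoot α), bar hV (sprod (C.e α) ((h : H) : L))⁆⁆ =
    calMul hV (bar hV (lift ω v)) (bar hV (sprod (C.e α) ((h : H) : L))) := by
  obtain ⟨k, hk⟩ := lie_e_bar_lift_mem hV α v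
  have h1 : ⁅C.e α, ⁅C.e (negRoot α), bar hV (sprod (C.e α) ((h : H) : L))⁆⁆ =
      (2 : ℂ) • bar hV (sprod (C.e α) ((h : H) : L)) := by
    have h0 : α.1 (h : H) = 0 := h.2
    rw [← bar_lie, ← bar_lie, lie_neg_e_h h0, lie_neg, lie_sprod, hh_eq_coe, lie_e_h, lie_e_h, h0,
      apply_coroot, pI_self, ← map_smul]
    congr 1
    simp
  rw [lie_calMul, h1, ← hk, barE_apply, ← bar_lie, lie_neg_e_h h.2, map_neg, map_neg,
    calMul_bar_e_h_bar_h_h, neg_zero, zero_add, map_smul, smul_smul]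
  norm_num

variable {a b : Lam₀ H → H.root}
variable (hab : ∀ μ, (rootSystem H).root (a μ) + (rootSystem H).root (b μ) = μ.1)
variable (hV₀ : IsCompl (frakA₀ C ω) (frakV C ω)) (hJ : Function.Bijective (piJ hV₀))

lemma frakMul_inJ_inPerp (v : frakJ ω) (α : H.root) (h : perp α) :
    frakMul hV hab (inJ ω v) (inPerp ω α h) = (1 / 2 : ℂ) • frakAct (theta hab hV) (C.e α)
      (inJ ω (diamond hV₀ hJ v
        (frakAct (theta hab hV) (C.e (negRoot α)) (inPerp ω α h)).1)) := by
  refine (theta hab hV).injective ?_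
  have h1 : inJ ω (frakAct (theta hab hV) (C.e (negRoot α)) (inPerp ω α h)).1 =
      frakAct (theta hab hV) (C.e (negRoot α)) (inPerp ω α h) := by
    rw [frakAct_inPerp]; rfl
  rw [theta_frakMul, map_smul, theta_frakAct, ← frakMul_inJ_inJ hV hab, h1, theta_frakMul,
    theta_frakAct, theta_inJ, theta_inPerp, half_smul_lie_calMul]

end RootComponents

/-! ### Products of 𝔍 with the vectors x_λ -/

section OrthogonalPairs

variable {L : Type*} [LieRing L] [LieAlgebra ℂ L] [FiniteDimensional ℂ L] [IsKilling ℂ L]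
variable {H : LieSubalgebra ℂ L} [H.IsCartanSubalgebra]
variable [SimplyLaced H] [(rootSystem H).IsIrreducible]

lemma reflectionPerm_apply (α γ : H.root) (x : H) :
    ((rootSystem H).reflectionPerm α γ).1 x = γ.1 x - pI γ α * α.1 x := by
  have h := LinearMap.congr_fun ((rootSystem H).root_reflectionPerm α γ) x
  rw [RootPairing.reflection_apply_root, rootSystem_pairing_apply, apply_coroot] at h
  exact h

lemma pI_reflectionPerm (α γ δ : H.root) :
    pI ((rootSystem H).reflectionPerm α γ) δ = pI γ δ - pI γ α * pI α δ := by
  rw [pI_eq_iff, reflectionPerm_apply, apply_coroot, apply_coroot]; push_cast; rfl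

/-- The permutation `α ↦ -α` of the roots. -/
def negPerm : Equiv.Perm H.root := Function.Involutive.toPerm negRoot negRoot_negRoot

lemma negPerm_apply (α : H.root) : negPerm α = negRoot α := rfl

open Classical in
lemma filter_pI_add_eq_two {α β : H.root} (h : pI α β = 0) :
    ({δ : H.root | pI δ α + pI δ β = 2} : Finset H.root) =
      insert α (insert β ({δ : H.root | pI δ α = 1 ∧ pI δ β = 1} : Finset H.root)) := by
  ext δ
  simp only [Finset.mem_filter_univ, Finset.mem_insert]
  constructor
  · intro hδ
    have h1 := pI_mem δ α
    have h2 := pI_mem δ β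
    by_cases h3 : pI δ α = 2
    · exact Or.inl (pI_eq_two_iff.mp h3)
    by_cases h4 : pI δ β = 2
    · exact Or.inr (Or.inl (pI_eq_two_iff.mp h4))
    exact Or.inr (Or.inr (by omega))
  · rintro (rfl | rfl | hδ)
    · rw [pI_self, h]; norm_num
    · rw [pI_self, pI_symm, h]; norm_num
    · omega

lemma exists_add_eq {α β δ : H.root} (h : pI α β = 0) (hδ : pI δ α + pI δ β = 2) :
    ∃ ε : H.root, ∀ x : H, δ.1 x + ε.1 x = α.1 x + β.1 x := by
  classical
  have h1 : δ ∈ ({δ : H.root | pI δ α + pI δ β = 2} : Finset H.root) := by simpa using hδ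
  rw [filter_pI_add_eq_two h] at h1
  simp only [Finset.mem_filter_univ, Finset.mem_insert] at h1
  rcases h1 with rfl | rfl | ⟨h1, h2⟩
  · exact ⟨β, fun x => rfl⟩
  · exact ⟨α, fun x => add_comm _ _⟩
  -- Reflecting in α and then in β gives δ - α - β, so its negative is the complement of δ.
  · refine ⟨negRoot ((rootSystem H).reflectionPerm β ((rootSystem H).reflectionPerm α δ)),
      fun x => ?_⟩
    rw [negRoot_apply, reflectionPerm_apply, reflectionPerm_apply, pI_reflectionPerm, h1, h2, h]
    push_cast
    ring

lemma pI_add_eq_two {α β γ δ : H.root} (h : pI α β = 0)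
    (h' : ∀ x : H, γ.1 x + δ.1 x = α.1 x + β.1 x) : pI γ α + pI γ β = 2 := by
  have h1 := h' (coroot γ.1)
  simp only [apply_coroot] at h1
  have h2 : pI γ γ + pI δ γ = pI α γ + pI β γ := by exact_mod_cast h1
  rw [pI_symm δ γ, pI_eq_zero_of_add_eq h h', pI_self, pI_symm α, pI_symm β] at h2
  omega

open Classical in
-- The roots counted on the right are exactly those occurring in some pair with sum μ. Each has a
-- unique partner, different from itself, so δ ↦ {δ, ε(δ)} is two-to-one onto the pairs.
lemma two_mul_nPairs {α β : H.root} (h : pI α β = 0) {μ : Module.Dual ℂ H}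
    (hμ : ∀ x : H, α.1 x + β.1 x = μ x) :
    2 * nPairs μ = ({δ : H.root | pI δ α + pI δ β = 2} : Finset H.root).card := by
  set D : Finset H.root := {δ : H.root | pI δ α + pI δ β = 2} with hD
  have : Nonempty H.root := ⟨α⟩
  have hex : ∀ δ : H.root, δ ∈ D → ∃ ε : H.root, ∀ x : H, δ.1 x + ε.1 x = α.1 x + β.1 x :=
    fun δ hδ => exists_add_eq h (by simpa [hD] using hδ)
  choose! ε hε using hex
  have hmem : ∀ {γ δ : H.root}, (∀ x : H, γ.1 x + δ.1 x = α.1 x + β.1 x) → γ ∈ D := fun h' => by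
    rw [hD, Finset.mem_filter_univ]; exact pI_add_eq_two h h'
  have huniq : ∀ {γ δ : H.root}, (∀ x : H, γ.1 x + δ.1 x = α.1 x + β.1 x) → ε γ = δ := fun h' =>
    root_ext fun x => by linear_combination hε _ (hmem h') x - h' x
  have hP : {s : Sym2 H.root | ∃ γ δ : H.root, s = s(γ, δ) ∧
      (rootSystem H).root γ + (rootSystem H).root δ = μ} = ↑(D.image fun δ => s(δ, ε δ)) := by
    ext s
    simp only [Set.mem_ofPred_eq, Finset.coe_image, Set.mem_image, Finset.mem_coe]
    constructor
    · rintro ⟨γ, δ, rfl, h1⟩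
      have h2 : ∀ x : H, γ.1 x + δ.1 x = α.1 x + β.1 x := fun x => by
        rw [hμ, ← h1]; rfl
      exact ⟨γ, hmem h2, by rw [huniq h2]⟩
    · rintro ⟨δ, hδ, rfl⟩
      refine ⟨δ, ε δ, rfl, LinearMap.ext fun x => ?_⟩
      rw [← hμ]
      exact hε δ hδ x
  rw [nPairs, hP, Set.ncard_coe_finset, Finset.card_eq_sum_card_image (fun δ => s(δ, ε δ)) D,
    Finset.sum_const_nat (m := 2), mul_comm]
  intro s hs
  obtain ⟨δ, hδ, rfl⟩ := Finset.mem_image.mp hs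
  have h1 : ∀ x : H, (ε δ).1 x + δ.1 x = α.1 x + β.1 x := fun x => by
    rw [add_comm]; exact hε δ hδ x
  have hne : δ ≠ ε δ := fun heq => by
    have h2 := pI_eq_zero_of_add_eq h (hε δ hδ)
    rw [← heq, pI_self] at h2
    norm_num at h2
  have h3 : D.filter (fun γ => s(γ, ε γ) = s(δ, ε δ)) = {δ, ε δ} := by
    ext γ
    simp only [Finset.mem_filter, Finset.mem_insert, Finset.mem_singleton, Sym2.eq_iff]
    constructor
    · rintro ⟨-, ⟨h4, -⟩ | ⟨h4, -⟩⟩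
      · exact Or.inl h4
      · exact Or.inr h4
    · rintro (rfl | rfl)
      · exact ⟨hδ, Or.inl ⟨rfl, rfl⟩⟩
      · exact ⟨hmem h1, Or.inr ⟨rfl, huniq h1⟩⟩
  rw [h3, Finset.card_pair hne]

open Classical in
lemma sum_reflectionPerm_left {α β : H.root} (h : pI α β = 0) (f : H.root → ℂ) :
    ∑ γ : H.root with pI γ α = -1 ∧ pI γ β = 1, f ((rootSystem H).reflectionPerm α γ) =
      ∑ δ : H.root with pI δ α = 1 ∧ pI δ β = 1, f δ := by
  refine Finset.sum_equiv ((rootSystem H).reflectionPerm α) (fun γ => ?_) fun _ _ => rfl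
  simp only [Finset.mem_filter_univ, pI_reflectionPerm, pI_self, h]
  omega

open Classical in
lemma sum_reflectionPerm_right {α β : H.root} (h : pI α β = 0) (f : H.root → ℂ) :
    ∑ γ : H.root with pI γ α = -1 ∧ pI γ β = 1,
        f (negRoot ((rootSystem H).reflectionPerm β γ)) =
      ∑ δ : H.root with pI δ α = 1 ∧ pI δ β = 1, f δ := by
  refine Finset.sum_equiv (((rootSystem H).reflectionPerm β).trans negPerm) (fun γ => ?_)
    fun _ _ => rfl
  simp only [Finset.mem_filter_univ, Equiv.trans_apply, negPerm_apply, pI_neg_left,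
    pI_reflectionPerm, pI_self, pI_symm β α, h]
  omega

variable (C : Chevalley H) (ω : H.root)

lemma kappa_lie_e_lie_e_of_pI_eq_zero {α β : H.root} (h : pI α β = 0) (z w : L) :
    kappa ω ⁅z, C.e α⁆ ⁅w, C.e β⁆ =
      ∑ γ : H.root, kappa ω z ⁅C.e γ, C.e α⁆ * kappa ω w ⁅C.e (negRoot γ), C.e β⁆ := by
  -- The added multiple of h_α cancels the Cartan component of [z, e_α], so that the root expansion
  -- applies; it is invisible to [w, e_β] because α and β are orthogonal.
  have h1 : kappa ω ⁅w, C.e β⁆ (⁅z, C.e α⁆ + kappa ω z (C.e α) • hh α) =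
      kappa ω ⁅z, C.e α⁆ ⁅w, C.e β⁆ := by
    have h2 : kappa ω ⁅w, C.e β⁆ (hh α) = 0 := by
      rw [kappa_lie', hh_eq_coe, lie_e_h, apply_coroot, pI_symm, h]
      simp
    rw [map_add, map_smul, h2, smul_zero, add_zero, kappa_comm]
  rw [← h1, kappa_eq_sum C ω]
  · refine Finset.sum_congr rfl fun γ _ => ?_
    rw [kappa_comm ω (C.e (negRoot γ)), kappa_comm ω (C.e γ), map_add, LinearMap.add_apply,
      map_smul, LinearMap.smul_apply, kappa_hh_e, kappa_lie', kappa_lie', ← lie_skew (C.e β),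
      ← lie_skew (C.e α)]
    simp only [map_neg, smul_zero, add_zero]
    ring
  · intro x
    rw [map_add, map_smul, kappa_comm, kappa_lie', lie_e_h, map_smul, kappa_comm ω (x : L) (hh α),
      kappa_hh]
    simp only [smul_eq_mul]
    ring

lemma lieForm_e_e {α β : H.root} (h : pI α β = 0) (x : S2 L) :
    lieForm (kappa ω) x (sprod (C.e α) (C.e β)) = ∑ γ : H.root,
      bform (kappa ω) x (sprod ⁅C.e γ, C.e α⁆ ⁅C.e (negRoot γ), C.e β⁆) := by
  induction x using S2.induction with
  | hadd a b ha hb =>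
    simp only [map_add, LinearMap.add_apply, ha, hb, Finset.sum_add_distrib]
  | h z w =>
    rw [lieForm_sprod' (kappa_comm ω), kappa_lie_e_lie_e_of_pI_eq_zero C ω h z w,
      kappa_comm ω ⁅z, C.e β⁆, kappa_lie_e_lie_e_of_pI_eq_zero C ω h w z,
      ← Finset.sum_add_distrib, Finset.mul_sum]
    refine Finset.sum_congr rfl fun γ _ => ?_
    rw [bform_sprod]
    ring

lemma e_e_sub_sum_mem {α β : H.root} (h : pI α β = 0) :
    sprod (C.e α) (C.e β) - (1 / 2 : ℂ) • ∑ γ : H.root,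
      sprod ⁅C.e γ, C.e α⁆ ⁅C.e (negRoot γ), C.e β⁆ ∈ calA C ω := by
  rw [mem_calA_iff]
  intro v hv
  have h1 := lieForm_eq_of_mem_calV C ω hv (sprod (C.e α) (C.e β))
  rw [lieForm_e_e C ω h] at h1
  rw [map_sub, map_smul, map_sum, h1, smul_eq_mul]
  ring

lemma sprod_lie_e_lie_e_eq_zero {α β γ : H.root} (h : pI α β = 0)
    (hγ : ¬ (pI γ α = -1 ∧ pI γ β = 1)) :
    sprod ⁅C.e γ, C.e α⁆ ⁅C.e (negRoot γ), C.e β⁆ = 0 := by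
  rcases le_or_gt 0 (pI γ α) with h1 | h1
  · rw [lie_e_e_eq_zero C h1, map_zero, LinearMap.zero_apply]
  rcases le_or_gt (pI γ β) 0 with h2 | h2
  · rw [lie_e_e_eq_zero C (α := negRoot γ) (by rw [pI_neg_left]; omega), map_zero]
  exfalso
  have h3 := pI_mem γ α
  have h4 := pI_mem γ β
  by_cases h5 : pI γ α = -2
  · rw [pI_eq_neg_two_iff] at h5
    subst h5
    rw [pI_neg_left, h] at h2
    norm_num at h2
  by_cases h6 : pI γ β = 2
  · rw [pI_eq_two_iff] at h6
    subst h6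
    rw [pI_symm, h] at h1
    norm_num at h1
  omega

variable {C ω}

lemma bullet_sprod_lie_e_lie_e {x : S2 L} (hx : HasWt (H := H) 0 x) {α β γ : H.root}
    (hα : pI γ α = -1) (hβ : pI γ β = 1) :
    bullet (kappa ω) x (sprod ⁅C.e γ, C.e α⁆ ⁅C.e (negRoot γ), C.e β⁆) = ((1 / 2 : ℂ) *
      (bform (kappa ω) x (sprod (C.e ((rootSystem H).reflectionPerm α γ))
          (C.e (negRoot ((rootSystem H).reflectionPerm α γ)))) +
        bform (kappa ω) x (sprod (C.e (negRoot ((rootSystem H).reflectionPerm β γ)))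
          (C.e (negRoot (negRoot ((rootSystem H).reflectionPerm β γ))))))) •
      sprod ⁅C.e γ, C.e α⁆ ⁅C.e (negRoot γ), C.e β⁆ := by
  have h1 : IsSum γ α ((rootSystem H).reflectionPerm α γ) := fun y => by
    rw [reflectionPerm_apply, hα]; push_cast; ring
  have h2 : IsSum (negRoot γ) β (negRoot ((rootSystem H).reflectionPerm β γ)) := fun y => by
    rw [negRoot_apply, negRoot_apply, reflectionPerm_apply, hβ]; push_cast; ring
  obtain ⟨c, hc⟩ := lie_e_e_of_isSum C h1
  obtain ⟨d, hd⟩ := lie_e_e_of_isSum C h2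
  rw [hc, hd]
  simp only [map_smul, LinearMap.smul_apply]
  rw [bullet_e_e hx]
  module

variable (hV : IsCompl (calA C ω).toSubmodule (calV C ω).toSubmodule)

open Classical in
-- Modulo `𝒱` each nonzero term of e_α e_β - ½∑ [e_γ,e_α][e_{-γ},e_β] is a multiple of e_α e_β, so
-- this element of `𝒜` is (1 + ½|D₁|) W. Multiplication by X is diagonal on its terms, with
-- eigenvalues the half-sums ½(f(γ+α) + f(β-γ)) for the indices in S. Reflections reindex the terms
-- by D₁, and comparison gives the average of f over D₁ ∪ {α, β}.
lemma card_smul_calMul_bar_e_e {X : calA C ω} (hX : HasWt (H := H) 0 (X : S2 L)) {α β : H.root}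
    (h : pI α β = 0) :
    (({δ : H.root | pI δ α + pI δ β = 2} : Finset H.root).card : ℂ) •
      calMul hV X (bar hV (sprod (C.e α) (C.e β))) =
    (∑ δ : H.root with pI δ α + pI δ β = 2,
      bform (kappa ω) X (sprod (C.e δ) (C.e (negRoot δ)))) •
      bar hV (sprod (C.e α) (C.e β)) := by
  set W := bar hV (sprod (C.e α) (C.e β)) with hW
  set f : H.root → ℂ := fun δ => bform (kappa ω) X (sprod (C.e δ) (C.e (negRoot δ))) with hf
  set D₁ : Finset H.root := {δ : H.root | pI δ α = 1 ∧ pI δ β = 1} with hD₁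
  set S : Finset H.root := {γ : H.root | pI γ α = -1 ∧ pI γ β = 1} with hS
  have hβ : β ∉ D₁ := by simp [hD₁]
  have hα : α ∉ insert β D₁ := by
    simp only [Finset.mem_insert, not_or]
    refine ⟨fun h1 => ?_, by simp [hD₁]⟩
    rw [h1, pI_self] at h
    norm_num at h
  have hcard : (S.card : ℂ) = D₁.card := by
    have h1 := sum_reflectionPerm_left h fun _ => 1
    simpa only [Finset.sum_const, nsmul_eq_mul, mul_one] using h1
  have hbar : ∀ γ ∈ S, bar hV (sprod ⁅C.e γ, C.e α⁆ ⁅C.e (negRoot γ), C.e β⁆) = -W := by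
    intro γ hγ
    rw [hS, Finset.mem_filter_univ] at hγ
    exact bar_lie_sprod_lie hV h hγ.1 hγ.2
  have hsum : ∑ γ : H.root, sprod ⁅C.e γ, C.e α⁆ ⁅C.e (negRoot γ), C.e β⁆ =
      ∑ γ ∈ S, sprod ⁅C.e γ, C.e α⁆ ⁅C.e (negRoot γ), C.e β⁆ := by
    refine (Finset.sum_subset (Finset.subset_univ S) fun γ _ hγ => ?_).symm
    rw [hS, Finset.mem_filter_univ] at hγ
    exact sprod_lie_e_lie_e_eq_zero C h hγ
  have hmem := e_e_sub_sum_mem C ω h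
  rw [hsum] at hmem
  have h1 : (⟨_, hmem⟩ : calA C ω) = (1 + (1 / 2 : ℂ) * D₁.card) • W := by
    rw [← bar_of_mem hV, map_sub, map_smul, map_sum, Finset.sum_congr rfl hbar, Finset.sum_const,
      ← hW, ← Nat.cast_smul_eq_nsmul ℂ, hcard]
    module
  have h2 : calMul hV X ⟨_, hmem⟩ = ((1 / 2 : ℂ) * (f α + f β + ∑ δ ∈ D₁, f δ)) • W := by
    rw [calMul_apply, map_sub, map_smul, map_sum, bullet_e_e hX, map_sub, map_smul, map_smul,
      map_sum, ← hW]
    have h3 : ∀ γ ∈ S, bar hV (bullet (kappa ω) X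
        (sprod ⁅C.e γ, C.e α⁆ ⁅C.e (negRoot γ), C.e β⁆)) =
        (-(1 / 2 : ℂ) * (f ((rootSystem H).reflectionPerm α γ) +
          f (negRoot ((rootSystem H).reflectionPerm β γ)))) • W := by
      intro γ hγ
      have hγ' := hγ
      rw [hS, Finset.mem_filter_univ] at hγ'
      rw [bullet_sprod_lie_e_lie_e hX hγ'.1 hγ'.2, map_smul, hbar γ hγ, smul_neg, ← neg_smul,
        neg_mul]
    rw [Finset.sum_congr rfl h3, ← Finset.sum_smul, ← Finset.mul_sum, Finset.sum_add_distrib,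
      sum_reflectionPerm_left h f, sum_reflectionPerm_right h f]
    module
  rw [h1, map_smul] at h2
  rw [filter_pI_add_eq_two h, Finset.card_insert_of_notMem hα, Finset.card_insert_of_notMem hβ,
    Finset.sum_insert hα, Finset.sum_insert hβ]
  have h4 := congrArg (fun z => (2 : ℂ) • z) h2
  simp only [smul_smul] at h4
  convert h4 using 2
  · push_cast; ring
  · ring

variable {a b : Lam₀ H → H.root}
variable (hab : ∀ μ, (rootSystem H).root (a μ) + (rootSystem H).root (b μ) = μ.1)
variable (hV₀ : IsCompl (frakA₀ C ω) (frakV C ω))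

include hab in
lemma formJ_frakE (v : frakJ ω) (μ : Lam₀ H) : formJ hV₀ v (frakE ω μ.1) •
      bar hV (sprod (C.e (a μ)) (C.e (b μ))) =
    calMul hV (bar hV (lift ω v)) (bar hV (sprod (C.e (a μ)) (C.e (b μ)))) := by
  classical
  have h0 := pI_a_b hab μ
  set X := bar hV (lift ω (v : Module.End ℂ L)) with hX
  have hX0 : HasWt (H := H) 0 (X : S2 L) := hasWt_bar hV (hasWt_lift ω v.2)
  set D : Finset H.root := {δ : H.root | pI δ (a μ) + pI δ (b μ) = 2} with hD
  have hDμ : ({δ : H.root | μ.1 (coroot δ.1) = 2} : Finset H.root) = D := by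
    ext δ
    rw [hD, Finset.mem_filter_univ, Finset.mem_filter_univ, ← hab_apply hab, apply_coroot,
      apply_coroot, pI_symm δ, pI_symm δ]
    norm_cast
  have hn : ((2 * nPairs μ.1 : ℕ) : ℂ) = D.card := by
    rw [two_mul_nPairs h0 (hab_apply hab μ)]
  have hD0 : (D.card : ℂ) ≠ 0 := by
    rw [Nat.cast_ne_zero, Finset.card_ne_zero]
    exact ⟨a μ, by rw [hD, Finset.mem_filter_univ, pI_self, h0]; norm_num⟩
  -- The factor 2 comes from orthogonality of X to v_δ; with 4n_μ in the definition of `frakE` and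
  -- 2n_μ = |D| it leaves the average over D.
  have hj : ∀ δ : H.root, formJ hV₀ v (jJ ω δ) =
      2 * bform (kappa ω) X (sprod (C.e δ) (C.e (negRoot δ))) := by
    intro δ
    rw [bform_e_neg X.2, formJ_eq hV]
    change bform (kappa ω) (X : S2 L) (bar hV (lift ω (jEnd ω δ)) : S2 L) = _
    rw [jEnd, lift_zeta, bform_comm (kappa_comm ω), bform_bar hV _ X.2, bform_comm (kappa_comm ω)]
    ring
  have hE : formJ hV₀ v (frakE ω μ.1) =
      (D.card : ℂ)⁻¹ * ∑ δ ∈ D, bform (kappa ω) X (sprod (C.e δ) (C.e (negRoot δ))) := by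
    rw [frakE, map_smul, map_sum, Finset.sum_congr rfl fun δ _ => hj δ, ← Finset.mul_sum,
      smul_eq_mul, ← hn, ← hDμ, ← mul_assoc]
    congr 1
    push_cast
    rw [mul_inv, mul_inv]
    ring
  rw [hE, mul_smul, ← card_smul_calMul_bar_e_e hV hX0 h0, ← hD, smul_smul, inv_mul_cancel₀ hD0,
    one_smul]

lemma frakMul_inJ_xx (v : frakJ ω) (μ : Lam₀ H) :
    frakMul hV hab (inJ ω v) (xx ω μ) = formJ hV₀ v (frakE ω μ.1) • xx ω μ :=
  (theta hab hV).injective (by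
    rw [theta_frakMul, map_smul, theta_xx, theta_inJ, formJ_frakE hV hab])

variable (hJ : Function.Bijective (piJ hV₀))

lemma extends_frakMul : Extends hJ (theta hab hV) (frakMul hV hab) (frakForm hV hab) where
  mul_J := frakMul_inJ_inJ hV hab hV₀ hJ
  mul_perp := frakMul_inJ_inPerp hV hab hV₀ hJ
  mul_x := frakMul_inJ_xx hV hab hV₀
  form_J := frakForm_inJ_inJ hV hab hV₀
  form_perp := frakForm_inJ_inPerp hV hab
  form_x := frakForm_inJ_xx hV hab

end OrthogonalPairs

/-! ### Uniqueness of the extension -/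

section Uniqueness

variable {L : Type*} [LieRing L] [LieAlgebra ℂ L] [FiniteDimensional ℂ L] [IsKilling ℂ L]
variable {H : LieSubalgebra ℂ L} [H.IsCartanSubalgebra]
variable [SimplyLaced H] [(rootSystem H).IsIrreducible]
variable {C : Chevalley H} {ω : H.root}
variable (hV : IsCompl (calA C ω).toSubmodule (calV C ω).toSubmodule)
variable {a b : Lam₀ H → H.root}
variable (hab : ∀ μ, (rootSystem H).root (a μ) + (rootSystem H).root (b μ) = μ.1)

/-- The operator e_α e_{-α} acts on the copy of α^⊥ as multiplication by 2, and e_{-α} maps that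
copy into `𝔍`. -/
lemma inPerp_eq (α : H.root) (h : perp α) : inPerp ω α h = (1 / 2 : ℂ) •
    frakAct (theta hab hV) (C.e α)
      (inJ ω (-⟨_, zeta_h_h_mem ω (coroot α.1) (h : H)⟩)) := by
  refine (theta hab hV).injective ?_
  have h0 : α.1 (h : H) = 0 := h.2
  rw [map_smul, theta_frakAct, ← frakAct_inPerp hV hab, theta_frakAct, theta_inPerp, ← bar_lie,
    ← bar_lie, lie_neg_e_h h0, lie_neg, lie_sprod, hh_eq_coe, lie_e_h, lie_e_h, h0, apply_coroot,
    pI_self, ← map_smul]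
  congr 1
  simp

/-- Apply e_b to e_a h_b: orthogonality kills [e_b, e_a], and [e_b, h_b] = -2 e_b. -/
lemma xx_eq (μ : Lam₀ H) : ∃ h : perp (a μ), xx ω μ = (-(1 / 2) : ℂ) •
    frakAct (theta hab hV) (C.e (b μ)) (inPerp ω (a μ) h) := by
  have h0 := pI_a_b hab μ
  have hp : coroot (b μ).1 ∈ perp (a μ) := by
    change (a μ).1 (coroot (b μ).1) = 0
    rw [apply_coroot, h0, Int.cast_zero]
  have hb : (b μ).1 (coroot (b μ).1) = 2 := by rw [apply_coroot, pI_self]; norm_num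
  refine ⟨⟨_, hp⟩, (theta hab hV).injective ?_⟩
  rw [map_smul, theta_frakAct, theta_inPerp, theta_xx, ← bar_lie, lie_sprod,
    lie_e_e_eq_zero C (by rw [pI_symm, h0]), lie_e_h, hb, ← map_smul]
  congr 1
  simp

variable {M : Type*} [AddCommGroup M] [Module ℂ M]

/-- As an `L`-module, `𝔄` is generated by `𝔍`. -/
lemma FrakA.hom_ext_of_inJ {f g : FrakA ω →ₗ[ℂ] M} (hJ : ∀ u, f (inJ ω u) = g (inJ ω u))
    (hstep : ∀ ℓ v, f v = g v → f (frakAct (theta hab hV) ℓ v) = g (frakAct (theta hab hV) ℓ v)) :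
    f = g := by
  have hperp : ∀ α h, f (inPerp ω α h) = g (inPerp ω α h) := fun α h => by
    rw [inPerp_eq hV hab, map_smul, map_smul, hstep _ _ (hJ _)]
  refine FrakA.hom_ext hJ hperp fun μ => ?_
  obtain ⟨h, hh⟩ := xx_eq hV hab (ω := ω) μ
  rw [hh, map_smul, map_smul, hstep _ _ (hperp _ _)]

variable {hV₀ : IsCompl (frakA₀ C ω) (frakV C ω)} (hJ : Function.Bijective (piJ hV₀))
variable {mul mul' : FrakA ω →ₗ[ℂ] FrakA ω →ₗ[ℂ] FrakA ω}
variable {form form' : LinearMap.BilinForm ℂ (FrakA ω)}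

include hab in
lemma Extends.unique (h : Extends hJ (theta hab hV) mul form)
    (hF : IsFrobeniusFor (frakAct (theta hab hV)) mul form)
    (h' : Extends hJ (theta hab hV) mul' form')
    (hF' : IsFrobeniusFor (frakAct (theta hab hV)) mul' form') : mul' = mul ∧ form' = form := by
  constructor
  · refine FrakA.hom_ext_of_inJ (M := FrakA ω →ₗ[ℂ] FrakA ω) hV hab (fun u => ?_) fun ℓ v hv => ?_
    · refine FrakA.hom_ext (N := FrakA ω) (fun v => ?_) (fun α x => ?_) fun μ => ?_
      · rw [h.mul_J, h'.mul_J]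
      · rw [h.mul_perp, h'.mul_perp]
      · rw [h.mul_x, h'.mul_x]
    · refine LinearMap.ext fun w => ?_
      -- Equivariance expresses the product with ℓ·v through products with v, so agreement spreads
      -- from `𝔍` to the submodule it generates.
      have h1 := hF.mul_equivariant ℓ v w
      have h2 := hF'.mul_equivariant ℓ v w
      rw [hv, h1] at h2
      exact (add_right_cancel h2).symm
  · refine FrakA.hom_ext_of_inJ (M := FrakA ω →ₗ[ℂ] ℂ) hV hab (fun u => ?_) fun ℓ v hv => ?_
    · refine FrakA.hom_ext (fun v => ?_) (fun α x => ?_) fun μ => ?_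
      · rw [h.form_J, h'.form_J]
      · rw [h.form_perp, h'.form_perp]
      · rw [h.form_x, h'.form_x]
    · refine LinearMap.ext fun w => ?_
      have h1 := hF.form_equivariant ℓ v w
      have h2 := hF'.form_equivariant ℓ v w
      rw [hv, ← h1] at h2
      exact add_right_cancel h2

end Uniqueness

end SymSquareAlgebra

end

theorem mainTheorem3 {L : Type*} [LieRing L] [LieAlgebra ℂ L] [FiniteDimensional ℂ L]
    [LieAlgebra.IsSimple ℂ L] (H : LieSubalgebra ℂ L) [H.IsCartanSubalgebra]
    (Δ : (rootSystem H).Base) (hΔ : IsADE Δ)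
    (ω : H.root) (hω : IsHighest Δ ω) (C : Chevalley H)
    (a b : Lam₀ H → H.root)
    (hab : ∀ μ, (rootSystem H).root (a μ) + (rootSystem H).root (b μ) = μ.1) :
    ∃ (hV : IsCompl (calA C ω).toSubmodule (calV C ω).toSubmodule)
      (hV₀ : IsCompl (frakA₀ C ω) (frakV C ω))
      (hJ : Function.Bijective (piJ hV₀))
      (θ : FrakA ω ≃ₗ[ℂ] calA C ω),
      IsTheta hV a b θ ∧
      (∀ (α : H.root) (h : perp α),
        ∃ u : frakJ ω, frakAct θ (C.e (negRoot α)) (inPerp ω α h) = inJ ω u) ∧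
      IsFrobeniusFor (calAct C ω) (calMul hV) (calForm C ω) ∧
      ∃ (mul : FrakA ω →ₗ[ℂ] FrakA ω →ₗ[ℂ] FrakA ω) (form : LinearMap.BilinForm ℂ (FrakA ω)),
        Extends hJ θ mul form ∧ IsFrobeniusFor (frakAct θ) mul form ∧
        (∀ (mul' : FrakA ω →ₗ[ℂ] FrakA ω →ₗ[ℂ] FrakA ω)
            (form' : LinearMap.BilinForm ℂ (FrakA ω)),
          Extends hJ θ mul' form' → IsFrobeniusFor (frakAct θ) mul' form' →
            mul' = mul ∧ form' = form) ∧
        IsFrobeniusHom (frakAct θ) mul form (calAct C ω) (calMul hV) (calForm C ω)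
          θ.toLinearMap := by
  have := hΔ.simplyLaced ω
  have hV := isCompl_calA_calV C ω
  have hV₀ := isCompl_frakA₀_frakV C ω
  have hJ := piJ_bijective hV₀
  have hE := extends_frakMul hV hab hV₀ hJ
  have hF := isFrobeniusFor_frakA hV hab
  exact ⟨hV, hV₀, hJ, theta hab hV, isTheta_theta hab hV,
    fun α h => ⟨_, frakAct_inPerp hV hab α h⟩, isFrobeniusFor_calA hV,
    frakMul hV hab, frakForm hV hab, hE, hF,
    fun mul' form' hE' hF' => hE.unique hV hab hJ hF hE' hF', isFrobeniusHom_theta hV hab⟩
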